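/- \textbf{Setting.} Let $\Omega\subset\mathbb R^d$ ($d\ge 1$) be a bounded open set, $T>0$, $\omega=2\pi/T$, $Q=\Omega\times(0,T)$, and let $\sigma,\nu$ be measurable functions of $x\in\Omega$ with $0<\underline\sigma\le\sigma\le\overline\sigma$, $0<\underline\nu\le\nu\le\overline\nu$. Let $\lambda>0$, $\boldsymbol g_d\in[L^2(Q)]^d$, $\underline{\mu_1}=\frac1{\sqrt2}\min\{\underline\nu,\underline\sigma\}$, and let $C_F>0$ be a constant in Friedrichs' inequality $\|w\|_\Omega\le C_F\|\nabla w\|_\Omega$, $w\in H^1_0(\Omega)$. Write $\|\cdot\|,\langle\cdot,\cdot\rangle$ for the norm and inner product of $L^2(Q)$; $\nabla$ and $\nabla\cdot$ are spatial. For $u\in L^2(Q)$ let $u_k^c=\frac2T\int_0^T u\cos(k\omega t)\,dt$, $u_k^s=\frac2T\int_0^T u\sin(k\omega t)\,dt$, $\boldsymbol u_k=(u_k^c,u_k^s)$, $\boldsymbol u_k^\perp=(-u_k^s,u_k^c)$, and $$\|\partial_t^{1/2}u\|^2=\tfrac T2\sum_{k\ge1}k\omega\|\boldsymbol u_k\|_\Omega^2,\qquad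 \int_Q\sigma\,\partial_t^{1/2}u\,\partial_t^{1/2}w^\perp:=\tfrac T2\sum_{k\ge1}k\omega\langle\sigma\boldsymbol u_k,\boldsymbol w_k^\perp\rangle_\Omega ,\qquad |u|_{1,1/2}^2=\|\nabla u\|^2+\|\partial_t^{1/2}u\|^2 .$$ $H^{1,0}_0(Q)$ is the closure of $C_c^\infty(Q)$ in $H^{1,0}(Q)$ (zero lateral boundary values); $H^{1,1/2}_{0,per}(Q)=\{u\in H^{1,0}_0(Q):\|\partial_t^{1/2}u\|<\infty\}$; $H^{1,1}_{0,per}(Q)=\{u\in H^{1,0}_0(Q):\partial_tu\in L^2(Q),\ u(0)=u(T)\}$; $H(\mathrm{div},Q)=\{\boldsymbol\tau\in[L^2(Q)]^d:\nabla\cdot\boldsymbol\tau\in L^2(Q)\}$. For $v\in L^2(Q)$ let $y(v)\in H^{1,1/2}_{0,per}(Q)$ be the weak solution of $\sigma\partial_ty-\nabla\cdot(\nu\nabla y)=v$, i.e. $\int_Q(\nu\nabla y\cdot\nabla q+\sigma\partial_t^{1/2}y\,\partial_t^{1/2}q^\perp)=\langle v,q\rangle$ for all $q\in H^{1,1/2}_{0,per}(Q)$.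 Put $\tilde{\mathcal J}(y,v)=\frac12\|\nabla y-\boldsymbol g_d\|^2+\frac\lambda2\|v\|^2$ and let $u$ be the optimal control, i.e. the minimizer of $v\mapsto\tilde{\mathcal J}(y(v),v)$ over $L^2(Q)$. For $\eta,\zeta\in H^{1,1}_{0,per}(Q)$, $\boldsymbol\tau,\boldsymbol\rho\in H(\mathrm{div},Q)$, $v\in L^2(Q)$, $\alpha,\beta>0$ define $\mathcal R_1(\eta,\boldsymbol\tau,v)=\sigma\partial_t\eta-\nabla\cdot\boldsymbol\tau-v$, $\mathcal R_2(\eta,\boldsymbol\tau)=\boldsymbol\tau-\nu\nabla\eta$, $\mathcal R_3(\zeta,\boldsymbol\rho)=\nabla\cdot\boldsymbol\rho+\sigma\partial_t\zeta$, $\mathcal R_4(\zeta,\boldsymbol\rho,\eta)=\boldsymbol\rho-\nu\nabla\zeta+\nabla\eta-\boldsymbol g_d$, $\gamma=\frac{(1+\alpha)(1+\beta)}{2\alpha\underline{\mu_1}^2}$, and $$\tilde{\mathcal J}^\oplus=\tfrac{1+\alpha}2\|\nabla\eta-\boldsymbol g_d\|^2+\gamma\Big(\|\mathcal R_2\|^2+\tfrac{C_F^2}\beta\|\mathcal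 R_1(\eta,\boldsymbol\tau,v)\|^2\Big)+\tfrac\lambda2\|v\|^2,$$ $$\begin{aligned}\tilde{\mathcal J}^\ominus=&\tfrac12\|\nabla\eta-\boldsymbol g_d\|^2+\tfrac1{2\lambda}\|\zeta\|^2-\int_Q\big(\nu\nabla\eta\cdot\nabla\zeta+\sigma\partial_t\eta\,\zeta+\lambda^{-1}\zeta^2\big)-\tfrac{C_F^2}{\underline{\mu_1}^2\lambda}\big(C_F\|\mathcal R_3\|+\|\mathcal R_4\|\big)^2\\&-\tfrac1{\underline{\mu_1}}\big(C_F\|\mathcal R_1(\eta,\boldsymbol\tau,-\lambda^{-1}\zeta)\|+\|\mathcal R_2\|\big)\big(C_F\|\mathcal R_3\|+\|\mathcal R_4\|\big),\end{aligned}$$ $$\tilde{\mathcal M}^\oplus=\tilde{\mathcal J}^\oplus-\tilde{\mathcal J}^\ominus,\qquad \tilde{\mathcal M}_1^\oplus=\tilde{\mathcal M}^\oplus+\tfrac{3\lambda}{4C_F^2}\big(C_F\|\mathcal R_1(\eta,\boldsymbol\tau,v)\|+\|\mathcal R_2\|\big)^2,$$ $$||||u-v||||^2=\tfrac12\|\nabla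 y(u)-\nabla y(v)\|^2+\tfrac\lambda2\|u-v\|^2,\qquad ||||u-v||||_1^2=\tfrac12\|\nabla y(u)-\nabla y(v)\|^2+\tfrac{\lambda\underline{\mu_1}^2}{2C_F^2}|y(u)-y(v)|_{1,1/2}^2 .$$ \textbf{Claim.} (a) For every $v\in L^2(Q)$ the state $y(v)$ exists and is unique, and so does the optimal control $u$. A pair $(y,u)$ is optimal if and only if $u=-\lambda^{-1}p$ for some $p\in H^{1,1/2}_{0,per}(Q)$ such that, for all $z,q\in H^{1,1/2}_{0,per}(Q)$, $$\int_Q(\nabla y\cdot\nabla z-\nu\nabla p\cdot\nabla z+\sigma\partial_t^{1/2}p\,\partial_t^{1/2}z^\perp)=\int_Q\boldsymbol g_d\cdot\nabla z,\qquad\int_Q(\nu\nabla y\cdot\nabla q+\sigma\partial_t^{1/2}y\,\partial_t^{1/2}q^\perp+\lambda^{-1}pq)=0 .$$ (b) For every $v\in L^2(Q)$: $||||u-v||||^2=\tilde{\mathcal J}(y(v),v)-\tilde{\mathcal J}(y(u),u)$. (c) For all $v\in L^2(Q)$, $\eta,\zeta\in H^{1,1}_{0,per}(Q)$, $\boldsymbol\tau,\boldsymbol\rho\in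 H(\mathrm{div},Q)$, $\alpha,\beta>0$: $$||||u-v||||^2\le\tilde{\mathcal M}^\oplus(\alpha,\beta;\eta,\zeta,\boldsymbol\tau,\boldsymbol\rho,v),\qquad ||||u-v||||_1^2\le\tilde{\mathcal M}_1^\oplus(\alpha,\beta;\eta,\zeta,\boldsymbol\tau,\boldsymbol\rho,v),$$ where $$\begin{aligned}\tilde{\mathcal M}^\oplus=&\tfrac\alpha2\|\nabla\eta-\boldsymbol g_d\|^2+\gamma\Big(\|\mathcal R_2\|^2+\tfrac{C_F^2}\beta\|\mathcal R_1(\eta,\boldsymbol\tau,v)\|^2\Big)+\tfrac\lambda2\|v\|^2-\tfrac1{2\lambda}\|\zeta\|^2+\int_Q\big(\nu\nabla\eta\cdot\nabla\zeta+\sigma\partial_t\eta\,\zeta+\lambda^{-1}\zeta^2\big)\\&+\tfrac{C_F^2}{\underline{\mu_1}^2\lambda}\big(C_F\|\mathcal R_3\|+\|\mathcal R_4\|\big)^2+\tfrac1{\underline{\mu_1}}\big(C_F\|\mathcal R_1(\eta,\boldsymbol\tau,-\lambda^{-1}\zeta)\|+\|\mathcal R_2\|\big)\big(C_F\|\mathcal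 R_3\|+\|\mathcal R_4\|\big).\end{aligned}$$ (d) $\inf\tilde{\mathcal M}^\oplus=0$ and $\inf\tilde{\mathcal M}_1^\oplus=0$, the infima being over all $\eta,\zeta\in H^{1,1}_{0,per}(Q)$, $\boldsymbol\tau,\boldsymbol\rho\in H(\mathrm{div},Q)$, $v\in L^2(Q)$, $\alpha,\beta>0$. They are reached at the solution of the optimality system as $\alpha\to0$: $y(u)\in H^{1,1}_{0,per}(Q)$ and $\nu\nabla y(u)\in H(\mathrm{div},Q)$, and, with $v=u$, $\eta=y(u)$, $\boldsymbol\tau=\nu\nabla y(u)$ and $\boldsymbol\rho^*=\nu\nabla p-(\nabla y(u)-\boldsymbol g_d)$ (equivalently, $\boldsymbol\rho^*+\nabla\eta-\boldsymbol g_d=\nu\nabla p$): if $p\in H^{1,1}_{0,per}(Q)$, then $\boldsymbol\rho^*\in H(\mathrm{div},Q)$, and for $\zeta=p$, $\boldsymbol\rho=\boldsymbol\rho^*$ both majorants equal $\frac\alpha2\|\nabla y(u)-\boldsymbol g_d\|^2$ for all $\alpha,\beta>0$. In general there are $\zeta_n\in H^{1,1}_{0,per}(Q)$, $\boldsymbol\rho_n\in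 H(\mathrm{div},Q)$ with $\zeta_n\to p$, $\nabla\zeta_n\to\nabla p$, $\boldsymbol\rho_n\to\boldsymbol\rho^*$ in $L^2(Q)$ along which both majorants converge to $\frac\alpha2\|\nabla y(u)-\boldsymbol g_d\|^2$ for all $\alpha,\beta>0$. -/

import Mathlib

open MeasureTheory Set Filter Topology
open scoped ContDiff

noncomputable section

/-- Data of the time-periodic parabolic problem
`σ ∂ₜy - ∇·(ν ∇y) = v` in `Q = Ω × (0,T)`, `y = 0` on `∂Ω × (0,T)`, `y(0) = y(T)`. -/
structure ParabolicProblem (d : ℕ) where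
  Ω : Set (EuclideanSpace ℝ (Fin d))
  isOpen_Ω : IsOpen Ω
  isBounded_Ω : Bornology.IsBounded Ω
  T : ℝ
  T_pos : 0 < T
  σ : EuclideanSpace ℝ (Fin d) → ℝ
  ν : EuclideanSpace ℝ (Fin d) → ℝ
  measurable_σ : Measurable σ
  measurable_ν : Measurable ν
  σlo : ℝ
  σhi : ℝ
  νlo : ℝ
  νhi : ℝ
  σlo_pos : 0 < σlo
  νlo_pos : 0 < νlo
  σ_bounds : ∀ x ∈ Ω, σlo ≤ σ x ∧ σ x ≤ σhi
  ν_bounds : ∀ x ∈ Ω, νlo ≤ ν x ∧ ν x ≤ νhi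

namespace ParabolicProblem

variable {d : ℕ} (P : ParabolicProblem d)

/-- The space-time cylinder `Q = Ω × (0,T)`. -/
def Q : Set (EuclideanSpace ℝ (Fin d) × ℝ) := P.Ω ×ˢ Ioo 0 P.T

/-- Lebesgue measure on `Q`. -/
def μQ : Measure (EuclideanSpace ℝ (Fin d) × ℝ) := volume.restrict P.Q

/-- `L²(Q)` -/
abbrev L2Q : Type := Lp ℝ 2 P.μQ

/-- `[L²(Q)]^d` -/
abbrev L2Qd : Type := Lp (EuclideanSpace ℝ (Fin d)) 2 P.μQ

/-- `L²(Ω)` -/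
abbrev L2Ω : Type := Lp ℝ 2 (volume.restrict P.Ω)

/-! ### Multiplication by the coefficients -/

theorem memLp_coeff_smul {F : Type*} [NormedAddCommGroup F] [NormedSpace ℝ F]
    {c : EuclideanSpace ℝ (Fin d) → ℝ} {lo hi : ℝ} (hc : Measurable c) (hlo : 0 < lo)
    (hb : ∀ x ∈ P.Ω, lo ≤ c x ∧ c x ≤ hi) (f : Lp F 2 P.μQ) :
    MemLp (fun z => c z.1 • f z) 2 P.μQ := by
  refine (Lp.memLp f).of_le_mul (c := hi)
    ((hc.comp measurable_fst).aestronglyMeasurable.smul (Lp.aestronglyMeasurable f)) ?_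
  have hQ : MeasurableSet P.Q := P.isOpen_Ω.measurableSet.prod measurableSet_Ioo
  filter_upwards [(ae_restrict_mem hQ : ∀ᵐ z ∂P.μQ, z ∈ P.Q)] with z hz
  obtain ⟨h1, h2⟩ := hb z.1 hz.1
  rw [norm_smul, Real.norm_of_nonneg (hlo.le.trans h1)]
  exact mul_le_mul_of_nonneg_right h2 (norm_nonneg _)

/-- The function `σ w` for `w ∈ L²(Q)`. -/
def mulσ (w : P.L2Q) : P.L2Q :=
  (P.memLp_coeff_smul P.measurable_σ P.σlo_pos P.σ_bounds w).toLp _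

/-- The vector field `ν G` for `G ∈ [L²(Q)]^d`. -/
def mulν (G : P.L2Qd) : P.L2Qd :=
  (P.memLp_coeff_smul P.measurable_ν P.νlo_pos P.ν_bounds G).toLp _

/-! ### Test functions and Sobolev-type spaces on `Q` -/

/-- Spatial gradient of a function of `(x,t)`. -/
def gradX (φ : EuclideanSpace ℝ (Fin d) × ℝ → ℝ) (z : EuclideanSpace ℝ (Fin d) × ℝ) :
    EuclideanSpace ℝ (Fin d) :=
  gradient (fun x => φ (x, z.2)) z.1

/-- Time derivative of a function of `(x,t)`. -/
def derivT (φ : EuclideanSpace ℝ (Fin d) × ℝ → ℝ) (z : EuclideanSpace ℝ (Fin d) × ℝ) : ℝ :=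
  deriv (fun t => φ (z.1, t)) z.2

/-- `φ ∈ C_c^∞(U)` for a subset `U` of space-time. -/
def IsTestOn (U : Set (EuclideanSpace ℝ (Fin d) × ℝ))
    (φ : EuclideanSpace ℝ (Fin d) × ℝ → ℝ) : Prop :=
  ContDiff ℝ ∞ φ ∧ HasCompactSupport φ ∧ tsupport φ ⊆ U

/-- The pairs `(φ, ∇φ)`, `φ ∈ C_c^∞(Q)`, in `L²(Q) × [L²(Q)]^d`. -/
def testPairs : Set (P.L2Q × P.L2Qd) :=
  {w | ∃ φ, IsTestOn P.Q φ ∧ (w.1 : _ → ℝ) =ᵐ[P.μQ] φ ∧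
    (w.2 : _ → EuclideanSpace ℝ (Fin d)) =ᵐ[P.μQ] gradX φ}

/-- `u ∈ H^{1,0}_0(Q)` with weak spatial gradient `G`: the space `H^{1,0}_0(Q)`, i.e.
`L²(0,T; H¹₀(Ω))`, is the closure of `C_c^∞(Q)` in the norm of `H^{1,0}(Q)`. -/
def MemH10Zero (u : P.L2Q) (G : P.L2Qd) : Prop := (u, G) ∈ closure P.testPairs

/-- `w ∈ L²(Q)` is the weak time derivative of `u ∈ L²(Q)`, and `a, b ∈ L²(Ω)` are the traces
`u(0) = a`, `u(T) = b`. All this is expressed by integration by parts in time against smooth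
functions with compact support in `Ω × ℝ` (those supported in `Ω × (0,T)` say that `w = ∂ₜu`,
the others see the values of `u` at the two ends). -/
def HasTimeDerivWithTraces (u w : P.L2Q) (a b : P.L2Ω) : Prop :=
  ∀ φ, IsTestOn (P.Ω ×ˢ univ) φ →
    ∫ z, u z * derivT φ z ∂P.μQ =
      (∫ x in P.Ω, b x * φ (x, P.T)) - (∫ x in P.Ω, a x * φ (x, 0)) - ∫ z, w z * φ z ∂P.μQ

/-- `u ∈ H^{0,1}_per(Q)` with `∂ₜu = w`: the traces `u(0)` and `u(T)` coincide. -/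
def HasPeriodicTimeDeriv (u w : P.L2Q) : Prop :=
  ∃ a : P.L2Ω, P.HasTimeDerivWithTraces u w a a

/-- `q ∈ L²(Q)` is the weak spatial divergence of `τ ∈ [L²(Q)]^d`. -/
def HasWeakDiv (τ : P.L2Qd) (q : P.L2Q) : Prop :=
  ∀ φ, IsTestOn P.Q φ → ∫ z, q z * φ z ∂P.μQ = - ∫ z, inner ℝ (τ z) (gradX φ z) ∂P.μQ

/-! ### Fourier coefficients and half time derivatives -/

/-- `ω = 2π/T` -/
def freq : ℝ := 2 * Real.pi / P.T

/-- `u_k^c(x) = (2/T) ∫₀ᵀ u(x,t) cos(kωt) dt` (used for `k ≥ 1`). -/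
def fourierCos (u : P.L2Q) (k : ℕ) (x : EuclideanSpace ℝ (Fin d)) : ℝ :=
  2 / P.T * ∫ t in Ioo 0 P.T, u (x, t) * Real.cos (k * P.freq * t)

/-- `u_k^s(x) = (2/T) ∫₀ᵀ u(x,t) sin(kωt) dt` (used for `k ≥ 1`). -/
def fourierSin (u : P.L2Q) (k : ℕ) (x : EuclideanSpace ℝ (Fin d)) : ℝ :=
  2 / P.T * ∫ t in Ioo 0 P.T, u (x, t) * Real.sin (k * P.freq * t)

/-- `kω ‖(u_k^c, u_k^s)‖²_Ω`; it vanishes for `k = 0`. -/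
def halfTerm (u : P.L2Q) (k : ℕ) : ℝ :=
  k * P.freq * ∫ x in P.Ω, ((P.fourierCos u k x) ^ 2 + (P.fourierSin u k x) ^ 2)

/-- `‖∂ₜ^{1/2} u‖² = (T/2) ∑_{k ≥ 1} kω ‖(u_k^c, u_k^s)‖²_Ω` (a real number if the series
converges). -/
def halfNormSq (u : P.L2Q) : ℝ := P.T / 2 * ∑' k : ℕ, P.halfTerm u k

/-- `∫_Q σ ∂ₜ^{1/2} y ∂ₜ^{1/2} q^⊥ = (T/2) ∑_{k ≥ 1} kω ⟨σ y_k, q_k^⊥⟩_Ω` with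
`y_k = (y_k^c, y_k^s)` and `q_k^⊥ = (-q_k^s, q_k^c)`; for `y ∈ H^{0,1}_per(Q)` this is
`∫_Q σ ∂ₜy q`. -/
def halfForm (y q : P.L2Q) : ℝ :=
  P.T / 2 * ∑' k : ℕ, k * P.freq * ∫ x in P.Ω, P.σ x *
    (P.fourierCos y k x * (-P.fourierSin q k x) + P.fourierSin y k x * P.fourierCos q k x)

/-! ### Bundled function spaces -/

/-- The space `H^{1,1/2}_{0,per}(Q)`; the gradient is determined by `val`. -/
structure HHalf where
  val : P.L2Q
  grad : P.L2Qd
  mem_zero : P.MemH10Zero val grad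
  half_finite : Summable (P.halfTerm val)

/-- The space `H^{1,1}_{0,per}(Q)`; gradient and time derivative are determined by `val`. -/
structure HOne where
  val : P.L2Q
  grad : P.L2Qd
  dt : P.L2Q
  mem_zero : P.MemH10Zero val grad
  periodic : P.HasPeriodicTimeDeriv val dt

/-- The space `H(div,Q)`; the (spatial) divergence is determined by `val`. -/
structure HDiv where
  val : P.L2Qd
  div : P.L2Q
  hasDiv : P.HasWeakDiv val div

/-! ### State equation, cost functional, optimality -/

/-- `∫_Q (ν ∇y·∇q + σ ∂ₜ^{1/2} y ∂ₜ^{1/2} q^⊥)` -/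
def stateForm (y q : P.HHalf) : ℝ :=
  inner ℝ (P.mulν y.grad) q.grad + P.halfForm y.val q.val

/-- `y = y(v)`: `y ∈ H^{1,1/2}_{0,per}(Q)` is the weak solution of the state equation with
control `v ∈ L²(Q)`. -/
def IsState (v : P.L2Q) (y : P.HHalf) : Prop :=
  ∀ q : P.HHalf, P.stateForm y q = inner ℝ v q.val

/-- The cost functional `½‖∇y - g_d‖² + (λ/2)‖u‖²`. -/
def cost (gd : P.L2Qd) (lam : ℝ) (y : P.HHalf) (u : P.L2Q) : ℝ :=
  1 / 2 * ‖y.grad - gd‖ ^ 2 + lam / 2 * ‖u‖ ^ 2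

/-- `u` is an optimal control of problem II and `y = y(u)` its state. -/
def IsOptimal (gd : P.L2Qd) (lam : ℝ) (y : P.HHalf) (u : P.L2Q) : Prop :=
  P.IsState u y ∧ ∀ (w : P.L2Q) (z : P.HHalf), P.IsState w z → P.cost gd lam y u ≤ P.cost gd lam z w

/-- The optimality system of problem II for the state `y` and the adjoint state `p`. -/
def OptimalitySystem (gd : P.L2Qd) (lam : ℝ) (y p : P.HHalf) : Prop :=
  (∀ z : P.HHalf, inner ℝ y.grad z.grad - inner ℝ (P.mulν p.grad) z.grad + P.halfForm p.val z.val =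
    inner ℝ gd z.grad) ∧
  (∀ q : P.HHalf, P.stateForm y q + lam⁻¹ * inner ℝ p.val q.val = 0)

/-- `C_F > 0` is a constant in Friedrichs' inequality `‖φ‖_Ω ≤ C_F ‖∇φ‖_Ω`. It is required on the
dense subspace `C_c^∞(Ω)` of `H¹₀(Ω)`. -/
def IsFriedrichsConstant (CF : ℝ) : Prop :=
  0 < CF ∧ ∀ φ : EuclideanSpace ℝ (Fin d) → ℝ, ContDiff ℝ ∞ φ → HasCompactSupport φ →
    tsupport φ ⊆ P.Ω → ∫ x in P.Ω, (φ x) ^ 2 ≤ CF ^ 2 * ∫ x in P.Ω, ‖gradient φ x‖ ^ 2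

/-! ### Error measures, residuals, majorant and minorant -/

/-- `μ₁ = min{ν_lo, σ_lo}/√2` -/
def μ₁ : ℝ := 1 / Real.sqrt 2 * min P.νlo P.σlo

/-- `½‖∇y - ∇z‖² + (λ/2)‖u - v‖²` for the controls `u, v` with states `y, z`. -/
def errSq (lam : ℝ) (y : P.HHalf) (u : P.L2Q) (z : P.HHalf) (v : P.L2Q) : ℝ :=
  1 / 2 * ‖y.grad - z.grad‖ ^ 2 + lam / 2 * ‖u - v‖ ^ 2

/-- `½‖∇y - ∇z‖² + (λ μ₁²/(2 C_F²)) |y - z|²_{1,1/2}` with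
`|w|²_{1,1/2} = ‖∇w‖² + ‖∂ₜ^{1/2} w‖²`. -/
def errOneSq (lam CF : ℝ) (y z : P.HHalf) : ℝ :=
  1 / 2 * ‖y.grad - z.grad‖ ^ 2 + lam * P.μ₁ ^ 2 / (2 * CF ^ 2) *
    (‖y.grad - z.grad‖ ^ 2 + P.halfNormSq (y.val - z.val))

/-- `R₁(η,τ,v) = σ ∂ₜη - ∇·τ - v` -/
def R₁ (η : P.HOne) (τ : P.HDiv) (v : P.L2Q) : P.L2Q := P.mulσ η.dt - τ.div - v

/-- `R₂(η,τ) = τ - ν ∇η` -/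
def R₂ (η : P.HOne) (τ : P.HDiv) : P.L2Qd := τ.val - P.mulν η.grad

/-- `R₃(ζ,ρ) = ∇·ρ + σ ∂ₜζ` -/
def R₃ (ζ : P.HOne) (ρ : P.HDiv) : P.L2Q := ρ.div + P.mulσ ζ.dt

/-- `R₄(ζ,ρ,η) = ρ - ν ∇ζ + ∇η - g_d` -/
def R₄ (gd : P.L2Qd) (ζ : P.HOne) (ρ : P.HDiv) (η : P.HOne) : P.L2Qd :=
  ρ.val - P.mulν ζ.grad + η.grad - gd

/-- `γ = (1+α)(1+β)/(2 α μ₁²)` -/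
def γ (α β : ℝ) : ℝ := (1 + α) * (1 + β) / (2 * α * P.μ₁ ^ 2)

/-- The majorant of the cost functional. -/
def Jplus (gd : P.L2Qd) (lam CF α β : ℝ) (η : P.HOne) (τ : P.HDiv) (v : P.L2Q) : ℝ :=
  (1 + α) / 2 * ‖η.grad - gd‖ ^ 2 +
    P.γ α β * (‖P.R₂ η τ‖ ^ 2 + CF ^ 2 / β * ‖P.R₁ η τ v‖ ^ 2) + lam / 2 * ‖v‖ ^ 2

/-- `∫_Q (ν ∇η·∇ζ + σ ∂ₜη ζ + λ⁻¹ ζ²)` -/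
def crossTerm (lam : ℝ) (η ζ : P.HOne) : ℝ :=
  inner ℝ (P.mulν η.grad) ζ.grad + inner ℝ (P.mulσ η.dt) ζ.val + lam⁻¹ * ‖ζ.val‖ ^ 2

/-- `C_F ‖R₁‖ + ‖R₂‖` -/
def stateRes (CF : ℝ) (η : P.HOne) (τ : P.HDiv) (v : P.L2Q) : ℝ :=
  CF * ‖P.R₁ η τ v‖ + ‖P.R₂ η τ‖

/-- `C_F ‖R₃‖ + ‖R₄‖` -/
def adjointRes (gd : P.L2Qd) (CF : ℝ) (ζ : P.HOne) (ρ : P.HDiv) (η : P.HOne) : ℝ :=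
  CF * ‖P.R₃ ζ ρ‖ + ‖P.R₄ gd ζ ρ η‖

/-- The minorant of the cost functional. -/
def Jminus (gd : P.L2Qd) (lam CF : ℝ) (η ζ : P.HOne) (τ ρ : P.HDiv) : ℝ :=
  1 / 2 * ‖η.grad - gd‖ ^ 2 + 1 / (2 * lam) * ‖ζ.val‖ ^ 2 - P.crossTerm lam η ζ
    - CF ^ 2 / (P.μ₁ ^ 2 * lam) * (P.adjointRes gd CF ζ ρ η) ^ 2
    - 1 / P.μ₁ * P.stateRes CF η τ (-(lam⁻¹ • ζ.val)) * P.adjointRes gd CF ζ ρ η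

/-- The error majorant: majorant minus minorant of the cost functional. -/
def Maj (gd : P.L2Qd) (lam CF α β : ℝ) (η ζ : P.HOne) (τ ρ : P.HDiv) (v : P.L2Q) : ℝ :=
  P.Jplus gd lam CF α β η τ v - P.Jminus gd lam CF η ζ τ ρ

/-- The error majorant for the weighted `H¹`-type error measure. -/
def MajOne (gd : P.L2Qd) (lam CF α β : ℝ) (η ζ : P.HOne) (τ ρ : P.HDiv) (v : P.L2Q) : ℝ :=
  P.Jplus gd lam CF α β η τ v - P.Jminus gd lam CF η ζ τ ρ
    + 3 * lam / (4 * CF ^ 2) * (P.stateRes CF η τ v) ^ 2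

end ParabolicProblem

end

noncomputable section

/-! Everything rests on the Fourier expansion in time. The real trigonometric system is orthonormal
and complete in L²(0,T), so L²(Q) is a Hilbert sum of copies of L²(Ω) (`isHilbertSum_tens`). In the
coefficients `coef n`, a periodic time derivative acts by u_n ↦ nω u_{-n}, the half derivative by
multiplication with √(|n|ω) (`HasHalf`), and u ↦ u^⊥ is a Hilbert transform `hilb`. The half-order
form becomes ⟨σ h_y, h_q^⊥⟩ for the half derivatives h (`HasHalf.halfForm_eq`). Since σ and ν do not
depend on time, they commute with all these operations. So does membership in H^{1,0}_0(Q), which is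
shown by duality: that space is the annihilator of the pairs (τ, ∇·τ) (`memH10Zero_iff`), and weak
divergences are stable under operations on time coefficients.

The transform is skew-adjoint, hence ⟨c u, u^⊥⟩ = 0 for every coefficient c. Testing the state form
of w with w - w^⊥ therefore leaves ⟨ν∇w,∇w⟩ + ⟨σh,h⟩, while the test gradient has norm at most
√2‖∇w‖; this is the inf-sup condition with constant μ₁ (`HHalf.inf_sup`). The same twist, put on the
trial side, makes the form coercive, and Lax–Milgram solves the state and adjoint equations
(`exists_solution`). The control problem is then a strictly convex quadratic minimization: its Euler
equation is the optimality system, and the second-order part of the cost is exactly the error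
measure (`FirstOrder.errSq_eq`).

For the majorant, integration by parts against τ shows that y(v) - η solves the state equation with
the residuals as data; the inf-sup condition and two Young inequalities bound the cost from above
(`IsState.cost_le_Jplus`). For the minorant, the cost is expanded about η, the linear term is
rewritten through the adjoint residuals and the state form tested with ζ, and the square of u + λ⁻¹ζ
absorbs what remains (`IsState.Jminus_le_cost`). The second error measure is already bounded by the
first one through stability of the state (`errOneSq_le_errSq`), so the additional term of the second
majorant only enlarges the bound.

For sharpness, testing the state equation with truncated time derivatives of y kills the elliptic
part and yields ∂ₜy ∈ L²(Q) (`IsState.exists_timeDeriv`), so y and its flux are admissible and the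
state residuals vanish. The adjoint equation has only the divergence of an L² field as datum, so p
may fail to have a time derivative in L². Truncating its Fourier series, together with the flux ν∇p
- (∇y - g_d), keeps R₃ = 0 exactly and makes R₄ tend to 0 (`OptimalitySystem.exists_tendsto`). -/

theorem inner_toLp_right {α F : Type*} [MeasurableSpace α] {μ : Measure α}
    [NormedAddCommGroup F] [InnerProductSpace ℝ F] (f : Lp F 2 μ) {g : α → F} (hg : MemLp g 2 μ) :
    inner ℝ f (hg.toLp g) = ∫ z, inner ℝ (f z) (g z) ∂μ := by
  rw [L2.inner_def]
  refine integral_congr_ae ?_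
  filter_upwards [hg.coeFn_toLp] with z hz
  rw [hz]

theorem integrable_inner_of_memLp {α F : Type*} [MeasurableSpace α] {μ : Measure α}
    [NormedAddCommGroup F] [InnerProductSpace ℝ F] (f : Lp F 2 μ) {g : α → F} (hg : MemLp g 2 μ) :
    Integrable (fun z => inner ℝ (f z) (g z)) μ := by
  refine (L2.integrable_inner (𝕜 := ℝ) f (hg.toLp g)).congr ?_
  filter_upwards [hg.coeFn_toLp] with z hz
  rw [hz]

theorem inner_toLp_left {α F : Type*} [MeasurableSpace α] {μ : Measure α}
    [NormedAddCommGroup F] [InnerProductSpace ℝ F] {g : α → F} (hg : MemLp g 2 μ) (f : Lp F 2 μ) :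
    inner ℝ (hg.toLp g) f = ∫ z, inner ℝ (g z) (f z) ∂μ := by
  rw [real_inner_comm, inner_toLp_right]
  simp_rw [real_inner_comm]

namespace ParabolicProblem

variable {d : ℕ} (P : ParabolicProblem d)

/-! ### The product structure of Lebesgue measure on the cylinder -/

/-- Lebesgue measure on `Ω`. -/
abbrev μΩ : Measure (EuclideanSpace ℝ (Fin d)) := volume.restrict P.Ω

/-- Lebesgue measure on `(0,T)`. -/
abbrev μI : Measure ℝ := volume.restrict (Ioo 0 P.T)

theorem μQ_eq : P.μQ = P.μΩ.prod P.μI := by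
  rw [μQ, Q, Measure.volume_eq_prod, Measure.prod_restrict]

instance : IsFiniteMeasure P.μΩ :=
  ⟨by rw [Measure.restrict_apply_univ]; exact P.isBounded_Ω.measure_lt_top⟩

instance : IsFiniteMeasure P.μI :=
  ⟨by rw [Measure.restrict_apply_univ]; exact measure_Ioo_lt_top⟩

instance : IsFiniteMeasure P.μQ := by
  rw [μQ_eq]; infer_instance

theorem isOpen_Q : IsOpen P.Q := P.isOpen_Ω.prod isOpen_Ioo

/-! ### Test functions -/

variable {P}

theorem gradX_eq {φ : EuclideanSpace ℝ (Fin d) × ℝ → ℝ} (h : ContDiff ℝ ∞ φ)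
    (z : EuclideanSpace ℝ (Fin d) × ℝ) :
    gradX φ z = (InnerProductSpace.toDual ℝ _).symm
      ((fderiv ℝ φ z).comp (ContinuousLinearMap.inl ℝ _ ℝ)) := by
  have h1 : HasFDerivAt φ (fderiv ℝ φ z) (z.1, z.2) :=
    (h.differentiable (by simp) z).hasFDerivAt
  have h2 : HasFDerivAt (fun x => φ (x, z.2))
      ((fderiv ℝ φ z).comp (ContinuousLinearMap.inl ℝ _ ℝ)) z.1 :=
    HasFDerivAt.comp (f := fun x => (x, z.2)) z.1 h1 (hasFDerivAt_prodMk_left z.1 z.2)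
  exact h2.hasGradientAt.gradient

theorem derivT_eq {φ : EuclideanSpace ℝ (Fin d) × ℝ → ℝ} (h : ContDiff ℝ ∞ φ)
    (z : EuclideanSpace ℝ (Fin d) × ℝ) : derivT φ z = fderiv ℝ φ z (0, 1) := by
  have h1 : HasFDerivAt φ (fderiv ℝ φ z) (z.1, z.2) :=
    (h.differentiable (by simp) z).hasFDerivAt
  have h2 := h1.comp z.2 (hasFDerivAt_prodMk_right z.1 z.2)
  rw [derivT, ← fderiv_apply_one_eq_deriv]
  erw [h2.fderiv]
  simp

theorem hasDerivAt_derivT {φ : EuclideanSpace ℝ (Fin d) × ℝ → ℝ} (h : ContDiff ℝ ∞ φ)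
    (x : EuclideanSpace ℝ (Fin d)) (t : ℝ) :
    HasDerivAt (fun s => φ (x, s)) (derivT φ (x, t)) t := by
  have : Differentiable ℝ (fun s => φ (x, s)) :=
    (h.differentiable (by simp)).comp (by fun_prop)
  exact (this t).hasDerivAt

theorem gradX_smul_left (a : EuclideanSpace ℝ (Fin d) → ℝ) (ha : ContDiff ℝ ∞ a) (b : ℝ → ℝ)
    (z : EuclideanSpace ℝ (Fin d) × ℝ) :
    gradX (fun z => b z.2 * a z.1) z = b z.2 • gradient a z.1 := by
  have h1 : HasFDerivAt a (fderiv ℝ a z.1) z.1 := (ha.differentiable (by simp) _).hasFDerivAt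
  have h2 : HasFDerivAt (fun x => b z.2 * a x) (b z.2 • fderiv ℝ a z.1) z.1 := h1.const_mul _
  rw [gradX, h2.hasGradientAt.gradient, h1.hasGradientAt.gradient, map_smul]

section
variable {U : Set (EuclideanSpace ℝ (Fin d) × ℝ)} {φ ψ : EuclideanSpace ℝ (Fin d) × ℝ → ℝ}

theorem continuous_gradX (h : ContDiff ℝ ∞ φ) : Continuous (gradX φ) := by
  rw [funext (gradX_eq h)]
  have := h.continuous_fderiv (by simp)
  exact ((InnerProductSpace.toDual ℝ (EuclideanSpace ℝ (Fin d))).symm.continuous).comp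
    (this.clm_comp continuous_const)

theorem continuous_derivT (h : ContDiff ℝ ∞ φ) : Continuous (derivT φ) := by
  rw [funext (derivT_eq h)]
  have := h.continuous_fderiv (by simp)
  exact this.clm_apply continuous_const

theorem IsTestOn.hasCompactSupport_gradX (h : IsTestOn U φ) : HasCompactSupport (gradX φ) := by
  refine (h.2.1.fderiv (𝕜 := ℝ)).mono fun z hz h0 => hz ?_
  rw [gradX_eq h.1, h0, ContinuousLinearMap.zero_comp, map_zero]

theorem IsTestOn.hasCompactSupport_derivT (h : IsTestOn U φ) : HasCompactSupport (derivT φ) := by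
  refine (h.2.1.fderiv (𝕜 := ℝ)).mono fun z hz h0 => hz ?_
  rw [derivT_eq h.1, h0, zero_apply]

theorem IsTestOn.memLp (h : IsTestOn U φ) : MemLp φ 2 P.μQ :=
  h.1.continuous.memLp_of_hasCompactSupport h.2.1

theorem IsTestOn.memLp_gradX (h : IsTestOn U φ) : MemLp (gradX φ) 2 P.μQ :=
  (continuous_gradX h.1).memLp_of_hasCompactSupport h.hasCompactSupport_gradX

theorem IsTestOn.memLp_derivT (h : IsTestOn U φ) : MemLp (derivT φ) 2 P.μQ :=
  (continuous_derivT h.1).memLp_of_hasCompactSupport h.hasCompactSupport_derivT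

theorem IsTestOn.add (h : IsTestOn U φ) (h' : IsTestOn U ψ) : IsTestOn U (φ + ψ) :=
  ⟨h.1.add h'.1, h.2.1.add h'.2.1, (tsupport_add φ ψ).trans (union_subset h.2.2 h'.2.2)⟩

theorem IsTestOn.smul (c : ℝ) (h : IsTestOn U φ) : IsTestOn U (c • φ) :=
  ⟨h.1.const_smul c, h.2.1.smul_left (f := fun _ => c),
    (tsupport_smul_subset_right (fun _ => c) φ).trans h.2.2⟩

theorem isTestOn_zero : IsTestOn U (0 : EuclideanSpace ℝ (Fin d) × ℝ → ℝ) :=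
  ⟨contDiff_const, HasCompactSupport.zero, by simp [tsupport]⟩

theorem gradX_add (h : ContDiff ℝ ∞ φ) (h' : ContDiff ℝ ∞ ψ) :
    gradX (φ + ψ) = gradX φ + gradX ψ := by
  funext z
  have hs : ContDiff ℝ ∞ (φ + ψ) := h.add h'
  rw [Pi.add_apply, gradX_eq h, gradX_eq h', gradX_eq hs, ← map_add,
    fderiv_add (h.differentiable (by simp) z) (h'.differentiable (by simp) z),
    ContinuousLinearMap.add_comp]

theorem gradX_smul (c : ℝ) (h : ContDiff ℝ ∞ φ) : gradX (c • φ) = c • gradX φ := by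
  funext z
  have hs : ContDiff ℝ ∞ (c • φ) := h.const_smul c
  rw [Pi.smul_apply, gradX_eq h, gradX_eq hs, ← map_smul,
    fderiv_const_smul (h.differentiable (by simp) z), ContinuousLinearMap.smul_comp]

end

/-! ### Duality between `H^{1,0}_0(Q)` and weak divergences -/

variable (P)

/-- `testPairs` as a subspace of a Hilbert space. -/
def testSubmodule : Submodule ℝ (WithLp 2 (P.L2Q × P.L2Qd)) where
  carrier := {w | (w.fst, w.snd) ∈ P.testPairs}
  zero_mem' := by
    refine ⟨0, isTestOn_zero, Lp.coeFn_zero _ _ _, ?_⟩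
    have h0 : gradX (0 : EuclideanSpace ℝ (Fin d) × ℝ → ℝ) = 0 := by
      simpa using gradX_smul 0 (φ := (0 : EuclideanSpace ℝ (Fin d) × ℝ → ℝ)) contDiff_const
    rw [h0]
    exact Lp.coeFn_zero _ _ _
  add_mem' := by
    rintro a b ⟨φ, hφ, h1, h2⟩ ⟨ψ, hψ, h3, h4⟩
    refine ⟨φ + ψ, hφ.add hψ, ?_, ?_⟩
    · exact (Lp.coeFn_add _ _).trans (h1.add h3)
    · rw [gradX_add hφ.1 hψ.1]
      exact (Lp.coeFn_add _ _).trans (h2.add h4)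
  smul_mem' := by
    rintro c a ⟨φ, hφ, h1, h2⟩
    refine ⟨c • φ, hφ.smul c, ?_, ?_⟩
    · exact (Lp.coeFn_smul _ _).trans (h1.const_smul c)
    · rw [gradX_smul c hφ.1]
      exact (Lp.coeFn_smul _ _).trans (h2.const_smul c)

variable {P}

theorem memH10Zero_of_test {φ : EuclideanSpace ℝ (Fin d) × ℝ → ℝ} (h : IsTestOn P.Q φ) :
    P.MemH10Zero (h.memLp.toLp φ) (h.memLp_gradX.toLp _) :=
  subset_closure ⟨φ, h, h.memLp.coeFn_toLp, h.memLp_gradX.coeFn_toLp⟩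

theorem hasWeakDiv_iff_inner {τ : P.L2Qd} {q : P.L2Q} : P.HasWeakDiv τ q ↔
    ∀ φ (h : IsTestOn P.Q φ),
      inner ℝ q (h.memLp.toLp φ) + inner ℝ τ (h.memLp_gradX.toLp (gradX φ)) = 0 := by
  refine forall₂_congr fun φ h => ?_
  rw [inner_toLp_right, inner_toLp_right, eq_neg_iff_add_eq_zero]
  simp only [RCLike.inner_apply, conj_trivial, mul_comm]

theorem hasWeakDiv_iff_testPairs {τ : P.L2Qd} {q : P.L2Q} : P.HasWeakDiv τ q ↔
    ∀ w ∈ P.testPairs, inner ℝ q w.1 + inner ℝ τ w.2 = 0 := by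
  rw [hasWeakDiv_iff_inner]
  constructor
  · rintro h w ⟨φ, hφ, h1, h2⟩
    rw [← h φ hφ]
    congr 2
    · exact Lp.ext (h1.trans hφ.memLp.coeFn_toLp.symm)
    · exact Lp.ext (h2.trans hφ.memLp_gradX.coeFn_toLp.symm)
  · intro h φ hφ
    exact h (_, _) ⟨φ, hφ, hφ.memLp.coeFn_toLp, hφ.memLp_gradX.coeFn_toLp⟩

/-- The integration by parts formula on `H^{1,0}_0(Q)`. -/
theorem MemH10Zero.inner_add_eq_zero {u : P.L2Q} {G : P.L2Qd} (h : P.MemH10Zero u G)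
    {τ : P.L2Qd} {q : P.L2Q} (hτ : P.HasWeakDiv τ q) : inner ℝ q u + inner ℝ τ G = 0 := by
  have hc : IsClosed {w : P.L2Q × P.L2Qd | inner ℝ q w.1 + inner ℝ τ w.2 = 0} :=
    isClosed_eq (by fun_prop) continuous_const
  exact closure_minimal (fun w hw => hasWeakDiv_iff_testPairs.1 hτ w hw) hc h

/-- `H^{1,0}_0(Q)` is the annihilator of the pairs `(τ, ∇·τ)`. -/
theorem memH10Zero_iff {u : P.L2Q} {G : P.L2Qd} : P.MemH10Zero u G ↔
    ∀ (τ : P.L2Qd) (q : P.L2Q), P.HasWeakDiv τ q → inner ℝ q u + inner ℝ τ G = 0 := by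
  refine ⟨fun h τ q hτ => h.inner_add_eq_zero hτ, fun h => ?_⟩
  -- The orthogonal complement of the test pairs consists exactly of the pairs (∇·τ, τ), so the
  -- hypothesis places (u, G) in the double complement, which is the closure.
  have h1 : WithLp.toLp 2 (u, G) ∈ (P.testSubmodule)ᗮᗮ := by
    rw [Submodule.mem_orthogonal]
    intro w hw
    rw [WithLp.prod_inner_apply]
    refine h w.snd w.fst (hasWeakDiv_iff_testPairs.2 fun z hz => ?_)
    have := (Submodule.mem_orthogonal' _ _).1 hw (WithLp.toLp 2 z) hz
    rwa [WithLp.prod_inner_apply] at this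
  rw [Submodule.orthogonal_orthogonal_eq_closure] at h1
  have h2 : WithLp.toLp 2 (u, G) ∈ closure (P.testSubmodule : Set (WithLp 2 (P.L2Q × P.L2Qd))) := h1
  have h3 := image_closure_subset_closure_image
    (WithLp.homeomorphProd 2 P.L2Q P.L2Qd).continuous (mem_image_of_mem _ h2)
  refine closure_mono ?_ h3
  rintro _ ⟨w, hw, rfl⟩
  exact hw

theorem MemH10Zero.add {u v : P.L2Q} {G H : P.L2Qd} (h : P.MemH10Zero u G)
    (h' : P.MemH10Zero v H) : P.MemH10Zero (u + v) (G + H) := by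
  rw [memH10Zero_iff] at *
  intro τ q hτ
  rw [inner_add_right, inner_add_right]
  linear_combination h τ q hτ + h' τ q hτ

theorem MemH10Zero.smul {u : P.L2Q} {G : P.L2Qd} (c : ℝ) (h : P.MemH10Zero u G) :
    P.MemH10Zero (c • u) (c • G) := by
  rw [memH10Zero_iff] at *
  intro τ q hτ
  rw [real_inner_smul_right, real_inner_smul_right]
  linear_combination c * h τ q hτ

theorem MemH10Zero.sub {u v : P.L2Q} {G H : P.L2Qd} (h : P.MemH10Zero u G)
    (h' : P.MemH10Zero v H) : P.MemH10Zero (u - v) (G - H) := by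
  have := h.add (h'.smul (-1))
  simpa only [neg_smul, one_smul, ← sub_eq_add_neg] using this

theorem memH10Zero_zero : P.MemH10Zero 0 0 := by
  rw [memH10Zero_iff]
  simp

theorem MemH10Zero.sum {ι : Type*} (s : Finset ι) {u : ι → P.L2Q} {G : ι → P.L2Qd}
    (h : ∀ i ∈ s, P.MemH10Zero (u i) (G i)) :
    P.MemH10Zero (∑ i ∈ s, u i) (∑ i ∈ s, G i) := by
  rw [memH10Zero_iff]
  intro τ q hτ
  rw [inner_sum, inner_sum, ← Finset.sum_add_distrib]
  exact Finset.sum_eq_zero fun i hi => (h i hi).inner_add_eq_zero hτ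

theorem MemH10Zero.of_hasSum {ι : Type*} {u : ι → P.L2Q} {G : ι → P.L2Qd} {v : P.L2Q} {H : P.L2Qd}
    (h : ∀ i, P.MemH10Zero (u i) (G i)) (hu : HasSum u v) (hG : HasSum G H) :
    P.MemH10Zero v H :=
  isClosed_closure.mem_of_tendsto (hu.prodMk_nhds hG)
    (Eventually.of_forall fun s => MemH10Zero.sum s fun i _ => h i)

/-- The weak divergence of the field `φ v`, for a constant vector `v`. -/
theorem hasWeakDiv_test_smul {φ : EuclideanSpace ℝ (Fin d) × ℝ → ℝ} (h : IsTestOn P.Q φ)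
    (v : EuclideanSpace ℝ (Fin d)) (hτ : MemLp (fun z => φ z • v) 2 P.μQ)
    (hq : MemLp (fun z => fderiv ℝ φ z (v, 0)) 2 P.μQ) :
    P.HasWeakDiv (hτ.toLp _) (hq.toLp _) := by
  rw [hasWeakDiv_iff_inner]
  intro ψ hψ
  rw [inner_toLp_left, inner_toLp_left]
  -- Since φ and its derivative vanish outside Q, both integrals extend to the whole space, where
  -- integration by parts has no boundary terms.
  have hz : ∀ z ∉ P.Q, φ z = 0 := fun z hz => by
    by_contra hne
    exact hz (h.2.2 (subset_tsupport _ hne))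
  have hz' : ∀ z ∉ P.Q, fderiv ℝ φ z = 0 := fun z hz => by
    by_contra hne
    exact hz (h.2.2 (support_fderiv_subset ℝ hne))
  have h1 : ∫ z, inner ℝ (fderiv ℝ φ z (v, 0)) ((hψ.memLp (P := P)).toLp ψ z) ∂P.μQ
      = ∫ z, fderiv ℝ φ z (v, 0) * ψ z := by
    rw [← setIntegral_eq_integral_of_forall_compl_eq_zero (μ := volume) (s := P.Q)]
    · refine integral_congr_ae (μ := P.μQ) ?_
      filter_upwards [(hψ.memLp (P := P)).coeFn_toLp] with z hz
      rw [hz]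
      simp [mul_comm]
    · intro z hz
      simp [hz' z hz]
  have h2 : ∫ z, inner ℝ (φ z • v) ((hψ.memLp_gradX (P := P)).toLp (gradX ψ) z) ∂P.μQ
      = ∫ z, φ z * fderiv ℝ ψ z (v, 0) := by
    rw [← setIntegral_eq_integral_of_forall_compl_eq_zero (μ := volume) (s := P.Q)]
    · refine integral_congr_ae (μ := P.μQ) ?_
      filter_upwards [(hψ.memLp_gradX (P := P)).coeFn_toLp] with z hz
      rw [hz, gradX_eq hψ.1, real_inner_smul_left, real_inner_comm,
        InnerProductSpace.toDual_symm_apply]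
      simp
    · intro z hz'
      simp [hz z hz']
  rw [h1, h2]
  have hcφ := h.1.continuous_fderiv (by simp)
  have hcψ := hψ.1.continuous_fderiv (by simp)
  have : (volume : Measure (EuclideanSpace ℝ (Fin d) × ℝ)).IsAddHaarMeasure := by
    rw [Measure.volume_eq_prod]; infer_instance
  rw [integral_mul_fderiv_eq_neg_fderiv_mul_of_integrable]
  · ring
  · refine Continuous.integrable_of_hasCompactSupport ?_ ?_
    · exact (hcφ.clm_apply continuous_const).mul hψ.1.continuous
    · exact hψ.2.1.mul_left
  · refine Continuous.integrable_of_hasCompactSupport ?_ ?_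
    · exact h.1.continuous.mul (hcψ.clm_apply continuous_const)
    · exact h.2.1.mul_right
  · exact (h.1.continuous.mul hψ.1.continuous).integrable_of_hasCompactSupport hψ.2.1.mul_left
  · exact fun x _ => h.1.differentiable (by simp) x
  · exact fun x _ => hψ.1.differentiable (by simp) x

/-- Duality with the fields φv, for a test function φ and a constant vector v, gives ⟨∫φG, v⟩ = 0,
so all moments of G against test functions vanish. -/
theorem MemH10Zero.grad_eq_zero {G : P.L2Qd} (h : P.MemH10Zero 0 G) : G = 0 := by
  have hG : Integrable (G : _ → EuclideanSpace ℝ (Fin d)) P.μQ :=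
    (Lp.memLp G).integrable (by norm_num)
  refine Lp.ext (EventuallyEq.trans ?_ (Lp.coeFn_zero _ _ _).symm)
  have key := P.isOpen_Q.ae_eq_zero_of_integral_contDiff_smul_eq_zero (μ := volume) (f := G)
    (IntegrableOn.locallyIntegrableOn hG) fun φ h1 h2 h3 => ?_
  · exact (ae_restrict_iff' P.isOpen_Q.measurableSet).2 key
  · have hφ : IsTestOn P.Q φ := ⟨h1, h2, h3⟩
    have hz : ∀ z ∉ P.Q, φ z • G z = 0 := fun z hz => by
      rw [image_eq_zero_of_notMem_tsupport (fun hh => hz (h3 hh)), zero_smul]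
    rw [← setIntegral_eq_integral_of_forall_compl_eq_zero hz]
    have hi : Integrable (fun z => φ z • G z) P.μQ := by
      obtain ⟨C, hC⟩ := h2.exists_bound_of_continuous h1.continuous
      exact hG.bdd_smul C h1.continuous.aestronglyMeasurable (ae_of_all _ hC)
    refine ext_inner_left ℝ fun v => ?_
    have hτ : MemLp (fun z => φ z • v) 2 P.μQ :=
      (h1.continuous.smul continuous_const).memLp_of_hasCompactSupport h2.smul_right
    have hq : MemLp (fun z => fderiv ℝ φ z (v, 0)) 2 P.μQ :=
      ((h1.continuous_fderiv (by simp)).clm_apply continuous_const).memLp_of_hasCompactSupport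
        ((h2.fderiv (𝕜 := ℝ)).mono fun z hz h0 => hz (by simp [h0]))
    have := h.inner_add_eq_zero (hasWeakDiv_test_smul hφ v hτ hq)
    rw [inner_zero_right, zero_add, inner_toLp_left] at this
    rw [inner_zero_right, ← this]
    refine (integral_inner hi v).symm.trans ?_
    refine integral_congr_ae (ae_of_all _ fun z => ?_)
    simp only [real_inner_smul_left, real_inner_smul_right]

/-- The gradient of an element of `H^{1,0}_0(Q)` is determined by its values. -/
theorem MemH10Zero.grad_unique {u : P.L2Q} {G H : P.L2Qd} (h : P.MemH10Zero u G)
    (h' : P.MemH10Zero u H) : G = H := by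
  have := h.sub h'
  rw [sub_self] at this
  exact sub_eq_zero.1 this.grad_eq_zero

end ParabolicProblem
end

noncomputable section

namespace ParabolicProblem

variable {d : ℕ} (P : ParabolicProblem d)

/-! ### The trigonometric system on `(0,T)` -/

/-- The real trigonometric orthonormal system of `L²(0,T)`: cosines for positive indices, sines for
negative ones. -/
def trig (n : ℤ) (t : ℝ) : ℝ :=
  if n = 0 then 1 / √P.T
  else if 0 < n then √(2 / P.T) * Real.cos (n * P.freq * t)
  else √(2 / P.T) * Real.sin (-n * P.freq * t)

theorem freq_pos : 0 < P.freq := div_pos Real.two_pi_pos P.T_pos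

theorem trig_natCast {k : ℕ} (hk : k ≠ 0) (t : ℝ) :
    P.trig k t = √(2 / P.T) * Real.cos (k * P.freq * t) := by
  have h : 0 < k := Nat.pos_of_ne_zero hk
  simp [trig, hk, h]

theorem trig_neg_natCast {k : ℕ} (hk : k ≠ 0) (t : ℝ) :
    P.trig (-k) t = √(2 / P.T) * Real.sin (k * P.freq * t) := by
  have h : 0 < k := Nat.pos_of_ne_zero hk
  simp [trig, hk]

/-- The sign of the index distinguishes cosine from sine, so a single formula θ_n' = -nω θ_{-n}
covers both, including the constant n = 0. -/
theorem hasDerivAt_trig (n : ℤ) (t : ℝ) :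
    HasDerivAt (P.trig n) (-(n * P.freq) * P.trig (-n) t) t := by
  rcases lt_trichotomy n 0 with hn | rfl | hn
  · have h1 : P.trig n = fun t => √(2 / P.T) * Real.sin (-n * P.freq * t) := by
      funext t; simp [trig, hn.ne, hn.le]
    have h2 : P.trig (-n) t = √(2 / P.T) * Real.cos (-n * P.freq * t) := by
      simp [trig, hn.ne, hn]
    rw [h1, h2]
    convert! (((hasDerivAt_id t).const_mul (-n * P.freq)).sin).const_mul (√(2 / P.T)) using 1
    simp only [id, mul_one]; ring
  · have h1 : P.trig 0 = fun _ => 1 / √P.T := by funext t; simp [trig]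
    rw [h1]
    simpa using hasDerivAt_const t (1 / √P.T)
  · have h1 : P.trig n = fun t => √(2 / P.T) * Real.cos (n * P.freq * t) := by
      funext t; simp [trig, hn.ne', hn]
    have h2 : P.trig (-n) t = √(2 / P.T) * Real.sin (n * P.freq * t) := by
      simp [trig, hn.ne', hn.le]
    rw [h1, h2]
    convert! (((hasDerivAt_id t).const_mul (n * P.freq)).cos).const_mul (√(2 / P.T)) using 1
    simp only [id, mul_one]; ring

theorem contDiff_trig (n : ℤ) : ContDiff ℝ ∞ (P.trig n) := by
  unfold trig
  split_ifs <;> fun_prop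

theorem continuous_trig (n : ℤ) : Continuous (P.trig n) := (P.contDiff_trig n).continuous

theorem trig_T (n : ℤ) : P.trig n P.T = P.trig n 0 := by
  have hT := P.T_pos.ne'
  have h1 : (n : ℝ) * P.freq * P.T = n * (2 * Real.pi) := by rw [freq]; field_simp
  have h2 : -(n : ℝ) * P.freq * P.T = (-n : ℤ) * (2 * Real.pi) := by
    push_cast; rw [freq]; field_simp
  simp only [trig, h1, h2, mul_zero, Real.cos_zero, Real.sin_zero]
  split_ifs
  · rfl
  · rw [Real.cos_int_mul_two_pi]
  · rw [show (((-n : ℤ) : ℝ) * (2 * Real.pi)) = ((-n * 2 : ℤ) : ℝ) * Real.pi by push_cast; ring,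
      Real.sin_int_mul_pi, mul_zero]

theorem abs_trig_le (n : ℤ) (t : ℝ) : |P.trig n t| ≤ √(2 / P.T) := by
  have h0 : 0 ≤ √(2 / P.T) := Real.sqrt_nonneg _
  unfold trig
  split_ifs
  · rw [abs_of_nonneg (by positivity), one_div, ← Real.sqrt_inv]
    refine Real.sqrt_le_sqrt ?_
    rw [inv_eq_one_div]
    exact div_le_div_of_nonneg_right one_le_two P.T_pos.le
  · rw [abs_mul, abs_of_nonneg h0]
    exact mul_le_of_le_one_right h0 (Real.abs_cos_le_one _)
  · rw [abs_mul, abs_of_nonneg h0]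
    exact mul_le_of_le_one_right h0 (Real.abs_sin_le_one _)

theorem integral_μI (f : ℝ → ℝ) : ∫ t, f t ∂P.μI = ∫ t in (0)..P.T, f t := by
  rw [intervalIntegral.integral_of_le P.T_pos.le, integral_Ioc_eq_integral_Ioo]

theorem intervalIntegrable_trig_mul (m n : ℤ) :
    IntervalIntegrable (fun t => P.trig m t * P.trig n t) volume 0 P.T :=
  ((P.continuous_trig m).mul (P.continuous_trig n)).intervalIntegrable _ _

/-- The Gram matrix of the trigonometric system. -/
def trigInner (m n : ℤ) : ℝ := ∫ t, P.trig m t * P.trig n t ∂P.μI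

/-- The derivative of θ_m θ_n integrates to zero over a period. All orthogonality relations follow
from this identity by algebra. -/
theorem trigInner_relation (m n : ℤ) :
    m * P.trigInner (-m) n + n * P.trigInner m (-n) = 0 := by
  have h := intervalIntegral.integral_eq_sub_of_hasDerivAt (a := 0) (b := P.T)
    (f := fun t => P.trig m t * P.trig n t)
    (fun t _ => (P.hasDerivAt_trig m t).mul (P.hasDerivAt_trig n t))
    (Continuous.intervalIntegrable (by
      have := P.continuous_trig
      fun_prop) _ _)
  have h1 : ∀ t, -(m * P.freq) * P.trig (-m) t * P.trig n t +
      P.trig m t * (-(n * P.freq) * P.trig (-n) t) =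
      -(m * P.freq) * (P.trig (-m) t * P.trig n t) +
      -(n * P.freq) * (P.trig m t * P.trig (-n) t) := fun t => by ring
  simp only [h1, trig_T, sub_self] at h
  rw [intervalIntegral.integral_add ((P.intervalIntegrable_trig_mul _ _).const_mul _)
    ((P.intervalIntegrable_trig_mul _ _).const_mul _), intervalIntegral.integral_const_mul,
    intervalIntegral.integral_const_mul, ← integral_μI, ← integral_μI] at h
  rw [trigInner, trigInner]
  have hω := P.freq_pos.ne'
  refine mul_left_cancel₀ hω ?_
  linear_combination -h

theorem trigInner_comm (m n : ℤ) : P.trigInner m n = P.trigInner n m := by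
  simp only [trigInner, mul_comm]

theorem trig_sq_add_sq {n : ℤ} (hn : n ≠ 0) (t : ℝ) :
    P.trig n t * P.trig n t + P.trig (-n) t * P.trig (-n) t = 2 / P.T := by
  have h2 : √(2 / P.T) * √(2 / P.T) = 2 / P.T :=
    Real.mul_self_sqrt (div_nonneg zero_le_two P.T_pos.le)
  rcases hn.lt_or_gt with hn | hn
  · have := Real.sin_sq_add_cos_sq (-n * P.freq * t)
    simp only [trig, hn.ne, hn, hn.not_gt, neg_eq_zero, Left.neg_pos_iff, if_true, if_false]
    push_cast
    linear_combination (Real.sin (-n * P.freq * t) ^ 2 + Real.cos (-n * P.freq * t) ^ 2) * h2 +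
      2 / P.T * this
  · have := Real.sin_sq_add_cos_sq (n * P.freq * t)
    simp only [trig, hn.ne', hn, hn.not_gt, neg_eq_zero, Left.neg_pos_iff, if_true, if_false]
    push_cast
    rw [neg_neg]
    linear_combination (Real.sin (n * P.freq * t) ^ 2 + Real.cos (n * P.freq * t) ^ 2) * h2 +
      2 / P.T * this

/-- For n ≠ 0 the relation for (-n, n) shows that θ_n and θ_{-n} have equal norms, and sin² + cos² =
1 makes the sum of their squared norms equal to 2. -/
theorem trigInner_self (n : ℤ) : P.trigInner n n = 1 := by
  have hT := P.T_pos
  rcases eq_or_ne n 0 with rfl | hn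
  · simp only [trigInner, trig, if_true, integral_const]
    rw [Measure.real, Measure.restrict_apply_univ, Real.volume_Ioo, sub_zero,
      ENNReal.toReal_ofReal hT.le, smul_eq_mul, ← sq, div_pow, Real.sq_sqrt hT.le]
    field_simp
  · have h1 := P.trigInner_relation (-n) n
    have h2 : P.trigInner n n + P.trigInner (-n) (-n) = 2 := by
      rw [trigInner, trigInner, integral_μI, integral_μI,
        ← intervalIntegral.integral_add (P.intervalIntegrable_trig_mul _ _)
          (P.intervalIntegrable_trig_mul _ _)]
      simp only [P.trig_sq_add_sq hn, intervalIntegral.integral_const, sub_zero, smul_eq_mul]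
      field_simp
    have h3 : (n : ℝ) ≠ 0 := Int.cast_ne_zero.2 hn
    push_cast at h1
    rw [neg_neg] at h1
    have h4 : P.trigInner (-n) (-n) = P.trigInner n n := by
      refine mul_left_cancel₀ h3 ?_
      linear_combination h1
    linarith

/-- Eliminating the entry at (-m, -n) from two instances of `trigInner_relation` gives (m² -
n²)⟨θ_m, θ_n⟩ = 0. The case m = -n is degenerate and uses the relation for (n, n). -/
theorem trigInner_of_ne {m n : ℤ} (h : m ≠ n) : P.trigInner m n = 0 := by
  by_cases h' : m = -n
  · have hn : (n : ℝ) ≠ 0 := by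
      rintro h0
      rw [Int.cast_eq_zero] at h0
      subst h0
      exact h (by simpa using h')
    have h1 := P.trigInner_relation n n
    rw [P.trigInner_comm n (-n)] at h1
    rw [h']
    have : (n : ℝ) * P.trigInner (-n) n = 0 := by linarith
    exact (mul_eq_zero.1 this).resolve_left hn
  · have h1 := P.trigInner_relation (-m) n
    have h2 := P.trigInner_relation m (-n)
    push_cast at h1 h2
    rw [neg_neg] at h1 h2
    have h3 : ((m : ℝ) - n) * ((m : ℝ) + n) ≠ 0 := by
      refine mul_ne_zero (sub_ne_zero.2 (Int.cast_injective.ne h)) ?_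
      rw [← sub_neg_eq_add, ← Int.cast_neg]
      exact sub_ne_zero.2 (Int.cast_injective.ne h')
    have h4 : ((m : ℝ) - n) * ((m : ℝ) + n) * P.trigInner m n = 0 := by
      linear_combination -(m : ℝ) * h1 + n * h2
    exact (mul_eq_zero.1 h4).resolve_left h3

/-! ### Completeness of the trigonometric system -/

instance : Fact (0 < P.T) := ⟨P.T_pos⟩

variable {F : Type*} [NormedAddCommGroup F] [NormedSpace ℝ F]

theorem integrable_continuous_smul {g : ℝ → F} (hg : Integrable g P.μI) {b : ℝ → ℝ} {C : ℝ}
    (hb : Continuous b) (hC : ∀ t, |b t| ≤ C) : Integrable (fun t => b t • g t) P.μI :=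
  hg.bdd_smul C hb.aestronglyMeasurable (ae_of_all _ hC)

theorem re_circle_le (f : C(AddCircle P.T, ℂ)) (t : ℝ) : |(f (t : AddCircle P.T)).re| ≤ ‖f‖ :=
  (Complex.abs_re_le_norm _).trans (f.norm_coe_le_norm _)

/-- `f ↦ ∫₀ᵀ (Re f) g` -/
def reMoment {g : ℝ → F} (hg : Integrable g P.μI) : C(AddCircle P.T, ℂ) →L[ℝ] F :=
  LinearMap.mkContinuous
    { toFun := fun f => ∫ t : ℝ, (f (t : AddCircle P.T)).re • g t ∂P.μI
      map_add' := fun f f' => by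
        have h := fun f : C(AddCircle P.T, ℂ) => P.integrable_continuous_smul hg
          (b := fun t : ℝ => (f (t : AddCircle P.T)).re)
          (Complex.continuous_re.comp (f.continuous.comp (AddCircle.continuous_mk' _)))
          (P.re_circle_le f)
        rw [← integral_add (h f) (h f')]
        simp only [ContinuousMap.add_apply, Complex.add_re, add_smul]
      map_smul' := fun c f => by
        rw [RingHom.id_apply, ← integral_smul]
        simp [mul_smul] }
    (∫ t, ‖g t‖ ∂P.μI) fun f => by
      rw [mul_comm, ← integral_const_mul]
      refine norm_integral_le_of_norm_le (hg.norm.const_mul _) (ae_of_all _ fun t => ?_)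
      rw [norm_smul]
      exact mul_le_mul_of_nonneg_right (P.re_circle_le f t) (norm_nonneg _)

theorem reMoment_apply {g : ℝ → F} (hg : Integrable g P.μI) (f : C(AddCircle P.T, ℂ)) :
    P.reMoment hg f = ∫ t : ℝ, (f (t : AddCircle P.T)).re • g t ∂P.μI := rfl

/-- The real part of c·exp(inωt) is a combination of cos(nωt) and sin(nωt), and the moments of g
against these vanish by hypothesis. -/
theorem reMoment_fourier {g : ℝ → F} (hg : Integrable g P.μI)
    (h : ∀ n, ∫ t, P.trig n t • g t ∂P.μI = 0) (n : ℤ) (c : ℂ) :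
    P.reMoment hg (c • fourier n) = 0 := by
  have hr : √(2 / P.T) ≠ 0 := (Real.sqrt_pos.2 (div_pos two_pos P.T_pos)).ne'
  have hcos : ∫ t, Real.cos (n * P.freq * t) • g t ∂P.μI = 0 := by
    rcases eq_or_ne n 0 with rfl | hn
    · have := h 0
      simp only [trig, if_true, integral_smul] at this
      simpa using (smul_eq_zero.1 this).resolve_left
        (one_div_ne_zero (Real.sqrt_pos.2 P.T_pos).ne')
    · have := h |n|
      have h0 : 0 < |n| := abs_pos.2 hn
      simp only [trig, h0.ne', h0, if_true, if_false, mul_smul, integral_smul] at this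
      have h1 := (smul_eq_zero.1 this).resolve_left hr
      rcases abs_choice n with hc | hc <;> rw [hc] at h1
      · exact h1
      · push_cast at h1
        simpa only [neg_mul, Real.cos_neg] using h1
  have hsin : ∫ t, Real.sin (n * P.freq * t) • g t ∂P.μI = 0 := by
    rcases eq_or_ne n 0 with rfl | hn
    · simp
    · have := h (-|n|)
      have h0 : 0 < |n| := abs_pos.2 hn
      simp only [trig, neg_eq_zero, h0.ne', Left.neg_pos_iff, h0.not_gt, if_false, mul_smul,
        integral_smul] at this
      have h1 := (smul_eq_zero.1 this).resolve_left hr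
      push_cast at h1
      rw [neg_neg] at h1
      rcases abs_choice n with hc | hc
      · rwa [← Int.cast_abs, hc] at h1
      · rw [← Int.cast_abs, hc] at h1
        push_cast at h1
        simpa only [neg_mul, Real.sin_neg, neg_smul, integral_neg, neg_eq_zero] using h1
  have hf : ∀ t : ℝ, (fourier n (t : AddCircle P.T) : ℂ) =
      Complex.cos ((n * P.freq * t : ℝ)) + Complex.sin ((n * P.freq * t : ℝ)) * Complex.I := by
    intro t
    rw [fourier_coe_apply, ← Complex.exp_mul_I]
    congr 1
    rw [freq]
    push_cast
    ring
  have hre : ∀ t : ℝ, ((c • fourier n : C(AddCircle P.T, ℂ)) (t : AddCircle P.T)).re =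
      c.re * Real.cos (n * P.freq * t) - c.im * Real.sin (n * P.freq * t) := by
    intro t
    rw [ContinuousMap.smul_apply, hf, smul_eq_mul, ← Complex.ofReal_cos, ← Complex.ofReal_sin]
    generalize Real.cos _ = x
    generalize Real.sin _ = y
    simp
  rw [reMoment_apply]
  simp only [hre, sub_smul, mul_smul]
  rw [integral_sub, integral_smul, integral_smul, hcos, hsin, smul_zero, smul_zero, sub_zero]
  · exact (P.integrable_continuous_smul hg (b := fun t => Real.cos (n * P.freq * t)) (by fun_prop)
      fun t => Real.abs_cos_le_one _).smul c.re
  · exact (P.integrable_continuous_smul hg (b := fun t => Real.sin (n * P.freq * t)) (by fun_prop)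
      fun t => Real.abs_sin_le_one _).smul c.im

/-- Trigonometric polynomials are uniformly dense in the continuous functions on the circle, and the
moment map is continuous in the uniform norm. -/
theorem reMoment_eq_zero {g : ℝ → F} (hg : Integrable g P.μI)
    (h : ∀ n, ∫ t, P.trig n t • g t ∂P.μI = 0) (f : C(AddCircle P.T, ℂ)) :
    P.reMoment hg f = 0 := by
  have hmem : f ∈ (Submodule.span ℂ (range (@fourier P.T))).topologicalClosure := by
    rw [span_fourier_closure_eq_top]; trivial
  have hcl : IsClosed {f | P.reMoment hg f = 0} :=
    isClosed_eq (P.reMoment hg).continuous continuous_const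
  refine closure_minimal (fun f' hf' => ?_) hcl hmem
  -- The real part is only real linear, so induction over the complex span must carry an arbitrary
  -- complex factor.
  have : ∀ c : ℂ, P.reMoment hg (c • f') = 0 := by
    induction hf' using Submodule.span_induction with
    | mem x hx =>
      obtain ⟨n, rfl⟩ := hx
      exact P.reMoment_fourier hg h n
    | zero => intro c; rw [smul_zero, map_zero]
    | add x y _ _ hx hy => intro c; rw [smul_add, map_add, hx, hy, add_zero]
    | smul a x _ hx => intro c; rw [smul_smul]; exact hx _
  simpa using this 1

/-- An integrable function on `(0,T)` all of whose trigonometric moments vanish is zero. -/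
theorem ae_eq_zero_of_trig_moments [CompleteSpace F] {g : ℝ → F} (hg : Integrable g P.μI)
    (h : ∀ n, ∫ t, P.trig n t • g t ∂P.μI = 0) : ∀ᵐ t ∂P.μI, g t = 0 := by
  refine (ae_restrict_iff' measurableSet_Ioo).2 ?_
  refine isOpen_Ioo.ae_eq_zero_of_integral_contDiff_smul_eq_zero
    (IntegrableOn.locallyIntegrableOn hg) fun b hb hbc hbs => ?_
  have hz : ∀ t ∉ Ioo 0 P.T, b t = 0 := fun t ht =>
    image_eq_zero_of_notMem_tsupport fun hh => ht (hbs hh)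
  rw [← setIntegral_eq_integral_of_forall_compl_eq_zero (s := Ioo 0 P.T)
    fun t ht => by rw [hz t ht, zero_smul]]
  -- A function with compact support in (0,T) vanishes at both ends, hence descends to a continuous
  -- function on the circle.
  have hc : Continuous (AddCircle.liftIco P.T 0 fun t => (b t : ℂ)) := by
    refine AddCircle.liftIco_zero_continuous ?_ ?_
    · rw [hz 0 (by simp), hz P.T (by simp)]
    · exact (Complex.continuous_ofReal.comp hb.continuous).continuousOn
  have h0 := P.reMoment_eq_zero hg h ⟨_, hc⟩
  rw [reMoment_apply] at h0
  rw [← h0]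
  refine setIntegral_congr_fun measurableSet_Ioo fun t ht => ?_
  simp only [ContinuousMap.coe_mk]
  rw [AddCircle.liftIco_zero_coe_apply (Ioo_subset_Ico_self ht), Complex.ofReal_re]

end ParabolicProblem
end

noncomputable section

namespace ParabolicProblem

variable {d : ℕ} (P : ParabolicProblem d)

/-! ### Fourier expansion in time of functions on `Q` -/

variable {F : Type*} [NormedAddCommGroup F]

variable {P} in
theorem Integrable.ae_slice {f : EuclideanSpace ℝ (Fin d) × ℝ → F} (hf : Integrable f P.μQ) :
    ∀ᵐ x ∂P.μΩ, Integrable (fun t => f (x, t)) P.μI := by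
  rw [μQ_eq] at hf
  exact hf.prod_right_ae

theorem memLp_comp_fst {a : EuclideanSpace ℝ (Fin d) → F} (ha : MemLp a 2 P.μΩ) :
    MemLp (fun z : EuclideanSpace ℝ (Fin d) × ℝ => a z.1) 2 P.μQ := by
  rw [μQ_eq]; exact ha.comp_fst _

variable [InnerProductSpace ℝ F]

variable {P} in
theorem integral_μQ {f : EuclideanSpace ℝ (Fin d) × ℝ → F} (hf : Integrable f P.μQ) :
    ∫ z, f z ∂P.μQ = ∫ x, ∫ t, f (x, t) ∂P.μI ∂P.μΩ := by
  rw [μQ_eq] at hf ⊢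
  exact integral_prod f hf

variable {P} in
theorem Integrable.integral_slice {f : EuclideanSpace ℝ (Fin d) × ℝ → F}
    (hf : Integrable f P.μQ) : Integrable (fun x => ∫ t, f (x, t) ∂P.μI) P.μΩ := by
  rw [μQ_eq] at hf
  exact hf.integral_prod_left

variable {P} in
theorem ae_slice_of_ae {p : EuclideanSpace ℝ (Fin d) × ℝ → Prop} (h : ∀ᵐ z ∂P.μQ, p z) :
    ∀ᵐ x ∂P.μΩ, ∀ᵐ t ∂P.μI, p (x, t) := by
  rw [μQ_eq] at h
  exact Measure.ae_ae_of_ae_prod h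

variable {P} in
theorem ae_of_ae_slice {p : EuclideanSpace ℝ (Fin d) × ℝ → Prop} (hp : MeasurableSet {z | p z})
    (h : ∀ᵐ x ∂P.μΩ, ∀ᵐ t ∂P.μI, p (x, t)) : ∀ᵐ z ∂P.μQ, p z := by
  rw [μQ_eq]
  exact (Measure.ae_prod_iff_ae_ae hp).2 h

theorem memLp_trig_smul {f : EuclideanSpace ℝ (Fin d) × ℝ → F} (hf : MemLp f 2 P.μQ) (n : ℤ) :
    MemLp (fun z => P.trig n z.2 • f z) 2 P.μQ := by
  refine hf.of_le_mul (c := √(2 / P.T)) ?_ (ae_of_all _ fun z => ?_)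
  · exact ((P.continuous_trig n).comp continuous_snd).aestronglyMeasurable.smul hf.1
  · rw [norm_smul]
    exact mul_le_mul_of_nonneg_right (P.abs_trig_le n _) (norm_nonneg _)

theorem memLp_tens (n : ℤ) (a : Lp F 2 P.μΩ) :
    MemLp (fun z : EuclideanSpace ℝ (Fin d) × ℝ => P.trig n z.2 • a z.1) 2 P.μQ :=
  P.memLp_trig_smul (P.memLp_comp_fst (Lp.memLp a)) n

variable {P} in
theorem ae_fst {p : EuclideanSpace ℝ (Fin d) → Prop} (h : ∀ᵐ x ∂P.μΩ, p x) :
    ∀ᵐ z ∂P.μQ, p z.1 := by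
  rw [μQ_eq]
  exact Measure.quasiMeasurePreserving_fst.ae h

theorem inner_tens_toLp (m n : ℤ) (a b : Lp F 2 P.μΩ) :
    inner ℝ ((P.memLp_tens m a).toLp _) ((P.memLp_tens n b).toLp _) =
      P.trigInner m n * inner ℝ a b := by
  rw [inner_toLp_left]
  have h1 : ∫ z, inner ℝ (P.trig m z.2 • a z.1) ((P.memLp_tens n b).toLp _ z) ∂P.μQ =
      ∫ z, (inner ℝ (a z.1) (b z.1)) * (P.trig m z.2 * P.trig n z.2) ∂P.μQ := by
    refine integral_congr_ae ?_
    filter_upwards [(P.memLp_tens n b).coeFn_toLp] with z hz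
    rw [hz, real_inner_smul_left, real_inner_smul_right]
    ring
  rw [h1, μQ_eq, integral_prod_mul (fun x => inner ℝ (a x) (b x))
    (fun t => P.trig m t * P.trig n t), L2.inner_def, trigInner, mul_comm]

/-- The isometric embedding `a ↦ a ⊗ θ_n` of `L²(Ω)` into `L²(Q)`. -/
def tens (n : ℤ) : Lp F 2 P.μΩ →ₗᵢ[ℝ] Lp F 2 P.μQ :=
  LinearMap.isometryOfInner
    { toFun := fun a => (P.memLp_tens n a).toLp _
      map_add' := fun a b => by
        rw [← MemLp.toLp_add]
        refine MemLp.toLp_congr _ _ ?_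
        filter_upwards [ae_fst (Lp.coeFn_add a b)] with z hz
        simp only [hz, Pi.add_apply, smul_add]
      map_smul' := fun c a => by
        rw [RingHom.id_apply, ← MemLp.toLp_const_smul]
        refine MemLp.toLp_congr _ _ ?_
        filter_upwards [ae_fst (Lp.coeFn_smul c a)] with z hz
        simp only [hz, Pi.smul_apply, smul_comm c] }
    fun a b => by
      refine (P.inner_tens_toLp n n a b).trans ?_
      rw [trigInner_self, one_mul]

theorem tens_eq_toLp (n : ℤ) (a : Lp F 2 P.μΩ) : P.tens n a = (P.memLp_tens n a).toLp _ := rfl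

theorem tens_ae (n : ℤ) (a : Lp F 2 P.μΩ) :
    P.tens n a =ᵐ[P.μQ] fun z => P.trig n z.2 • a z.1 := (P.memLp_tens n a).coeFn_toLp

theorem inner_tens_tens (m n : ℤ) (a b : Lp F 2 P.μΩ) :
    inner ℝ (P.tens m a) (P.tens n b) = if m = n then inner ℝ a b else 0 := by
  refine (P.inner_tens_toLp m n a b).trans ?_
  split_ifs with h
  · rw [h, trigInner_self, one_mul]
  · rw [P.trigInner_of_ne h, zero_mul]

variable [CompleteSpace F]

/-- The `n`-th Fourier coefficient in time, as an element of `L²(Ω)`. -/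
def coef (n : ℤ) : Lp F 2 P.μQ →L[ℝ] Lp F 2 P.μΩ :=
  ContinuousLinearMap.adjoint (P.tens n).toContinuousLinearMap

theorem inner_coef_left (n : ℤ) (u : Lp F 2 P.μQ) (a : Lp F 2 P.μΩ) :
    inner ℝ (P.coef n u) a = inner ℝ u (P.tens n a) :=
  ContinuousLinearMap.adjoint_inner_left _ _ _

theorem inner_coef_right (n : ℤ) (u : Lp F 2 P.μQ) (a : Lp F 2 P.μΩ) :
    inner ℝ a (P.coef n u) = inner ℝ (P.tens n a) u :=
  ContinuousLinearMap.adjoint_inner_right _ _ _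

theorem coef_tens (m n : ℤ) (a : Lp F 2 P.μΩ) :
    P.coef m (P.tens n a) = if m = n then a else 0 := by
  refine ext_inner_right ℝ fun b => ?_
  rw [inner_coef_left, inner_tens_tens]
  by_cases h : m = n
  · simp [h]
  · simp [h, Ne.symm h]

theorem coef_tens_self (n : ℤ) (a : Lp F 2 P.μΩ) : P.coef n (P.tens n a) = a := by
  simp [coef_tens]

/-- The coefficient is defined abstractly as an adjoint. Pairing it with c·1_s, for measurable s and
constant c, and applying Fubini identifies it with the pointwise Fourier integral. -/
theorem coef_ae (n : ℤ) (u : Lp F 2 P.μQ) :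
    P.coef n u =ᵐ[P.μΩ] fun x => ∫ t, P.trig n t • u (x, t) ∂P.μI := by
  have hu : MemLp (fun z => P.trig n z.2 • u z) 2 P.μQ := P.memLp_trig_smul (Lp.memLp u) n
  have hi : Integrable (fun z => P.trig n z.2 • u z) P.μQ := hu.integrable (by norm_num)
  have hi2 : Integrable (fun x => ∫ t, P.trig n t • u (x, t) ∂P.μI) P.μΩ := by
    exact Integrable.integral_slice hi
  have hi1 : Integrable (P.coef n u) P.μΩ := (Lp.memLp _).integrable (by norm_num)
  refine Integrable.ae_eq_of_forall_setIntegral_eq _ _ hi1 hi2 fun s hs hμs => ?_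
  refine ext_inner_left ℝ fun c => ?_
  rw [← L2.inner_indicatorConstLp_eq_inner_setIntegral ℝ hs hμs.ne, inner_coef_right,
    tens_eq_toLp, inner_toLp_left, ← integral_inner hi2.integrableOn, ← integral_indicator hs]
  have hind : ∀ᵐ z ∂P.μQ, (indicatorConstLp 2 hs hμs.ne c : Lp F 2 P.μΩ) z.1 =
      s.indicator (fun _ => c) z.1 := ae_fst indicatorConstLp_coeFn
  have h1 : ∫ z, inner ℝ (P.trig n z.2 • (indicatorConstLp 2 hs hμs.ne c : Lp F 2 P.μΩ) z.1)
      (u z) ∂P.μQ = ∫ z, inner ℝ (s.indicator (fun _ => c) z.1) (P.trig n z.2 • u z) ∂P.μQ := by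
    refine integral_congr_ae ?_
    filter_upwards [hind] with z hz
    rw [hz, real_inner_smul_left, real_inner_smul_right]
  have hi3 : Integrable (fun z => inner ℝ (s.indicator (fun _ => c) z.1)
      (P.trig n z.2 • u z)) P.μQ := by
    refine (hi.norm.const_mul ‖c‖).mono' ?_ (ae_of_all _ fun z => ?_)
    · refine AEStronglyMeasurable.inner ?_ hi.1
      exact ((stronglyMeasurable_const.indicator hs).comp_measurable
        measurable_fst).aestronglyMeasurable
    · refine (norm_inner_le_norm _ _).trans ?_
      exact mul_le_mul_of_nonneg_right (norm_indicator_le_norm_self (fun _ => c) _) (norm_nonneg _)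
  rw [h1, integral_μQ hi3]
  refine integral_congr_ae ?_
  have hae : ∀ᵐ x ∂P.μΩ, Integrable (fun t => P.trig n t • u (x, t)) P.μI := by
    exact Integrable.ae_slice hi
  filter_upwards [hae] with x hx
  by_cases hxs : x ∈ s
  · simp only [indicator_of_mem hxs]
    exact integral_inner hx c
  · simp [indicator_of_notMem hxs]

/-- There are countably many indices, so for almost every x all trigonometric moments of u(x,·)
vanish simultaneously, and completeness on (0,T) applies slice by slice. -/
theorem eq_zero_of_coef {u : Lp F 2 P.μQ} (h : ∀ n, P.coef n u = 0) : u = 0 := by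
  have hu : Integrable u P.μQ := (Lp.memLp u).integrable (by norm_num)
  have h1 : ∀ᵐ x ∂P.μΩ, ∀ n, ∫ t, P.trig n t • u (x, t) ∂P.μI = 0 := by
    rw [ae_all_iff]
    intro n
    filter_upwards [P.coef_ae n u, Lp.coeFn_zero F 2 P.μΩ] with x hx hx0
    rw [← hx, h n, hx0, Pi.zero_apply]
  have h2 : ∀ᵐ x ∂P.μΩ, Integrable (fun t => u (x, t)) P.μI := by
    exact Integrable.ae_slice hu
  have h3 : ∀ᵐ x ∂P.μΩ, ∀ᵐ t ∂P.μI, u (x, t) = 0 := by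
    filter_upwards [h1, h2] with x hx1 hx2
    exact P.ae_eq_zero_of_trig_moments hx2 hx1
  refine Lp.ext (EventuallyEq.trans ?_ (Lp.coeFn_zero _ _ _).symm)
  have hm : MeasurableSet {z | u z = 0} :=
    (Lp.stronglyMeasurable u).measurableSet_eq_fun stronglyMeasurable_const
  exact ae_of_ae_slice hm h3

theorem ext_coef {u v : Lp F 2 P.μQ} (h : ∀ n, P.coef n u = P.coef n v) : u = v := by
  rw [← sub_eq_zero]
  refine P.eq_zero_of_coef fun n => ?_
  rw [map_sub, h n, sub_self]

theorem isHilbertSum_tens : IsHilbertSum ℝ (fun _ : ℤ => Lp F 2 P.μΩ) P.tens := by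
  refine IsHilbertSum.mk (fun m n hmn a b => ?_) ?_
  · rw [inner_tens_tens, if_neg hmn]
  · rw [top_le_iff, Submodule.topologicalClosure_eq_top_iff, Submodule.eq_bot_iff]
    intro u hu
    refine P.eq_zero_of_coef fun n => ?_
    refine ext_inner_right ℝ fun a => ?_
    rw [inner_coef_left, inner_zero_left]
    exact (Submodule.mem_orthogonal' _ _).1 hu _
      (Submodule.mem_iSup_of_mem n ⟨a, rfl⟩)

theorem coef_eq_of_hasSum {c : ℤ → Lp F 2 P.μΩ} {u : Lp F 2 P.μQ}
    (h : HasSum (fun n => P.tens n (c n)) u) (n : ℤ) : P.coef n u = c n := by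
  have h2 : HasSum (fun m => P.coef n (P.tens m (c m))) (P.coef n u) := (P.coef n).hasSum h
  have h3 := hasSum_single (f := fun m => P.coef n (P.tens m (c m))) n fun m hm => by
    rw [coef_tens, if_neg hm.symm]
  rw [h2.unique h3, coef_tens_self]

theorem isHilbertSum_apply (u : Lp F 2 P.μQ) (n : ℤ) :
    P.isHilbertSum_tens.linearIsometryEquiv u n = P.coef n u := by
  have h := P.isHilbertSum_tens.hasSum_linearIsometryEquiv_symm
    (P.isHilbertSum_tens.linearIsometryEquiv u)
  rw [LinearIsometryEquiv.symm_apply_apply] at h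
  exact (P.coef_eq_of_hasSum h n).symm

/-- The Fourier series in time converges in `L²(Q)`. -/
theorem hasSum_tens_coef (u : Lp F 2 P.μQ) : HasSum (fun n => P.tens n (P.coef n u)) u := by
  have h := P.isHilbertSum_tens.hasSum_linearIsometryEquiv_symm
    (P.isHilbertSum_tens.linearIsometryEquiv u)
  rw [LinearIsometryEquiv.symm_apply_apply] at h
  simpa only [isHilbertSum_apply] using h

/-- Parseval's identity. -/
theorem hasSum_inner_coef (u v : Lp F 2 P.μQ) :
    HasSum (fun n => inner ℝ (P.coef n u) (P.coef n v)) (inner ℝ u v) := by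
  have h := lp.hasSum_inner (𝕜 := ℝ) (P.isHilbertSum_tens.linearIsometryEquiv u)
    (P.isHilbertSum_tens.linearIsometryEquiv v)
  rw [LinearIsometryEquiv.inner_map_map] at h
  simpa only [isHilbertSum_apply] using h

theorem hasSum_norm_sq_coef (u : Lp F 2 P.μQ) :
    HasSum (fun n => ‖P.coef n u‖ ^ 2) (‖u‖ ^ 2) := by
  simpa only [real_inner_self_eq_norm_sq] using P.hasSum_inner_coef u u

/-- Riesz–Fischer: square summable sequences are sequences of coefficients. -/
theorem exists_coef_eq {c : ℤ → Lp F 2 P.μΩ} (hc : Summable fun n => ‖c n‖ ^ 2) :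
    ∃ u : Lp F 2 P.μQ, ∀ n, P.coef n u = c n := by
  have hmem : Memℓp c 2 := memℓp_gen (by simpa using hc)
  refine ⟨P.isHilbertSum_tens.linearIsometryEquiv.symm ⟨c, hmem⟩, fun n => ?_⟩
  rw [← isHilbertSum_apply, LinearIsometryEquiv.apply_symm_apply]

end ParabolicProblem
end

noncomputable section

namespace ParabolicProblem

variable {d : ℕ} (P : ParabolicProblem d)

/-! ### Invariance of `H^{1,0}_0(Q)` under operations on the Fourier coefficients -/

/-- Pointwise Fourier coefficient of a test function. -/
def slice (n : ℤ) (φ : EuclideanSpace ℝ (Fin d) × ℝ → ℝ) (x : EuclideanSpace ℝ (Fin d)) : ℝ :=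
  ∫ t, P.trig n t * φ (x, t) ∂P.μI

variable {P}

theorem contDiff_slice {φ : EuclideanSpace ℝ (Fin d) × ℝ → ℝ} (h : IsTestOn P.Q φ) (n : ℤ) :
    ContDiff ℝ ∞ (P.slice n φ) := by
  -- The slice is the value at time 0 of the convolution of t ↦ θ_n(-t) with φ(x,·), so smoothness
  -- in the parameter x comes from that of parametrized convolutions.
  have h1 := contDiffOn_convolution_right_with_param (μ := (volume : Measure ℝ)) (n := ⊤)
    (ContinuousLinearMap.mul ℝ ℝ) (f := fun t => P.trig n (-t)) (g := fun x t => φ (x, t))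
    (s := univ) (k := Prod.snd '' tsupport φ) isOpen_univ (h.2.1.isCompact.image continuous_snd)
    (fun x t _ ht => image_eq_zero_of_notMem_tsupport fun hh => ht ⟨_, hh, rfl⟩)
    (((P.continuous_trig n).comp continuous_neg).locallyIntegrable)
    (h.1.contDiffOn)
  rw [univ_prod_univ, contDiffOn_univ] at h1
  have h2 := h1.comp (contDiff_id.prodMk (contDiff_const (c := (0 : ℝ))) :
    ContDiff ℝ ∞ fun x : EuclideanSpace ℝ (Fin d) => (x, (0 : ℝ)))
  convert! h2 using 1
  funext x
  simp only [slice, Function.comp_def, convolution_def, ContinuousLinearMap.mul_apply', zero_sub, id]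
  rw [integral_neg_eq_self (fun t => P.trig n t * φ (x, t)) volume]
  refine setIntegral_eq_integral_of_forall_compl_eq_zero fun t ht => ?_
  rw [image_eq_zero_of_notMem_tsupport (fun hh => ht (h.2.2 hh).2), mul_zero]

/-- Differentiation under the integral, dominated by a constant because φ has compact support and
(0,T) has finite measure. Consequently the Fourier coefficient of the gradient is the gradient of
the coefficient. -/
theorem hasGradientAt_slice {φ : EuclideanSpace ℝ (Fin d) × ℝ → ℝ} (h : IsTestOn P.Q φ) (n : ℤ)
    (x : EuclideanSpace ℝ (Fin d)) :
    HasGradientAt (P.slice n φ) (∫ t, P.trig n t • gradX φ (x, t) ∂P.μI) x := by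
  have hg : ∀ y t, HasGradientAt (fun y => φ (y, t)) (gradX φ (y, t)) y := by
    intro y t
    have h1 : HasFDerivAt φ (fderiv ℝ φ (y, t)) (y, t) :=
      (h.1.differentiable (by simp) _).hasFDerivAt
    have h2 : HasFDerivAt (fun x => φ (x, t))
        ((fderiv ℝ φ (y, t)).comp (ContinuousLinearMap.inl ℝ _ ℝ)) y :=
      HasFDerivAt.comp (f := fun x => (x, t)) y h1 (hasFDerivAt_prodMk_left y t)
    rw [gradX_eq h.1]
    exact h2.hasGradientAt
  obtain ⟨C, hC⟩ := h.hasCompactSupport_gradX.exists_bound_of_continuous (continuous_gradX h.1)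
  have hcg := continuous_gradX h.1
  have hct := P.continuous_trig n
  have hcφ := h.1.continuous
  have hb : ∀ y t, ‖P.trig n t • gradX φ (y, t)‖ ≤ √(2 / P.T) * C := by
    intro y t
    rw [norm_smul]
    exact mul_le_mul (P.abs_trig_le n t) (hC _) (norm_nonneg _) (Real.sqrt_nonneg _)
  obtain ⟨C', hC'⟩ := h.2.1.exists_bound_of_continuous hcφ
  have h1 := hasFDerivAt_integral_of_dominated_of_fderiv_le (𝕜 := ℝ) (μ := P.μI)
    (F := fun y t => P.trig n t * φ (y, t)) (x₀ := x) (s := univ)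
    (F' := fun y t => InnerProductSpace.toDual ℝ _ (P.trig n t • gradX φ (y, t)))
    (bound := fun _ => √(2 / P.T) * C) univ_mem ?_ ?_ ?_ ?_ ?_ ?_
  · have h2 : ∫ t, InnerProductSpace.toDual ℝ (EuclideanSpace ℝ (Fin d))
        (P.trig n t • gradX φ (x, t)) ∂P.μI = InnerProductSpace.toDual ℝ _
        (∫ t, P.trig n t • gradX φ (x, t) ∂P.μI) := by
      have hi1 : Integrable (fun t => P.trig n t • gradX φ (x, t)) P.μI :=
        (integrable_const (√(2 / P.T) * C)).mono'
          (Continuous.aestronglyMeasurable (by fun_prop)) (ae_of_all _ fun t => hb x t)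
      have hi2 : Integrable (fun t => InnerProductSpace.toDual ℝ (EuclideanSpace ℝ (Fin d))
          (P.trig n t • gradX φ (x, t))) P.μI := by
        refine (integrable_const (√(2 / P.T) * C)).mono' (Continuous.aestronglyMeasurable
          ((InnerProductSpace.toDual ℝ (EuclideanSpace ℝ (Fin d))).continuous.comp
            (by fun_prop))) (ae_of_all _ fun t => ?_)
        rw [LinearIsometryEquiv.norm_map]
        exact hb x t
      ext1 v
      rw [ContinuousLinearMap.integral_apply hi2, InnerProductSpace.toDual_apply_apply,
        real_inner_comm, ← integral_inner hi1]
      simp only [InnerProductSpace.toDual_apply_apply, real_inner_comm]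
    rw [h2] at h1
    exact h1
  · exact Eventually.of_forall fun y => Continuous.aestronglyMeasurable (by fun_prop)
  · refine (integrable_const (√(2 / P.T) * C')).mono'
        (Continuous.aestronglyMeasurable (by fun_prop)) (ae_of_all _ fun t => ?_)
    rw [norm_mul]
    exact mul_le_mul (P.abs_trig_le n t) (hC' _) (norm_nonneg _) (Real.sqrt_nonneg _)
  · exact Continuous.aestronglyMeasurable
      ((InnerProductSpace.toDual ℝ (EuclideanSpace ℝ (Fin d))).continuous.comp (by fun_prop))
  · refine ae_of_all _ fun t y _ => ?_
    rw [LinearIsometryEquiv.norm_map]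
    exact hb y t
  · exact integrable_const _
  · refine ae_of_all _ fun t y _ => ?_
    rw [map_smul]
    exact (hg y t).hasFDerivAt.const_mul _

theorem tsupport_slice_subset {φ : EuclideanSpace ℝ (Fin d) × ℝ → ℝ} (h : IsTestOn P.Q φ) (n : ℤ) :
    tsupport (P.slice n φ) ⊆ Prod.fst '' tsupport φ := by
  refine closure_minimal (fun x hx => ?_) (h.2.1.isCompact.image continuous_fst).isClosed
  by_contra hne
  refine hx ?_
  have : ∀ t, φ (x, t) = 0 := fun t =>
    image_eq_zero_of_notMem_tsupport fun hh => hne ⟨_, hh, rfl⟩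
  simp [slice, this]

theorem hasCompactSupport_slice {φ : EuclideanSpace ℝ (Fin d) × ℝ → ℝ} (h : IsTestOn P.Q φ)
    (n : ℤ) : HasCompactSupport (P.slice n φ) :=
  (h.2.1.isCompact.image continuous_fst).of_isClosed_subset (isClosed_tsupport _)
    (tsupport_slice_subset h n)

theorem tsupport_slice_subset_Ω {φ : EuclideanSpace ℝ (Fin d) × ℝ → ℝ} (h : IsTestOn P.Q φ)
    (n : ℤ) : tsupport (P.slice n φ) ⊆ P.Ω := by
  refine (tsupport_slice_subset h n).trans ?_
  rintro _ ⟨z, hz, rfl⟩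
  exact (h.2.2 hz).1

theorem coef_toLp_ae {F : Type*} [NormedAddCommGroup F] [InnerProductSpace ℝ F] [CompleteSpace F]
    {f : EuclideanSpace ℝ (Fin d) × ℝ → F} (hf : MemLp f 2 P.μQ) (n : ℤ) :
    P.coef n (hf.toLp f) =ᵐ[P.μΩ] fun x => ∫ t, P.trig n t • f (x, t) ∂P.μI := by
  have h1 : ∀ᵐ x ∂P.μΩ, ∀ᵐ t ∂P.μI, hf.toLp f (x, t) = f (x, t) :=
    ae_slice_of_ae hf.coeFn_toLp
  filter_upwards [P.coef_ae n (hf.toLp f), h1] with x hx hx1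
  rw [hx]
  refine integral_congr_ae ?_
  filter_upwards [hx1] with t ht
  rw [ht]

/-- Product test functions. -/
theorem isTestOn_prod {a : EuclideanSpace ℝ (Fin d) → ℝ} {b : ℝ → ℝ} {I : Set ℝ}
    (ha : ContDiff ℝ ∞ a) (hac : HasCompactSupport a) (has : tsupport a ⊆ P.Ω)
    (hb : ContDiff ℝ ∞ b) (hbc : HasCompactSupport b) (hbs : tsupport b ⊆ I) :
    IsTestOn (P.Ω ×ˢ I) (fun z => b z.2 * a z.1) := by
  have hsub : tsupport (fun z : EuclideanSpace ℝ (Fin d) × ℝ => b z.2 * a z.1) ⊆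
      tsupport a ×ˢ tsupport b := by
    refine closure_minimal (fun z hz => ?_) ((isClosed_tsupport a).prod (isClosed_tsupport b))
    have hz' : b z.2 * a z.1 ≠ 0 := hz
    exact ⟨subset_tsupport _ (right_ne_zero_of_mul hz'), subset_tsupport _ (left_ne_zero_of_mul hz')⟩
  exact ⟨(hb.comp contDiff_snd).mul (ha.comp contDiff_fst),
    (hac.isCompact.prod hbc.isCompact).of_isClosed_subset (isClosed_tsupport _) hsub,
    hsub.trans (prod_mono has hbs)⟩

theorem continuous_gradient {a : EuclideanSpace ℝ (Fin d) → ℝ} (ha : ContDiff ℝ ∞ a) :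
    Continuous (gradient a) :=
  (InnerProductSpace.toDual ℝ (EuclideanSpace ℝ (Fin d))).symm.continuous.comp
    (ha.continuous_fderiv (by simp))

theorem hasCompactSupport_gradient {a : EuclideanSpace ℝ (Fin d) → ℝ} (hac : HasCompactSupport a) :
    HasCompactSupport (gradient a) := by
  refine (hac.fderiv (𝕜 := ℝ)).mono fun z hz h0 => hz ?_
  rw [gradient, h0, map_zero]

/-- Time-dependent factors may be pulled out of a weak divergence. -/
theorem HasWeakDiv.integral_time_mul {τ : P.L2Qd} {q : P.L2Q} (h : P.HasWeakDiv τ q)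
    {a : EuclideanSpace ℝ (Fin d) → ℝ} (ha : ContDiff ℝ ∞ a) (hac : HasCompactSupport a)
    (has : tsupport a ⊆ P.Ω) {b : ℝ → ℝ} {C : ℝ} (hb : Continuous b) (hC : ∀ t, ‖b t‖ ≤ C) :
    ∫ z, b z.2 * (q z * a z.1 + inner ℝ (τ z) (gradient a z.1)) ∂P.μQ = 0 := by
  have hr : Integrable (fun z => q z * a z.1 + inner ℝ (τ z) (gradient a z.1)) P.μQ := by
    have h1 : MemLp (fun z : EuclideanSpace ℝ (Fin d) × ℝ => a z.1) 2 P.μQ :=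
      P.memLp_comp_fst (ha.continuous.memLp_of_hasCompactSupport hac)
    have h2 : MemLp (fun z : EuclideanSpace ℝ (Fin d) × ℝ => gradient a z.1) 2 P.μQ :=
      P.memLp_comp_fst ((continuous_gradient ha).memLp_of_hasCompactSupport
        (hasCompactSupport_gradient hac))
    exact ((Lp.memLp q).integrable_mul h1).add (integrable_inner_of_memLp τ h2)
  set r := fun z => q z * a z.1 + inner ℝ (τ z) (gradient a z.1) with hrdef
  have hfub : ∀ b : ℝ → ℝ, Continuous b → (∃ C, ∀ t, ‖b t‖ ≤ C) →
      ∫ z, b z.2 * r z ∂P.μQ = ∫ t, b t • ∫ x, r (x, t) ∂P.μΩ ∂P.μI := by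
    rintro b hb ⟨C, hC⟩
    have hi : Integrable (fun z => b z.2 * r z) P.μQ :=
      hr.bdd_mul (c := C) (hb.comp continuous_snd).aestronglyMeasurable (ae_of_all _ fun z => hC z.2)
    rw [μQ_eq] at hi ⊢
    rw [integral_prod_symm _ hi]
    simp only [integral_const_mul, smul_eq_mul]
  have hm : Integrable (fun t => ∫ x, r (x, t) ∂P.μΩ) P.μI := by
    have := hr
    rw [μQ_eq] at this
    exact this.integral_prod_right
  -- Product test functions with time factor in C_c^∞(0,T) show that the spatial integral vanishes
  -- for almost every t. After that the time factor need no longer vanish at the ends, so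
  -- trigonometric factors are allowed.
  have h0 : ∀ᵐ t ∂P.μI, ∫ x, r (x, t) ∂P.μΩ = 0 := by
    refine (ae_restrict_iff' measurableSet_Ioo).2 ?_
    refine isOpen_Ioo.ae_eq_zero_of_integral_contDiff_smul_eq_zero
      (IntegrableOn.locallyIntegrableOn hm) fun b hb hbc hbs => ?_
    have hz : ∀ t ∉ Ioo 0 P.T, b t = 0 := fun t ht =>
      image_eq_zero_of_notMem_tsupport fun hh => ht (hbs hh)
    rw [← setIntegral_eq_integral_of_forall_compl_eq_zero (s := Ioo 0 P.T)
      fun t ht => by rw [hz t ht, zero_smul]]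
    rw [← hfub b hb.continuous (hbc.exists_bound_of_continuous hb.continuous)]
    have hφ : IsTestOn P.Q (fun z => b z.2 * a z.1) := isTestOn_prod ha hac has hb hbc hbs
    rw [← hasWeakDiv_iff_inner.1 h _ hφ, inner_toLp_right, inner_toLp_right,
      ← integral_add (integrable_inner_of_memLp q hφ.memLp)
        (integrable_inner_of_memLp τ hφ.memLp_gradX)]
    refine integral_congr_ae (ae_of_all _ fun z => ?_)
    simp only [hrdef, gradX_smul_left a ha b z, real_inner_smul_right, RCLike.inner_apply,
      conj_trivial]
    ring
  rw [hfub b hb ⟨C, hC⟩]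
  refine integral_eq_zero_of_ae ?_
  filter_upwards [h0] with t ht
  rw [ht, smul_zero, Pi.zero_apply]

/-- Pairing with φ moves the operation to the other side: it amounts to pairing (τ, q) with θ_m
times the n-th slice of φ. That slice is a test function on Ω, and θ_m may be inserted by
`HasWeakDiv.integral_time_mul`. -/
theorem HasWeakDiv.tens_coef {τ : P.L2Qd} {q : P.L2Q} (h : P.HasWeakDiv τ q) (m n : ℤ) :
    P.HasWeakDiv (P.tens n (P.coef m τ)) (P.tens n (P.coef m q)) := by
  rw [hasWeakDiv_iff_inner]
  intro φ hφ
  have h0 := h.integral_time_mul (contDiff_slice hφ n) (hasCompactSupport_slice hφ n)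
    (tsupport_slice_subset_Ω hφ n) (P.continuous_trig m) (P.abs_trig_le m)
  rw [← inner_coef_right, ← inner_coef_right, inner_coef_left, inner_coef_left, tens_eq_toLp,
    tens_eq_toLp, inner_toLp_right, inner_toLp_right, ← integral_add, ← h0]
  · refine integral_congr_ae ?_
    filter_upwards [ae_fst (coef_toLp_ae (hφ.memLp (P := P)) n),
      ae_fst (coef_toLp_ae (hφ.memLp_gradX (P := P)) n)] with z h1 h2
    rw [h1, h2, (hasGradientAt_slice hφ n z.1).gradient, real_inner_smul_right,
      real_inner_smul_right, slice]
    simp only [RCLike.inner_apply, conj_trivial, smul_eq_mul]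
    ring
  · exact integrable_inner_of_memLp _ (P.memLp_tens _ _)
  · exact integrable_inner_of_memLp _ (P.memLp_tens _ _)

/-- `H^{1,0}_0(Q)` is invariant under operations on the Fourier coefficients in time. -/
theorem MemH10Zero.tens_coef {u : P.L2Q} {G : P.L2Qd} (h : P.MemH10Zero u G) (m n : ℤ) :
    P.MemH10Zero (P.tens n (P.coef m u)) (P.tens n (P.coef m G)) := by
  rw [memH10Zero_iff]
  intro τ q hτ
  -- The adjoint of u ↦ θ_n ⊗ u_m is q ↦ θ_m ⊗ q_n, hence the exchanged indices.
  have := h.inner_add_eq_zero (hτ.tens_coef n m)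
  rwa [← inner_coef_right, ← inner_coef_right, inner_coef_left, inner_coef_left] at this

end ParabolicProblem
end

noncomputable section

theorem hasSum_inner_right_const {ι E : Type*} [NormedAddCommGroup E] [InnerProductSpace ℝ E]
    {f : ι → E} {a : E} (h : HasSum f a) (b : E) :
    HasSum (fun i => inner ℝ (f i) b) (inner ℝ a b) := by
  have h1 : HasSum (fun i => inner ℝ b (f i)) (inner ℝ b a) := (innerSL ℝ b).hasSum h
  rw [real_inner_comm a b] at h1
  refine h1.congr_fun fun i => ?_
  exact real_inner_comm _ _

namespace ParabolicProblem

variable {d : ℕ} {P : ParabolicProblem d}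

/-! ### Periodic time derivatives in terms of Fourier coefficients -/

theorem L2Ω_eq_zero {f : P.L2Ω} (h : ∀ c : EuclideanSpace ℝ (Fin d) → ℝ, ContDiff ℝ ∞ c →
    HasCompactSupport c → tsupport c ⊆ P.Ω → ∫ x, c x * f x ∂P.μΩ = 0) : f = 0 := by
  have hf : Integrable f P.μΩ := (Lp.memLp f).integrable (by norm_num)
  refine Lp.ext (EventuallyEq.trans ?_ (Lp.coeFn_zero _ _ _).symm)
  refine (ae_restrict_iff' P.isOpen_Ω.measurableSet).2 ?_
  refine P.isOpen_Ω.ae_eq_zero_of_integral_contDiff_smul_eq_zero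
    (IntegrableOn.locallyIntegrableOn hf) fun c hc hcc hcs => ?_
  rw [← h c hc hcc hcs]
  refine (setIntegral_eq_integral_of_forall_compl_eq_zero fun x hx => ?_).symm
  rw [image_eq_zero_of_notMem_tsupport fun hh => hx (hcs hh), zero_smul]

/-- Testing with θ_n(t)c(x), cut off in time outside [0,T], makes the two trace terms cancel,
because the traces coincide and θ_n is periodic. -/
theorem HasPeriodicTimeDeriv.coef_eq {u w : P.L2Q} (h : P.HasPeriodicTimeDeriv u w) (n : ℤ) :
    P.coef n w = (n * P.freq) • P.coef (-n) u := by
  obtain ⟨a, ha⟩ := h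
  rw [← sub_eq_zero]
  refine L2Ω_eq_zero fun c hc hcc hcs => ?_
  have hT := P.T_pos
  -- The inner ball of radius T about T/2 contains [0,T], so the cutoff is 1 there and affects
  -- neither the traces nor the derivative inside (0,T).
  let χ : ContDiffBump (P.T / 2) := ⟨P.T, 2 * P.T, hT, by linarith⟩
  have hχ : ∀ t ∈ Icc 0 P.T, χ t = 1 := fun t ht => by
    refine χ.one_of_mem_closedBall ?_
    rw [Metric.mem_closedBall, Real.dist_eq, abs_le]
    change -P.T ≤ _ ∧ _ ≤ P.T
    exact ⟨by linarith [ht.1], by linarith [ht.2]⟩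
  have hφ : IsTestOn (P.Ω ×ˢ univ) (fun z => (P.trig n z.2 * χ z.2) * c z.1) :=
    isTestOn_prod (b := fun t => P.trig n t * χ t) hc hcc hcs ((P.contDiff_trig n).mul χ.contDiff)
      χ.hasCompactSupport.mul_left (subset_univ _)
  have h1 := ha _ hφ
  have hD : ∀ z ∈ P.Q, derivT (fun z => (P.trig n z.2 * χ z.2) * c z.1) z =
      -(n * P.freq) * (P.trig (-n) z.2 * c z.1) := by
    intro z hz
    have h2 : (fun t => P.trig n t * χ t * c z.1) =ᶠ[𝓝 z.2] fun t => P.trig n t * c z.1 := by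
      filter_upwards [isOpen_Ioo.mem_nhds hz.2] with t ht
      rw [hχ t (Ioo_subset_Icc_self ht), mul_one]
    rw [derivT]
    change deriv (fun t => P.trig n t * χ t * c z.1) z.2 = _
    rw [h2.deriv_eq, ((P.hasDerivAt_trig n z.2).mul_const _).deriv]
    ring
  have hcL : MemLp c 2 P.μΩ := hc.continuous.memLp_of_hasCompactSupport hcc
  have h3 : ∀ (m : ℤ) (v : P.L2Q), inner ℝ (P.coef m v) (hcL.toLp c) =
      ∫ z, v z * (P.trig m z.2 * c z.1) ∂P.μQ := by
    intro m v
    rw [inner_coef_left, tens_eq_toLp, inner_toLp_right]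
    refine integral_congr_ae ?_
    filter_upwards [ae_fst hcL.coeFn_toLp] with z hz
    rw [hz]
    simp only [RCLike.inner_apply, conj_trivial, smul_eq_mul]
    ring
  have hQ : ∀ᵐ z ∂P.μQ, z ∈ P.Q := ae_restrict_mem P.isOpen_Q.measurableSet
  have h4 : ∫ z, u z * derivT (fun z => (P.trig n z.2 * χ z.2) * c z.1) z ∂P.μQ =
      -(n * P.freq) * inner ℝ (P.coef (-n) u) (hcL.toLp c) := by
    rw [h3, ← integral_const_mul]
    refine integral_congr_ae ?_
    filter_upwards [hQ] with z hz
    rw [hD z hz]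
    ring
  have h5 : ∫ z, w z * (P.trig n z.2 * χ z.2 * c z.1) ∂P.μQ =
      inner ℝ (P.coef n w) (hcL.toLp c) := by
    rw [h3]
    refine integral_congr_ae ?_
    filter_upwards [hQ] with z hz
    rw [hχ z.2 (Ioo_subset_Icc_self hz.2), mul_one]
  rw [h4, h5] at h1
  simp only [hχ 0 (left_mem_Icc.2 hT.le), hχ P.T (right_mem_Icc.2 hT.le), trig_T, sub_self] at h1
  have h6 : ∫ x, c x * (P.coef n w - (n * P.freq) • P.coef (-n) u : P.L2Ω) x ∂P.μΩ =
      inner ℝ (P.coef n w - (n * P.freq) • P.coef (-n) u) (hcL.toLp c) := by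
    rw [inner_toLp_right]
    rfl
  rw [h6, inner_sub_left, real_inner_smul_left]
  linarith

variable (P) in
theorem memLp_trace {U : Set (EuclideanSpace ℝ (Fin d) × ℝ)}
    {φ : EuclideanSpace ℝ (Fin d) × ℝ → ℝ} (h : IsTestOn U φ) (t : ℝ) :
    MemLp (fun x => φ (x, t)) 2 P.μΩ := by
  obtain ⟨C, hC⟩ := h.2.1.exists_bound_of_continuous h.1.continuous
  have hc := h.1.continuous
  exact MemLp.of_bound (Continuous.aestronglyMeasurable (by fun_prop)) C (ae_of_all _ fun x => hC _)

/-- Integration by parts in the Fourier coefficients of a test function. -/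
theorem coef_derivT {U : Set (EuclideanSpace ℝ (Fin d) × ℝ)}
    {φ : EuclideanSpace ℝ (Fin d) × ℝ → ℝ} (h : IsTestOn U φ) (n : ℤ) :
    P.coef n ((h.memLp_derivT (P := P)).toLp _) =
      P.trig n 0 • ((P.memLp_trace h P.T).toLp _ - (P.memLp_trace h 0).toLp _) +
        (n * P.freq) • P.coef (-n) ((h.memLp (P := P)).toLp φ) := by
  refine Lp.ext ?_
  filter_upwards [coef_toLp_ae (h.memLp_derivT (P := P)) n, coef_toLp_ae (h.memLp (P := P)) (-n),
    Lp.coeFn_add (P.trig n 0 • ((P.memLp_trace h P.T).toLp _ - (P.memLp_trace h 0).toLp _))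
      ((n * P.freq) • P.coef (-n) ((h.memLp (P := P)).toLp φ)),
    Lp.coeFn_smul (P.trig n 0) ((P.memLp_trace h P.T).toLp _ - (P.memLp_trace h 0).toLp _),
    Lp.coeFn_smul (n * P.freq) (P.coef (-n) ((h.memLp (P := P)).toLp φ)),
    Lp.coeFn_sub ((P.memLp_trace h P.T).toLp _) ((P.memLp_trace h 0).toLp _),
    (P.memLp_trace h P.T).coeFn_toLp, (P.memLp_trace h 0).coeFn_toLp]
    with x h1 h2 h3 h4 h5 h6 h7 h8
  rw [h1, h3, Pi.add_apply, h4, h5, Pi.smul_apply, Pi.smul_apply, h2, h6, Pi.sub_apply, h7, h8]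
  have hc := h.1.continuous
  have hcd := continuous_derivT h.1
  have hct := P.continuous_trig
  have h9 := intervalIntegral.integral_eq_sub_of_hasDerivAt (a := 0) (b := P.T)
    (f := fun t => P.trig n t * φ (x, t))
    (fun t _ => (P.hasDerivAt_trig n t).mul (hasDerivAt_derivT h.1 x t))
    (Continuous.intervalIntegrable (by fun_prop) _ _)
  rw [intervalIntegral.integral_add (Continuous.intervalIntegrable (by fun_prop) _ _)
    (Continuous.intervalIntegrable (by fun_prop) _ _)] at h9
  simp only [mul_assoc, intervalIntegral.integral_const_mul, trig_T] at h9
  simp only [smul_eq_mul, integral_μI]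
  linear_combination h9

/-- The candidate for the common trace u(0) = u(T) is the Fourier series at t = 0. It converges
absolutely since ‖u_n‖ = (1/|n|)·|n|‖u_n‖ ≤ ½(1/n² + n²‖u_n‖²), and both terms are summable. -/
theorem summable_trace {u w : P.L2Q}
    (h : ∀ n, P.coef n w = (n * P.freq) • P.coef (-n) u) :
    Summable fun n => P.trig n 0 • P.coef n u := by
  have hω := P.freq_pos
  have hw : Summable fun n => ‖P.coef (-n) w‖ ^ 2 :=
    (Equiv.neg ℤ).summable_iff.2 (P.hasSum_norm_sq_coef w).summable
  have hb : Summable fun n : ℤ => √(2 / P.T) * (1 / 2 *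
      (1 / (n : ℝ) ^ 2 + P.freq⁻¹ ^ 2 * ‖P.coef (-n) w‖ ^ 2)) :=
    (((Real.summable_one_div_int_pow.2 one_lt_two).add (hw.mul_left _)).mul_left _).mul_left _
  refine Summable.of_norm_bounded_eventually hb ?_
  -- The majorant controls only the terms with n ≠ 0; a single index does not affect summability.
  filter_upwards [(Set.finite_singleton (0 : ℤ)).compl_mem_cofinite] with n hn
  have hn' : (n : ℝ) ≠ 0 := Int.cast_ne_zero.2 hn
  rw [norm_smul]
  refine mul_le_mul (P.abs_trig_le n 0) ?_ (norm_nonneg _) (Real.sqrt_nonneg _)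
  rw [h (-n), neg_neg, norm_smul, mul_pow, Real.norm_eq_abs, sq_abs]
  push_cast
  have h1 : 1 / (n : ℝ) ^ 2 + P.freq⁻¹ ^ 2 * ((-n * P.freq) ^ 2 * ‖P.coef n u‖ ^ 2) =
      (1 / (n : ℝ)) ^ 2 + (n * ‖P.coef n u‖) ^ 2 := by
    field_simp
  have h2 : 1 / (n : ℝ) * (n * ‖P.coef n u‖) = ‖P.coef n u‖ := by field_simp
  rw [h1]
  linarith [two_mul_le_add_sq (1 / (n : ℝ)) (n * ‖P.coef n u‖)]

/-- Parseval turns the left side into a sum over the coefficients of ∂ₜφ. By `coef_derivT` each term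
splits into a boundary part, which sums to the pairing with the trace, and a part that is Parseval
for -⟨w, φ⟩ after n ↦ -n. -/
theorem inner_derivT {u w : P.L2Q} (h : ∀ n, P.coef n w = (n * P.freq) • P.coef (-n) u)
    {a : P.L2Ω} (ha : HasSum (fun n => P.trig n 0 • P.coef n u) a)
    {U : Set (EuclideanSpace ℝ (Fin d) × ℝ)}
    {φ : EuclideanSpace ℝ (Fin d) × ℝ → ℝ} (hφ : IsTestOn U φ) :
    inner ℝ u ((hφ.memLp_derivT (P := P)).toLp _) =
      inner ℝ a ((P.memLp_trace hφ P.T).toLp _ - (P.memLp_trace hφ 0).toLp _) +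
        -inner ℝ w ((hφ.memLp (P := P)).toLp φ) := by
  have h1 := hasSum_inner_right_const ha
    ((P.memLp_trace hφ P.T).toLp _ - (P.memLp_trace hφ 0).toLp _)
  have h2 := ((Equiv.neg ℤ).hasSum_iff.2
    (P.hasSum_inner_coef w ((hφ.memLp (P := P)).toLp φ))).neg
  have h3 := P.hasSum_inner_coef u ((hφ.memLp_derivT (P := P)).toLp _)
  refine h3.unique ((h1.add h2).congr_fun fun n => ?_)
  simp only [Function.comp_apply, Equiv.neg_apply]
  rw [coef_derivT hφ, h (-n), neg_neg, inner_add_right, real_inner_smul_right,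
    real_inner_smul_right, real_inner_smul_left, real_inner_smul_left]
  push_cast
  ring

/-- This is the converse of `HasPeriodicTimeDeriv.coef_eq`: periodic differentiability is entirely a
condition on coefficients, the required trace being the sum of the series at t = 0. -/
theorem HasPeriodicTimeDeriv.of_coef {u w : P.L2Q}
    (h : ∀ n, P.coef n w = (n * P.freq) • P.coef (-n) u) : P.HasPeriodicTimeDeriv u w := by
  obtain ⟨a, ha⟩ := summable_trace h
  refine ⟨a, fun φ hφ => ?_⟩
  have h4 := inner_derivT h ha hφ
  rw [inner_sub_right, inner_toLp_right, inner_toLp_right, inner_toLp_right,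
    inner_toLp_right] at h4
  simp only [RCLike.inner_apply, conj_trivial] at h4
  simp only [mul_comm (u _), mul_comm (w _), mul_comm (a _)]
  rw [h4, sub_eq_add_neg _ (∫ z, _ ∂P.μQ)]

end ParabolicProblem
end

noncomputable section

/-! ### Multiplication by bounded functions -/

section
variable {α F : Type*} [MeasurableSpace α] {μ : Measure α} [NormedAddCommGroup F]
  [InnerProductSpace ℝ F] {m : α → ℝ} {C : ℝ}

theorem memLp_bdd_smul (hm : AEStronglyMeasurable m μ) (hC : ∀ᵐ x ∂μ, ‖m x‖ ≤ C) (f : Lp F 2 μ) :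
    MemLp (fun x => m x • f x) 2 μ := by
  refine (Lp.memLp f).of_le_mul (c := C) (hm.smul (Lp.aestronglyMeasurable f)) ?_
  filter_upwards [hC] with x hx
  rw [norm_smul]
  exact mul_le_mul_of_nonneg_right hx (norm_nonneg _)

/-- Multiplication by a bounded function on `L²`. -/
def bddMul (hm : AEStronglyMeasurable m μ) (hC : ∀ᵐ x ∂μ, ‖m x‖ ≤ C) : Lp F 2 μ →L[ℝ] Lp F 2 μ :=
  LinearMap.mkContinuous
    { toFun := fun f => (memLp_bdd_smul hm hC f).toLp _
      map_add' := fun f g => by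
        rw [← MemLp.toLp_add]
        refine MemLp.toLp_congr _ _ ?_
        filter_upwards [Lp.coeFn_add f g] with z hz
        simp only [hz, Pi.add_apply, smul_add]
      map_smul' := fun c f => by
        rw [RingHom.id_apply, ← MemLp.toLp_const_smul]
        refine MemLp.toLp_congr _ _ ?_
        filter_upwards [Lp.coeFn_smul c f] with z hz
        simp only [hz, Pi.smul_apply, smul_comm c] }
    C fun f => by
      refine Lp.norm_le_mul_norm_of_ae_le_mul ?_
      filter_upwards [hC, (memLp_bdd_smul hm hC f).coeFn_toLp] with x hx hx2
      rw [LinearMap.coe_mk, AddHom.coe_mk, hx2, norm_smul]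
      exact mul_le_mul_of_nonneg_right hx (norm_nonneg _)

theorem bddMul_ae (hm : AEStronglyMeasurable m μ) (hC : ∀ᵐ x ∂μ, ‖m x‖ ≤ C) (f : Lp F 2 μ) :
    bddMul hm hC f =ᵐ[μ] fun x => m x • f x :=
  (memLp_bdd_smul hm hC f).coeFn_toLp

theorem inner_bddMul_comm (hm : AEStronglyMeasurable m μ) (hC : ∀ᵐ x ∂μ, ‖m x‖ ≤ C)
    (f g : Lp F 2 μ) : inner ℝ (bddMul hm hC f) g = inner ℝ f (bddMul hm hC g) := by
  rw [L2.inner_def, L2.inner_def]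
  refine integral_congr_ae ?_
  filter_upwards [bddMul_ae hm hC f, bddMul_ae hm hC g] with x h1 h2
  rw [h1, h2, real_inner_smul_left, real_inner_smul_right]

theorem le_inner_bddMul_self (hm : AEStronglyMeasurable m μ) (hC : ∀ᵐ x ∂μ, ‖m x‖ ≤ C) {lo : ℝ}
    (hlo : ∀ᵐ x ∂μ, lo ≤ m x) (f : Lp F 2 μ) :
    lo * ‖f‖ ^ 2 ≤ inner ℝ (bddMul hm hC f) f := by
  rw [← real_inner_self_eq_norm_sq, ← real_inner_smul_left, L2.inner_def, L2.inner_def]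
  refine integral_mono_ae (L2.integrable_inner _ _) (L2.integrable_inner _ _) ?_
  filter_upwards [bddMul_ae hm hC f, Lp.coeFn_smul lo f, hlo] with x h1 h2 h3
  simp only [h1, h2, Pi.smul_apply, real_inner_smul_left]
  exact mul_le_mul_of_nonneg_right h3 real_inner_self_nonneg

end

namespace ParabolicProblem

variable {d : ℕ} (P : ParabolicProblem d)

/-- Coefficients of the differential equation. -/
structure IsCoeff (c : EuclideanSpace ℝ (Fin d) → ℝ) (lo hi : ℝ) : Prop where
  measurable : Measurable c
  pos : 0 < lo
  bounds : ∀ x ∈ P.Ω, lo ≤ c x ∧ c x ≤ hi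

theorem isCoeff_σ : P.IsCoeff P.σ P.σlo P.σhi := ⟨P.measurable_σ, P.σlo_pos, P.σ_bounds⟩

theorem isCoeff_ν : P.IsCoeff P.ν P.νlo P.νhi := ⟨P.measurable_ν, P.νlo_pos, P.ν_bounds⟩

variable {P} {F : Type*} [NormedAddCommGroup F] [InnerProductSpace ℝ F]
  {c : EuclideanSpace ℝ (Fin d) → ℝ} {lo hi : ℝ}

theorem IsCoeff.ae_bounds (h : P.IsCoeff c lo hi) : ∀ᵐ x ∂P.μΩ, lo ≤ c x ∧ c x ≤ hi := by
  filter_upwards [ae_restrict_mem P.isOpen_Ω.measurableSet] with x hx using h.bounds x hx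

theorem IsCoeff.ae_norm_le (h : P.IsCoeff c lo hi) : ∀ᵐ x ∂P.μΩ, ‖c x‖ ≤ hi := by
  filter_upwards [h.ae_bounds] with x hx
  rw [Real.norm_of_nonneg (h.pos.le.trans hx.1)]
  exact hx.2

/-- Multiplication by a coefficient on `L²(Q)`. -/
def IsCoeff.mulQ (h : P.IsCoeff c lo hi) : Lp F 2 P.μQ →L[ℝ] Lp F 2 P.μQ :=
  bddMul (m := fun z => c z.1) (h.measurable.comp measurable_fst).aestronglyMeasurable
    (ae_fst h.ae_norm_le)

/-- Multiplication by a coefficient on `L²(Ω)`. -/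
def IsCoeff.mulΩ (h : P.IsCoeff c lo hi) : Lp F 2 P.μΩ →L[ℝ] Lp F 2 P.μΩ :=
  bddMul h.measurable.aestronglyMeasurable h.ae_norm_le

theorem mulσ_eq (w : P.L2Q) : P.mulσ w = P.isCoeff_σ.mulQ w := rfl

theorem mulν_eq (G : P.L2Qd) : P.mulν G = P.isCoeff_ν.mulQ G := rfl

theorem IsCoeff.inner_mulQ_comm (h : P.IsCoeff c lo hi) (f g : Lp F 2 P.μQ) :
    inner ℝ (h.mulQ f) g = inner ℝ f (h.mulQ g) := inner_bddMul_comm _ _ _ _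

theorem IsCoeff.le_inner_mulQ_self (h : P.IsCoeff c lo hi) (f : Lp F 2 P.μQ) :
    lo * ‖f‖ ^ 2 ≤ inner ℝ (h.mulQ f) f :=
  le_inner_bddMul_self _ _ (ae_fst (h.ae_bounds.mono fun _ hx => hx.1)) _

theorem IsCoeff.inner_mulΩ_comm (h : P.IsCoeff c lo hi) (f g : Lp F 2 P.μΩ) :
    inner ℝ (h.mulΩ f) g = inner ℝ f (h.mulΩ g) := inner_bddMul_comm _ _ _ _

theorem IsCoeff.mulQ_tens (h : P.IsCoeff c lo hi) (n : ℤ) (a : Lp F 2 P.μΩ) :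
    h.mulQ (P.tens n a) = P.tens n (h.mulΩ a) := by
  refine Lp.ext ?_
  filter_upwards [bddMul_ae (h.measurable.comp measurable_fst).aestronglyMeasurable
    (ae_fst h.ae_norm_le) (P.tens n a), P.tens_ae n a, P.tens_ae n (h.mulΩ a),
    ae_fst (bddMul_ae h.measurable.aestronglyMeasurable h.ae_norm_le a)] with z h1 h2 h3 h4
  rw [IsCoeff.mulQ, h1, h2, h3, IsCoeff.mulΩ, h4, smul_comm]
  rfl

variable [CompleteSpace F]

/-- Here the coefficient's independence of time enters: multiplication commutes with the embedding a
↦ a ⊗ θ_n, and being symmetric it also commutes with the adjoint. -/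
theorem IsCoeff.coef_mulQ (h : P.IsCoeff c lo hi) (n : ℤ) (u : Lp F 2 P.μQ) :
    P.coef n (h.mulQ u) = h.mulΩ (P.coef n u) := by
  refine ext_inner_right ℝ fun a => ?_
  rw [inner_coef_left, h.inner_mulQ_comm, h.mulQ_tens, ← inner_coef_left, h.inner_mulΩ_comm]

/-! ### The Hilbert transform in time -/

variable (P)

theorem summable_norm_sq_of_le {c : ℤ → Lp F 2 P.μΩ} {u : Lp F 2 P.μQ}
    (h : ∀ n, ‖c n‖ ≤ ‖P.coef (-n) u‖) : Summable fun n => ‖c n‖ ^ 2 :=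
  Summable.of_nonneg_of_le (fun _ => sq_nonneg _)
    (fun n => pow_le_pow_left₀ (norm_nonneg _) (h n) 2)
    ((Equiv.neg ℤ).summable_iff.2 (P.hasSum_norm_sq_coef u).summable)

theorem norm_sign_smul_le (n : ℤ) {E : Type*} [NormedAddCommGroup E] [NormedSpace ℝ E] (x : E) :
    ‖(-(n.sign : ℝ)) • x‖ ≤ ‖x‖ := by
  rw [norm_smul, norm_neg]
  refine mul_le_of_le_one_left (norm_nonneg _) ?_
  rcases Int.sign_trichotomy n with h | h | h <;> simp [h]

theorem exists_hilb (u : Lp F 2 P.μQ) :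
    ∃ v : Lp F 2 P.μQ, ∀ n : ℤ, P.coef n v = (-(n.sign : ℝ)) • P.coef (-n) u :=
  P.exists_coef_eq (P.summable_norm_sq_of_le fun n => norm_sign_smul_le n _)

/-- The function underlying `hilb`. -/
def hilbFun (u : Lp F 2 P.μQ) : Lp F 2 P.μQ := (P.exists_hilb u).choose

theorem coef_hilbFun (u : Lp F 2 P.μQ) (n : ℤ) :
    P.coef n (P.hilbFun u) = (-(n.sign : ℝ)) • P.coef (-n) u :=
  (P.exists_hilb u).choose_spec n

/-- The Hilbert transform `u ↦ u^⊥` in time, i.e. `(u_k^c, u_k^s) ↦ (-u_k^s, u_k^c)`. -/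
def hilb : Lp F 2 P.μQ →L[ℝ] Lp F 2 P.μQ :=
  LinearMap.mkContinuous
    { toFun := P.hilbFun
      map_add' := fun u v => P.ext_coef fun n => by
        simp only [map_add, coef_hilbFun, smul_add]
      map_smul' := fun c u => P.ext_coef fun n => by
        simp only [map_smul, coef_hilbFun, RingHom.id_apply]
        rw [smul_comm] }
    1 fun u => by
      rw [one_mul]
      refine le_of_sq_le_sq ?_ (norm_nonneg _)
      refine hasSum_le (fun n => ?_) (P.hasSum_norm_sq_coef _)
        ((Equiv.neg ℤ).hasSum_iff.2 (P.hasSum_norm_sq_coef u))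
      rw [LinearMap.coe_mk, AddHom.coe_mk, coef_hilbFun]
      exact pow_le_pow_left₀ (norm_nonneg _) (norm_sign_smul_le n _) 2

variable {P}

theorem coef_hilb (n : ℤ) (u : Lp F 2 P.μQ) :
    P.coef n (P.hilb u) = (-(n.sign : ℝ)) • P.coef (-n) u := P.coef_hilbFun u n

theorem norm_hilb_le (u : Lp F 2 P.μQ) : ‖P.hilb u‖ ≤ ‖u‖ := by
  refine (P.hilb.le_opNorm u).trans ?_
  refine mul_le_of_le_one_left (norm_nonneg _) (LinearMap.mkContinuous_norm_le _ zero_le_one _)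

/-- The transform annihilates the mean value in time, hence the condition on the zeroth coefficient.
Half derivatives satisfy it automatically (`HasHalf.coef_zero`). -/
theorem hilb_hilb {u : Lp F 2 P.μQ} (hu : P.coef 0 u = 0) : P.hilb (P.hilb u) = -u := by
  refine P.ext_coef fun n => ?_
  rw [coef_hilb, coef_hilb, neg_neg, smul_smul, map_neg, Int.sign_neg]
  rcases Int.sign_trichotomy n with h | h | h
  · simp [h]
  · rw [Int.sign_eq_zero_iff_zero.1 h]
    simp [hu]
  · simp [h]

/-- The sign is an odd function of the index, so the substitution n ↦ -n in Parseval's sum produces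
the minus sign. -/
theorem inner_hilb_left (u v : Lp F 2 P.μQ) :
    inner ℝ (P.hilb u) v = -inner ℝ u (P.hilb v) := by
  refine (P.hasSum_inner_coef _ _).unique ?_
  refine ((Equiv.neg ℤ).hasSum_iff.2 (P.hasSum_inner_coef u (P.hilb v))).neg.congr_fun fun n => ?_
  simp only [Function.comp_apply, Equiv.neg_apply]
  rw [coef_hilb, coef_hilb, neg_neg, Int.sign_neg, real_inner_smul_left, real_inner_smul_right]
  push_cast
  ring

theorem inner_hilb_self (u : Lp F 2 P.μQ) : inner ℝ u (P.hilb u) = 0 := by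
  have h := inner_hilb_left u u
  rw [real_inner_comm] at h
  linarith

theorem IsCoeff.hilb_mulQ (h : P.IsCoeff c lo hi) (u : Lp F 2 P.μQ) :
    P.hilb (h.mulQ u) = h.mulQ (P.hilb u) := by
  refine P.ext_coef fun n => ?_
  rw [coef_hilb, h.coef_mulQ, h.coef_mulQ, coef_hilb, map_smul]

/-- A skew-adjoint operator that commutes with a symmetric one has a skew-adjoint product with it.
This removes the cross terms in the inf-sup and coercivity arguments. -/
theorem IsCoeff.inner_mulQ_hilb_self (h : P.IsCoeff c lo hi) (u : Lp F 2 P.μQ) :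
    inner ℝ (h.mulQ u) (P.hilb u) = 0 := by
  have h1 := inner_hilb_left u (h.mulQ u)
  rw [h.hilb_mulQ, ← h.inner_mulQ_comm, real_inner_comm] at h1
  rw [h.inner_mulQ_comm]
  linarith

theorem hasSum_hilb (u : Lp F 2 P.μQ) :
    HasSum (fun n : ℤ => (-(n.sign : ℝ)) • P.tens n (P.coef (-n) u)) (P.hilb u) := by
  refine (P.hasSum_tens_coef (P.hilb u)).congr_fun fun n => ?_
  rw [coef_hilb, map_smul]

/-- The transform is a convergent series of coefficient operations, each of which preserves the
closed subspace, and it acts alike on u and on its gradient. -/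
theorem MemH10Zero.hilb {u : P.L2Q} {G : P.L2Qd} (h : P.MemH10Zero u G) :
    P.MemH10Zero (P.hilb u) (P.hilb G) :=
  MemH10Zero.of_hasSum (fun n => (h.tens_coef (-n) n).smul _) (hasSum_hilb u) (hasSum_hilb G)

end ParabolicProblem
end

noncomputable section

namespace ParabolicProblem

variable {d : ℕ} {P : ParabolicProblem d}

/-! ### Half time derivatives -/

theorem two_div_T_eq : 2 / P.T = √(2 / P.T) * √(2 / P.T) :=
  (Real.mul_self_sqrt (div_nonneg zero_le_two P.T_pos.le)).symm

theorem fourierCos_ae (u : P.L2Q) {k : ℕ} (hk : k ≠ 0) :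
    P.fourierCos u k =ᵐ[P.μΩ] fun x => √(2 / P.T) * P.coef k u x := by
  filter_upwards [P.coef_ae k u] with x hx
  have h : ∀ t, P.trig k t • u (x, t) = √(2 / P.T) * (u (x, t) * Real.cos (k * P.freq * t)) :=
    fun t => by rw [P.trig_natCast hk, smul_eq_mul]; ring
  simp only [hx, fourierCos, h, integral_const_mul]
  rw [← mul_assoc, ← two_div_T_eq]

theorem fourierSin_ae (u : P.L2Q) {k : ℕ} (hk : k ≠ 0) :
    P.fourierSin u k =ᵐ[P.μΩ] fun x => √(2 / P.T) * P.coef (-k) u x := by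
  filter_upwards [P.coef_ae (-k) u] with x hx
  have h : ∀ t, P.trig (-k) t • u (x, t) = √(2 / P.T) * (u (x, t) * Real.sin (k * P.freq * t)) :=
    fun t => by rw [P.trig_neg_natCast hk, smul_eq_mul]; ring
  simp only [hx, fourierSin, h, integral_const_mul]
  rw [← mul_assoc, ← two_div_T_eq]

theorem integral_mul_eq_inner (f g : P.L2Ω) : ∫ x, f x * g x ∂P.μΩ = inner ℝ f g := by
  rw [L2.inner_def]
  simp only [RCLike.inner_apply, conj_trivial, mul_comm]

theorem integrable_mul_L2Ω (f g : P.L2Ω) : Integrable (fun x => f x * g x) P.μΩ :=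
  (Lp.memLp f).integrable_mul (Lp.memLp g)

/-- The factor 2/T is the square of the normalization of the trigonometric system. It cancels the
T/2 in `halfNormSq`, so the sum over k ≥ 1 becomes a two-sided sum over ℤ. -/
theorem halfTerm_eq (u : P.L2Q) (k : ℕ) : P.halfTerm u k =
    2 / P.T * ((k * P.freq) * ‖P.coef k u‖ ^ 2 + (k * P.freq) * ‖P.coef (-k) u‖ ^ 2) := by
  rcases eq_or_ne k 0 with rfl | hk
  · simp [halfTerm]
  have h : ∫ x in P.Ω, ((P.fourierCos u k x) ^ 2 + (P.fourierSin u k x) ^ 2) =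
      2 / P.T * (‖P.coef k u‖ ^ 2 + ‖P.coef (-k) u‖ ^ 2) := by
    rw [← real_inner_self_eq_norm_sq, ← real_inner_self_eq_norm_sq, ← integral_mul_eq_inner,
      ← integral_mul_eq_inner, ← integral_add (integrable_mul_L2Ω _ _) (integrable_mul_L2Ω _ _),
      ← integral_const_mul]
    refine integral_congr_ae ?_
    filter_upwards [fourierCos_ae u hk, fourierSin_ae u hk] with x h1 h2
    rw [h1, h2]
    linear_combination (-P.coef k u x * P.coef k u x - P.coef (-k) u x * P.coef (-k) u x) *
      two_div_T_eq (P := P)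
  rw [halfTerm, h]
  ring

/-- The summands of the form `∫_Q σ ∂ₜ^{1/2} y ∂ₜ^{1/2} q^⊥`. -/
theorem halfForm_term_eq (y q : P.L2Q) (k : ℕ) :
    k * P.freq * ∫ x in P.Ω, P.σ x *
      (P.fourierCos y k x * (-P.fourierSin q k x) + P.fourierSin y k x * P.fourierCos q k x) =
    2 / P.T * ((-(k * P.freq)) * inner ℝ (P.isCoeff_σ.mulΩ (P.coef k y)) (P.coef (-k) q) +
      (k * P.freq) * inner ℝ (P.isCoeff_σ.mulΩ (P.coef (-k) y)) (P.coef k q)) := by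
  rcases eq_or_ne k 0 with rfl | hk
  · simp
  have h : ∫ x in P.Ω, P.σ x *
      (P.fourierCos y k x * (-P.fourierSin q k x) + P.fourierSin y k x * P.fourierCos q k x) =
      2 / P.T * (inner ℝ (P.isCoeff_σ.mulΩ (P.coef (-k) y)) (P.coef k q) -
        inner ℝ (P.isCoeff_σ.mulΩ (P.coef k y)) (P.coef (-k) q)) := by
    rw [← integral_mul_eq_inner, ← integral_mul_eq_inner,
      ← integral_sub (integrable_mul_L2Ω _ _) (integrable_mul_L2Ω _ _), ← integral_const_mul]
    refine integral_congr_ae ?_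
    filter_upwards [fourierCos_ae y hk, fourierSin_ae y hk, fourierCos_ae q hk, fourierSin_ae q hk,
      bddMul_ae P.isCoeff_σ.measurable.aestronglyMeasurable P.isCoeff_σ.ae_norm_le (P.coef k y),
      bddMul_ae P.isCoeff_σ.measurable.aestronglyMeasurable P.isCoeff_σ.ae_norm_le (P.coef (-k) y)]
      with x h1 h2 h3 h4 h5 h6
    rw [IsCoeff.mulΩ, h1, h2, h3, h4, h5, h6, smul_eq_mul, smul_eq_mul]
    linear_combination (P.σ x * (P.coef k y x * P.coef (-k) q x - P.coef (-k) y x * P.coef k q x)) *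
      two_div_T_eq (P := P)
  rw [h]
  ring

/-- `h = ∂ₜ^{1/2} u` up to an isometry: the Fourier coefficients are multiplied by `√(|n| ω)`. -/
def HasHalf (u h : P.L2Q) : Prop := ∀ n : ℤ, P.coef n h = √(|(n : ℝ)| * P.freq) • P.coef n u

theorem abs_mul_freq_nonneg (n : ℤ) : 0 ≤ |(n : ℝ)| * P.freq :=
  mul_nonneg (abs_nonneg _) P.freq_pos.le

theorem norm_sq_half (u : P.L2Q) (n : ℤ) :
    ‖√(|(n : ℝ)| * P.freq) • P.coef n u‖ ^ 2 = |(n : ℝ)| * P.freq * ‖P.coef n u‖ ^ 2 := by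
  rw [norm_smul, mul_pow, Real.norm_eq_abs, sq_abs, Real.sq_sqrt (abs_mul_freq_nonneg n)]

/-- By Riesz–Fischer the series condition amounts to the existence of an L² half derivative. Unlike
the series, `HasHalf` is linear and closed in the pair, which gives the space its Hilbert structure.
-/
theorem summable_halfTerm_iff {u : P.L2Q} : Summable (P.halfTerm u) ↔ ∃ h, P.HasHalf u h := by
  have hT := P.T_pos
  have hω := P.freq_pos
  have heq : P.halfTerm u = fun k : ℕ => 2 / P.T * ((k * P.freq) * ‖P.coef k u‖ ^ 2 +
      (k * P.freq) * ‖P.coef (-k) u‖ ^ 2) := funext (halfTerm_eq u)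
  constructor
  · intro h
    rw [heq] at h
    have h1 := (summable_mul_left_iff (div_pos two_pos hT).ne').1 h
    refine P.exists_coef_eq (c := fun n => √(|(n : ℝ)| * P.freq) • P.coef n u) ?_
    simp only [norm_sq_half]
    refine Summable.of_nat_of_neg ?_ ?_
    · refine Summable.of_nonneg_of_le (fun k => by positivity) (fun k => ?_) h1
      simp only [Int.cast_natCast, Nat.abs_cast]
      exact le_add_of_nonneg_right (by positivity)
    · refine Summable.of_nonneg_of_le (fun k => by positivity) (fun k => ?_) h1
      simp only [Int.cast_neg, Int.cast_natCast, abs_neg, Nat.abs_cast]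
      exact le_add_of_nonneg_left (by positivity)
  · rintro ⟨h, hh⟩
    have h1 := P.hasSum_norm_sq_coef h
    simp only [hh _, norm_sq_half] at h1
    have h2 := h1.nat_add_neg.summable
    rw [heq]
    refine (h2.congr fun k => ?_).mul_left _
    simp

theorem HasHalf.halfNormSq_eq {u h : P.L2Q} (hh : P.HasHalf u h) : P.halfNormSq u = ‖h‖ ^ 2 := by
  have h1 := P.hasSum_norm_sq_coef h
  simp only [hh _, norm_sq_half] at h1
  have h2 := h1.nat_add_neg
  have h3 : P.halfTerm u = fun k : ℕ => 2 / P.T * ((k * P.freq) * ‖P.coef k u‖ ^ 2 +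
      (k * P.freq) * ‖P.coef (-k) u‖ ^ 2) := funext (halfTerm_eq u)
  have hT := P.T_pos
  rw [halfNormSq, h3, tsum_mul_left]
  simp only [Int.cast_neg, Int.cast_natCast, abs_neg, Nat.abs_cast, Int.cast_zero, abs_zero,
    zero_mul, add_zero] at h2
  rw [h2.tsum_eq]
  field_simp

/-- The two square roots multiply to |n|ω, and the sign from the Hilbert transform turns this into
nω, so Parseval reproduces the defining series. Boundedness and bilinearity of the form become
evident. -/
theorem HasHalf.halfForm_eq {y hy q hq : P.L2Q} (h1 : P.HasHalf y hy) (h2 : P.HasHalf q hq) :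
    P.halfForm y q = inner ℝ (P.mulσ hy) (P.hilb hq) := by
  have h3 := P.hasSum_inner_coef (P.mulσ hy) (P.hilb hq)
  have h4 : ∀ n : ℤ, inner ℝ (P.coef n (P.mulσ hy)) (P.coef n (P.hilb hq)) =
      -(n * P.freq) * inner ℝ (P.isCoeff_σ.mulΩ (P.coef n y)) (P.coef (-n) q) := by
    intro n
    rw [mulσ_eq, P.isCoeff_σ.coef_mulQ, coef_hilb, h1, h2, map_smul, real_inner_smul_left,
      real_inner_smul_right, real_inner_smul_right, Int.cast_neg, abs_neg]
    have h5 := Real.mul_self_sqrt (abs_mul_freq_nonneg (P := P) n)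
    have h6 : (n.sign : ℝ) * |(n : ℝ)| = n := by
      exact_mod_cast Int.sign_mul_abs n
    linear_combination (-(n.sign : ℝ) * inner ℝ (P.isCoeff_σ.mulΩ (P.coef n y))
      (P.coef (-n) q)) * h5 - P.freq * inner ℝ (P.isCoeff_σ.mulΩ (P.coef n y))
      (P.coef (-n) q) * h6
  simp only [h4] at h3
  have h7 := h3.nat_add_neg
  have hT := P.T_pos
  rw [halfForm]
  simp only [halfForm_term_eq, tsum_mul_left]
  simp only [Int.cast_neg, Int.cast_natCast, Int.cast_zero, zero_mul, neg_zero, add_zero,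
    neg_mul, neg_neg] at h7
  simp only [neg_mul]
  rw [h7.tsum_eq]
  field_simp

theorem HasHalf.add {u v h k : P.L2Q} (h1 : P.HasHalf u h) (h2 : P.HasHalf v k) :
    P.HasHalf (u + v) (h + k) := fun n => by
  rw [map_add, map_add, h1, h2, smul_add]

theorem HasHalf.smul (c : ℝ) {u h : P.L2Q} (h1 : P.HasHalf u h) : P.HasHalf (c • u) (c • h) :=
  fun n => by rw [map_smul, map_smul, h1, smul_comm]

theorem HasHalf.sub {u v h k : P.L2Q} (h1 : P.HasHalf u h) (h2 : P.HasHalf v k) :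
    P.HasHalf (u - v) (h - k) := fun n => by
  rw [map_sub, map_sub, h1, h2, smul_sub]

theorem hasHalf_zero : P.HasHalf (0 : P.L2Q) 0 := fun n => by simp

theorem HasHalf.hilb {u h : P.L2Q} (h1 : P.HasHalf u h) : P.HasHalf (P.hilb u) (P.hilb h) :=
  fun n => by
    rw [coef_hilb, coef_hilb, h1, smul_comm, Int.cast_neg, abs_neg]

theorem HasHalf.coef_zero {u h : P.L2Q} (h1 : P.HasHalf u h) : P.coef 0 h = 0 := by
  rw [h1]; simp

/-- Because |n| ≤ n² for integers, the weights of the half derivative are dominated by those of the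
full derivative. -/
theorem HasPeriodicTimeDeriv.exists_half {u w : P.L2Q} (h : P.HasPeriodicTimeDeriv u w) :
    ∃ k, P.HasHalf u k := by
  have hω := P.freq_pos
  refine P.exists_coef_eq (c := fun n => √(|(n : ℝ)| * P.freq) • P.coef n u) ?_
  simp only [norm_sq_half]
  have h1 : Summable fun n : ℤ => P.freq⁻¹ * ‖P.coef (-n) w‖ ^ 2 :=
    ((Equiv.neg ℤ).summable_iff.2 (P.hasSum_norm_sq_coef w).summable).mul_left _
  refine Summable.of_nonneg_of_le (fun n => by positivity) (fun n => ?_) h1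
  rw [h.coef_eq, neg_neg, norm_smul, mul_pow, Real.norm_eq_abs, sq_abs]
  have h2 : |(n : ℝ)| ≤ (n : ℝ) ^ 2 := by
    rcases eq_or_ne n 0 with rfl | hn
    · simp
    · rw [← sq_abs]
      exact le_self_pow₀ (by exact_mod_cast Int.one_le_abs hn) two_ne_zero
  have h3 : P.freq⁻¹ * ((((-n : ℤ) : ℝ) * P.freq) ^ 2 * ‖P.coef n u‖ ^ 2) =
      (n : ℝ) ^ 2 * P.freq * ‖P.coef n u‖ ^ 2 := by
    push_cast; field_simp
  rw [h3]
  gcongr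

/-- Both sides have the same Parseval series up to n ↦ -n. This links the weak formulation to the
residuals, which contain the full time derivative. -/
theorem HasPeriodicTimeDeriv.halfForm_eq {y w hy q hq : P.L2Q} (h : P.HasPeriodicTimeDeriv y w)
    (h1 : P.HasHalf y hy) (h2 : P.HasHalf q hq) : P.halfForm y q = inner ℝ (P.mulσ w) q := by
  rw [h1.halfForm_eq h2]
  refine (P.hasSum_inner_coef (P.mulσ hy) (P.hilb hq)).unique ?_
  refine ((Equiv.neg ℤ).hasSum_iff.2 (P.hasSum_inner_coef (P.mulσ w) q)).congr_fun fun n => ?_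
  simp only [Function.comp_apply, Equiv.neg_apply]
  rw [mulσ_eq, mulσ_eq, P.isCoeff_σ.coef_mulQ, P.isCoeff_σ.coef_mulQ, coef_hilb, h1, h2,
    h.coef_eq, map_smul, map_smul, real_inner_smul_left, neg_neg, real_inner_smul_left,
    real_inner_smul_right, real_inner_smul_right, Int.cast_neg, abs_neg]
  have h5 := Real.mul_self_sqrt (abs_mul_freq_nonneg (P := P) n)
  have h6 : (n.sign : ℝ) * |(n : ℝ)| = n := by
    exact_mod_cast Int.sign_mul_abs n
  linear_combination (-(n.sign : ℝ) * inner ℝ (P.isCoeff_σ.mulΩ (P.coef n y))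
    (P.coef (-n) q)) * h5 - P.freq * inner ℝ (P.isCoeff_σ.mulΩ (P.coef n y))
    (P.coef (-n) q) * h6

/-- Skewness of the Hilbert transform together with its commutation with σ; it explains the opposite
sign of the time term in the adjoint equation. -/
theorem HasHalf.halfForm_comm {y hy q hq : P.L2Q} (h1 : P.HasHalf y hy) (h2 : P.HasHalf q hq) :
    P.halfForm q y = -P.halfForm y q := by
  rw [h1.halfForm_eq h2, h2.halfForm_eq h1, mulσ_eq, mulσ_eq, P.isCoeff_σ.inner_mulQ_comm,
    ← P.isCoeff_σ.hilb_mulQ, real_inner_comm, inner_hilb_left]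

end ParabolicProblem
end

noncomputable section

/-! ### Bilinear forms and the Lax–Milgram theorem -/

section
variable {E H : Type*} [NormedAddCommGroup E] [InnerProductSpace ℝ E]
  [NormedAddCommGroup H] [InnerProductSpace ℝ H]

/-- The bounded bilinear form `(x, y) ↦ ⟨A x, C y⟩`. -/
def innerBilin (A C : E →L[ℝ] H) : E →L[ℝ] E →L[ℝ] ℝ :=
  LinearMap.mkContinuous₂ (LinearMap.mk₂ ℝ (fun x y => inner ℝ (A x) (C y))
    (fun x x' y => by rw [map_add, inner_add_left])
    (fun c x y => by rw [map_smul, real_inner_smul_left, smul_eq_mul])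
    (fun x y y' => by rw [map_add, inner_add_right])
    (fun c x y => by rw [map_smul, real_inner_smul_right, smul_eq_mul])) (‖A‖ * ‖C‖) fun x y => by
      rw [LinearMap.mk₂_apply]
      calc ‖inner ℝ (A x) (C y)‖ ≤ ‖A x‖ * ‖C y‖ := norm_inner_le_norm _ _
        _ ≤ (‖A‖ * ‖x‖) * (‖C‖ * ‖y‖) := by gcongr <;> exact ContinuousLinearMap.le_opNorm _ _
        _ = ‖A‖ * ‖C‖ * ‖x‖ * ‖y‖ := by ring

theorem IsCoercive.exists_solution [CompleteSpace E] {B : E →L[ℝ] E →L[ℝ] ℝ} (hB : IsCoercive B)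
    (f : E) : ∃ y, ∀ q, B y q = inner ℝ f q := by
  refine ⟨hB.continuousLinearEquivOfBilin.symm f, fun q => ?_⟩
  rw [← hB.continuousLinearEquivOfBilin_apply, ContinuousLinearEquiv.apply_symm_apply]

theorem IsCoercive.exists_solution_pair [CompleteSpace E] [CompleteSpace H] {H' : Type*}
    [NormedAddCommGroup H'] [InnerProductSpace ℝ H'] [CompleteSpace H'] {B : E →L[ℝ] E →L[ℝ] ℝ}
    (hB : IsCoercive B) (A : E →L[ℝ] H) (C : E →L[ℝ] H') (v : H) (g : H') :
    ∃ y, ∀ q, B y q = inner ℝ v (A q) + inner ℝ g (C q) := by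
  obtain ⟨y, hy⟩ := hB.exists_solution
    (ContinuousLinearMap.adjoint A v + ContinuousLinearMap.adjoint C g)
  refine ⟨y, fun q => ?_⟩
  rw [hy, inner_add_left, ContinuousLinearMap.adjoint_inner_left,
    ContinuousLinearMap.adjoint_inner_left]

end

namespace ParabolicProblem

variable {d : ℕ} {P : ParabolicProblem d}

/-! ### Friedrichs' inequality on `H^{1,0}_0(Q)` -/

/-- At each fixed time a test function on Q is a test function on Ω, so the spatial inequality is
integrated over (0,T). -/
theorem IsFriedrichsConstant.norm_test_le {CF : ℝ} (hCF : P.IsFriedrichsConstant CF)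
    {φ : EuclideanSpace ℝ (Fin d) × ℝ → ℝ} (h : IsTestOn P.Q φ) :
    ∫ z, φ z ^ 2 ∂P.μQ ≤ CF ^ 2 * ∫ z, ‖gradX φ z‖ ^ 2 ∂P.μQ := by
  have h1 : Integrable (fun z => φ z ^ 2) P.μQ := (h.memLp (P := P)).integrable_sq
  have h2 : Integrable (fun z => ‖gradX φ z‖ ^ 2) P.μQ := (h.memLp_gradX (P := P)).norm.integrable_sq
  rw [μQ_eq] at h1 h2 ⊢
  rw [integral_prod_symm _ h1, integral_prod_symm _ h2, ← integral_const_mul]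
  refine integral_mono h1.integral_prod_right (h2.integral_prod_right.const_mul _) fun t => ?_
  have hsub : tsupport (fun x => φ (x, t)) ⊆ Prod.fst '' tsupport φ := by
    refine closure_minimal (fun x hx => ?_) (h.2.1.isCompact.image continuous_fst).isClosed
    exact ⟨(x, t), subset_tsupport _ hx, rfl⟩
  refine hCF.2 (fun x => φ (x, t)) ?_ ?_ ?_
  · have hi : ContDiff ℝ ∞ fun x : EuclideanSpace ℝ (Fin d) => (x, t) :=
      contDiff_id.prodMk contDiff_const
    exact h.1.comp hi
  · exact (h.2.1.isCompact.image continuous_fst).of_isClosed_subset (isClosed_tsupport _) hsub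
  · refine hsub.trans ?_
    rintro _ ⟨z, hz, rfl⟩
    exact (h.2.2 hz).1

theorem MemH10Zero.norm_le {CF : ℝ} (hCF : P.IsFriedrichsConstant CF) {u : P.L2Q} {G : P.L2Qd}
    (h : P.MemH10Zero u G) : ‖u‖ ≤ CF * ‖G‖ := by
  have hc : IsClosed {w : P.L2Q × P.L2Qd | ‖w.1‖ ≤ CF * ‖w.2‖} :=
    isClosed_le (by fun_prop) (by fun_prop)
  suffices hsub : P.testPairs ⊆ {w : P.L2Q × P.L2Qd | ‖w.1‖ ≤ CF * ‖w.2‖} by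
    have h' := closure_minimal hsub hc h
    exact h'
  rintro ⟨v, H⟩ ⟨φ, hφ, h1, h2⟩
  change ‖v‖ ≤ CF * ‖H‖
  refine le_of_sq_le_sq ?_ (mul_nonneg hCF.1.le (norm_nonneg _))
  rw [mul_pow, ← real_inner_self_eq_norm_sq, ← real_inner_self_eq_norm_sq, L2.inner_def,
    L2.inner_def]
  have e1 : ∫ z, inner ℝ (v z) (v z) ∂P.μQ = ∫ z, φ z ^ 2 ∂P.μQ := by
    refine integral_congr_ae ?_
    filter_upwards [h1] with z hz
    rw [hz, real_inner_self_eq_norm_sq, Real.norm_eq_abs, sq_abs]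
  have e2 : ∫ z, inner ℝ (H z) (H z) ∂P.μQ = ∫ z, ‖gradX φ z‖ ^ 2 ∂P.μQ := by
    refine integral_congr_ae ?_
    filter_upwards [h2] with z hz
    rw [hz, real_inner_self_eq_norm_sq]
  rw [e1, e2]
  exact hCF.norm_test_le hφ

/-! ### The vector space `H^{1,1/2}_{0,per}(Q)` -/

theorem HHalf.ext_val {y z : P.HHalf} (h : y.val = z.val) : y = z := by
  obtain ⟨u, G, h1, h2⟩ := y
  obtain ⟨u', G', h1', h2'⟩ := z
  subst h
  obtain rfl := h1.grad_unique h1'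
  rfl

/-- The half time derivative of an element of `H^{1,1/2}_{0,per}(Q)`. -/
def HHalf.half (y : P.HHalf) : P.L2Q := (summable_halfTerm_iff.1 y.half_finite).choose

theorem HHalf.hasHalf (y : P.HHalf) : P.HasHalf y.val y.half :=
  (summable_halfTerm_iff.1 y.half_finite).choose_spec

/-- Elements of `H^{1,1/2}_{0,per}(Q)` from their half derivatives. -/
def HHalf.ofHalf {u : P.L2Q} {G : P.L2Qd} {h : P.L2Q} (h1 : P.MemH10Zero u G)
    (h2 : P.HasHalf u h) : P.HHalf := ⟨u, G, h1, summable_halfTerm_iff.2 ⟨h, h2⟩⟩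

instance : Add P.HHalf := ⟨fun y z => .ofHalf (y.mem_zero.add z.mem_zero) (y.hasHalf.add z.hasHalf)⟩

instance : Sub P.HHalf := ⟨fun y z => .ofHalf (y.mem_zero.sub z.mem_zero) (y.hasHalf.sub z.hasHalf)⟩

instance : SMul ℝ P.HHalf := ⟨fun c y => .ofHalf (y.mem_zero.smul c) (y.hasHalf.smul c)⟩

@[simp] theorem HHalf.add_val (y z : P.HHalf) : (y + z).val = y.val + z.val := rfl
@[simp] theorem HHalf.add_grad (y z : P.HHalf) : (y + z).grad = y.grad + z.grad := rfl
@[simp] theorem HHalf.sub_val (y z : P.HHalf) : (y - z).val = y.val - z.val := rfl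
@[simp] theorem HHalf.sub_grad (y z : P.HHalf) : (y - z).grad = y.grad - z.grad := rfl
@[simp] theorem HHalf.smul_val (c : ℝ) (y : P.HHalf) : (c • y).val = c • y.val := rfl
@[simp] theorem HHalf.smul_grad (c : ℝ) (y : P.HHalf) : (c • y).grad = c • y.grad := rfl

theorem stateForm_eq (y q : P.HHalf) : P.stateForm y q =
    inner ℝ (P.mulν y.grad) q.grad + P.halfForm y.val q.val := rfl

theorem stateForm_add_left (y z q : P.HHalf) :
    P.stateForm (y + z) q = P.stateForm y q + P.stateForm z q := by
  simp only [stateForm_eq, HHalf.add_val, HHalf.add_grad, y.hasHalf.halfForm_eq q.hasHalf,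
    z.hasHalf.halfForm_eq q.hasHalf, (y.hasHalf.add z.hasHalf).halfForm_eq q.hasHalf, mulν_eq,
    mulσ_eq, map_add, inner_add_left]
  ring

theorem stateForm_sub_left (y z q : P.HHalf) :
    P.stateForm (y - z) q = P.stateForm y q - P.stateForm z q := by
  simp only [stateForm_eq, HHalf.sub_val, HHalf.sub_grad, y.hasHalf.halfForm_eq q.hasHalf,
    z.hasHalf.halfForm_eq q.hasHalf, (y.hasHalf.sub z.hasHalf).halfForm_eq q.hasHalf, mulν_eq,
    mulσ_eq, map_sub, inner_sub_left]
  ring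

theorem stateForm_smul_left (c : ℝ) (y q : P.HHalf) :
    P.stateForm (c • y) q = c * P.stateForm y q := by
  simp only [stateForm_eq, HHalf.smul_val, HHalf.smul_grad, y.hasHalf.halfForm_eq q.hasHalf,
    (y.hasHalf.smul c).halfForm_eq q.hasHalf, mulν_eq,
    mulσ_eq, map_smul, real_inner_smul_left]
  ring

/-- The form of the adjoint equation is the transposed form of the state equation. -/
theorem stateForm_swap (z p : P.HHalf) :
    P.stateForm z p = inner ℝ (P.mulν p.grad) z.grad - P.halfForm p.val z.val := by
  rw [stateForm_eq, z.hasHalf.halfForm_comm p.hasHalf, mulν_eq, mulν_eq,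
    P.isCoeff_ν.inner_mulQ_comm, real_inner_comm]
  ring

theorem μ₁_pos : 0 < P.μ₁ :=
  mul_pos (one_div_pos.2 (Real.sqrt_pos.2 two_pos)) (lt_min P.νlo_pos P.σlo_pos)

/-- The inf-sup condition of the state equation. -/
theorem HHalf.inf_sup {w : P.HHalf} {R : ℝ}
    (h : ∀ q : P.HHalf, P.stateForm w q ≤ R * ‖q.grad‖) :
    P.μ₁ ^ 2 * (‖w.grad‖ ^ 2 + P.halfNormSq w.val) ≤ R ^ 2 := by
  -- Test function w - w^⊥: the first summand makes the elliptic part positive, the second the time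
  -- part, since the square of the Hilbert transform is -1 on half derivatives.
  have h1 := h (.ofHalf (w.mem_zero.sub w.mem_zero.hilb) (w.hasHalf.sub w.hasHalf.hilb))
  have h2 : P.stateForm w (.ofHalf (w.mem_zero.sub w.mem_zero.hilb)
      (w.hasHalf.sub w.hasHalf.hilb)) =
      inner ℝ (P.isCoeff_ν.mulQ w.grad) w.grad + inner ℝ (P.isCoeff_σ.mulQ w.half) w.half := by
    rw [stateForm_eq]
    simp only [HHalf.ofHalf]
    rw [w.hasHalf.halfForm_eq (w.hasHalf.sub w.hasHalf.hilb), mulν_eq, mulσ_eq, map_sub,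
      hilb_hilb w.hasHalf.coef_zero, inner_sub_right, inner_sub_right, inner_neg_right,
      P.isCoeff_ν.inner_mulQ_hilb_self, P.isCoeff_σ.inner_mulQ_hilb_self]
    ring
  -- A vector and its transform are orthogonal. The resulting 2 is the origin of the factor 1/√2 in
  -- μ₁.
  have h3 : ‖w.grad - P.hilb w.grad‖ ^ 2 ≤ 2 * ‖w.grad‖ ^ 2 := by
    rw [norm_sub_sq_real, inner_hilb_self]
    have := pow_le_pow_left₀ (norm_nonneg _) (norm_hilb_le w.grad) 2
    linarith
  rw [h2] at h1
  change _ ≤ R * ‖w.grad - P.hilb w.grad‖ at h1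
  rw [w.hasHalf.halfNormSq_eq, μ₁, mul_pow, div_pow, Real.sq_sqrt zero_le_two, one_pow]
  have hm : 0 < min P.νlo P.σlo := lt_min P.νlo_pos P.σlo_pos
  have h4 := P.isCoeff_ν.le_inner_mulQ_self w.grad
  have h5 := P.isCoeff_σ.le_inner_mulQ_self w.half
  have h6 : min P.νlo P.σlo * ‖w.grad‖ ^ 2 ≤ P.νlo * ‖w.grad‖ ^ 2 := by
    gcongr; exact min_le_left _ _
  have h7 : min P.νlo P.σlo * ‖w.half‖ ^ 2 ≤ P.σlo * ‖w.half‖ ^ 2 := by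
    gcongr; exact min_le_right _ _
  generalize min P.νlo P.σlo = m at *
  set N := ‖w.grad‖ ^ 2 + ‖w.half‖ ^ 2 with hN
  have hN0 : 0 ≤ N := by positivity
  have h8 : m * N ≤ R * ‖w.grad - P.hilb w.grad‖ := by rw [hN, mul_add]; linarith
  have h9 : (m * N) ^ 2 ≤ R ^ 2 * (2 * N) := by
    refine (pow_le_pow_left₀ (by positivity) h8 2).trans ?_
    rw [mul_pow]
    refine mul_le_mul_of_nonneg_left (h3.trans ?_) (sq_nonneg R)
    rw [hN]
    linarith [sq_nonneg ‖w.half‖]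
  rcases hN0.eq_or_lt with h0 | h0
  · rw [← h0, mul_zero]; positivity
  · have : m ^ 2 * N ≤ 2 * R ^ 2 := le_of_mul_le_mul_right (by linarith) h0
    linarith

/-! ### Solvability of the state equation and of the adjoint equation -/

variable (P) in
/-- The Hilbert space underlying `H^{1,1/2}_{0,per}(Q)`: triples of a function, its gradient and its
half time derivative. -/
def halfSpace : Submodule ℝ (WithLp 2 (P.L2Q × WithLp 2 (P.L2Qd × P.L2Q))) where
  carrier := {w | P.MemH10Zero w.fst w.snd.fst ∧ P.HasHalf w.fst w.snd.snd}
  zero_mem' := ⟨memH10Zero_zero, hasHalf_zero⟩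
  add_mem' := fun ha hb => ⟨ha.1.add hb.1, ha.2.add hb.2⟩
  smul_mem' := fun c _ ha => ⟨ha.1.smul c, ha.2.smul c⟩

theorem isClosed_halfSpace :
    IsClosed (P.halfSpace : Set (WithLp 2 (P.L2Q × WithLp 2 (P.L2Qd × P.L2Q)))) := by
  have h1 : Continuous fun w : WithLp 2 (P.L2Q × WithLp 2 (P.L2Qd × P.L2Q)) => w.fst :=
    WithLp.continuous_fst _ _ _
  have h2 : Continuous fun w : WithLp 2 (P.L2Q × WithLp 2 (P.L2Qd × P.L2Q)) => w.snd.fst :=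
    (WithLp.continuous_fst _ _ _).comp (WithLp.continuous_snd _ _ _)
  have h3 : Continuous fun w : WithLp 2 (P.L2Q × WithLp 2 (P.L2Qd × P.L2Q)) => w.snd.snd :=
    (WithLp.continuous_snd _ _ _).comp (WithLp.continuous_snd _ _ _)
  have h4 : IsClosed {w : WithLp 2 (P.L2Q × WithLp 2 (P.L2Qd × P.L2Q)) |
      ∀ n : ℤ, P.coef n w.snd.snd = √(|(n : ℝ)| * P.freq) • P.coef n w.fst} := by
    rw [Set.ofPred_forall]
    exact isClosed_iInter fun n => isClosed_eq ((P.coef n).continuous.comp h3)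
      ((continuous_const_smul _).comp ((P.coef n).continuous.comp h1))
  exact (isClosed_closure.preimage (h1.prodMk h2)).inter h4

instance : CompleteSpace P.halfSpace := isClosed_halfSpace.completeSpace_coe

variable (P) in
/-- The values of an element of `halfSpace`. -/
def valL : P.halfSpace →L[ℝ] P.L2Q := (WithLp.fstL 2 ℝ _ _).comp P.halfSpace.subtypeL

variable (P) in
/-- The gradient of an element of `halfSpace`. -/
def gradL : P.halfSpace →L[ℝ] P.L2Qd :=
  (WithLp.fstL 2 ℝ _ _).comp ((WithLp.sndL 2 ℝ _ _).comp P.halfSpace.subtypeL)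

variable (P) in
/-- The half time derivative of an element of `halfSpace`. -/
def halfL : P.halfSpace →L[ℝ] P.L2Q :=
  (WithLp.sndL 2 ℝ _ _).comp ((WithLp.sndL 2 ℝ _ _).comp P.halfSpace.subtypeL)

theorem memH10Zero_halfSpace (w : P.halfSpace) : P.MemH10Zero (P.valL w) (P.gradL w) := w.2.1

theorem hasHalf_halfSpace (w : P.halfSpace) : P.HasHalf (P.valL w) (P.halfL w) := w.2.2

theorem norm_sq_halfSpace (w : P.halfSpace) :
    ‖w‖ ^ 2 = ‖P.valL w‖ ^ 2 + (‖P.gradL w‖ ^ 2 + ‖P.halfL w‖ ^ 2) := by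
  change ‖(w : WithLp 2 (P.L2Q × WithLp 2 (P.L2Qd × P.L2Q)))‖ ^ 2 = _
  rw [WithLp.prod_norm_sq_eq_of_L2, WithLp.prod_norm_sq_eq_of_L2]
  rfl

theorem HHalf.exists_halfSpace (q : P.HHalf) : ∃ w : P.halfSpace,
    P.valL w = q.val ∧ P.gradL w = q.grad ∧ P.halfL w = q.half :=
  ⟨⟨WithLp.toLp 2 (q.val, WithLp.toLp 2 (q.grad, q.half)), q.mem_zero, q.hasHalf⟩, rfl, rfl, rfl⟩

variable (P) in
/-- The form `⟨ν ∇y, ∇q⟩ + s ⟨σ ∂ₜ^{1/2} y, ∂ₜ^{1/2} q^⊥⟩` at `y = w + s w^⊥`. -/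
def twistedForm (s : ℝ) : P.halfSpace →L[ℝ] P.halfSpace →L[ℝ] ℝ :=
  innerBilin (E := P.halfSpace) (H := P.L2Qd) (P.isCoeff_ν.mulQ.comp (P.gradL + s • P.hilb.comp P.gradL)) P.gradL +
    s • innerBilin (E := P.halfSpace) (H := P.L2Q) (P.isCoeff_σ.mulQ.comp (P.halfL + s • P.hilb.comp P.halfL))
      (P.hilb.comp P.halfL)

theorem twistedForm_apply (s : ℝ) (w q : P.halfSpace) : P.twistedForm s w q =
    inner ℝ (P.isCoeff_ν.mulQ (P.gradL w + s • P.hilb (P.gradL w))) (P.gradL q) +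
    s * inner ℝ (P.isCoeff_σ.mulQ (P.halfL w + s • P.hilb (P.halfL w))) (P.hilb (P.halfL q)) := rfl

theorem norm_hilb_eq {u : P.L2Q} (hu : P.coef 0 u = 0) : ‖P.hilb u‖ = ‖u‖ := by
  refine le_antisymm (norm_hilb_le u) ?_
  have := norm_hilb_le (P.hilb u)
  rwa [hilb_hilb hu, norm_neg] at this

/-- On the diagonal the cross terms vanish by skewness, and s² = 1 leaves ⟨ν∇w,∇w⟩ + ⟨σh^⊥,h^⊥⟩ with
‖h^⊥‖ = ‖h‖. Friedrichs' inequality then controls ‖w‖ and accounts for the factor 1 + C_F². -/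
theorem isCoercive_twistedForm {CF : ℝ} (hCF : P.IsFriedrichsConstant CF) {s : ℝ}
    (hs : s * s = 1) : IsCoercive (P.twistedForm s) := by
  have hm : 0 < min P.νlo P.σlo := lt_min P.νlo_pos P.σlo_pos
  have hc : 0 < 1 + CF ^ 2 := by positivity
  refine ⟨min P.νlo P.σlo / (1 + CF ^ 2), by positivity, fun w => ?_⟩
  have h1 : P.twistedForm s w w = inner ℝ (P.isCoeff_ν.mulQ (P.gradL w)) (P.gradL w) +
      inner ℝ (P.isCoeff_σ.mulQ (P.hilb (P.halfL w))) (P.hilb (P.halfL w)) := by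
    rw [twistedForm_apply, map_add, map_add, map_smul, map_smul, inner_add_left, inner_add_left,
      real_inner_smul_left, real_inner_smul_left, P.isCoeff_σ.inner_mulQ_hilb_self,
      P.isCoeff_ν.inner_mulQ_comm (P.hilb _), real_inner_comm (P.isCoeff_ν.mulQ (P.gradL w)),
      P.isCoeff_ν.inner_mulQ_hilb_self]
    linear_combination inner ℝ (P.isCoeff_σ.mulQ (P.hilb (P.halfL w))) (P.hilb (P.halfL w)) * hs
  have h4 := P.isCoeff_ν.le_inner_mulQ_self (P.gradL w)
  have h5 := P.isCoeff_σ.le_inner_mulQ_self (P.hilb (P.halfL w))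
  rw [norm_hilb_eq (hasHalf_halfSpace w).coef_zero] at h5
  have h6 : min P.νlo P.σlo * ‖P.gradL w‖ ^ 2 ≤ P.νlo * ‖P.gradL w‖ ^ 2 := by
    gcongr; exact min_le_left _ _
  have h7 : min P.νlo P.σlo * ‖P.halfL w‖ ^ 2 ≤ P.σlo * ‖P.halfL w‖ ^ 2 := by
    gcongr; exact min_le_right _ _
  have h8 := pow_le_pow_left₀ (norm_nonneg _) ((memH10Zero_halfSpace w).norm_le hCF) 2
  rw [h1, mul_assoc, ← sq, norm_sq_halfSpace]
  have h9 : ‖P.valL w‖ ^ 2 + (‖P.gradL w‖ ^ 2 + ‖P.halfL w‖ ^ 2) ≤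
      (1 + CF ^ 2) * (‖P.gradL w‖ ^ 2 + ‖P.halfL w‖ ^ 2) := by
    have : 0 ≤ CF ^ 2 * ‖P.halfL w‖ ^ 2 := by positivity
    rw [mul_pow] at h8
    linarith
  calc min P.νlo P.σlo / (1 + CF ^ 2) * (‖P.valL w‖ ^ 2 + (‖P.gradL w‖ ^ 2 + ‖P.halfL w‖ ^ 2))
      ≤ min P.νlo P.σlo / (1 + CF ^ 2) *
        ((1 + CF ^ 2) * (‖P.gradL w‖ ^ 2 + ‖P.halfL w‖ ^ 2)) := by gcongr
    _ = min P.νlo P.σlo * ‖P.gradL w‖ ^ 2 + min P.νlo P.σlo * ‖P.halfL w‖ ^ 2 := by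
      field_simp
    _ ≤ _ := by linarith

/-- Solvability of the state equation (`s = 1`) and of the adjoint equation (`s = -1`). -/
theorem exists_solution {CF : ℝ} (hCF : P.IsFriedrichsConstant CF) {s : ℝ}
    (hs : s * s = 1) (v : P.L2Q) (g : P.L2Qd) : ∃ y : P.HHalf, ∀ q : P.HHalf,
      inner ℝ (P.mulν y.grad) q.grad + s * P.halfForm y.val q.val =
        inner ℝ v q.val + inner ℝ g q.grad := by
  obtain ⟨w, hw⟩ := (isCoercive_twistedForm hCF hs).exists_solution_pair P.valL P.gradL v g
  have hy0 := (memH10Zero_halfSpace w).add ((memH10Zero_halfSpace w).hilb.smul s)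
  have hyh := (hasHalf_halfSpace w).add ((hasHalf_halfSpace w).hilb.smul s)
  -- The solution is w + s w^⊥, not the function w delivered by Lax–Milgram: the twist sits on the
  -- trial side, so the equation holds for all untwisted q.
  refine ⟨.ofHalf hy0 hyh, fun q => ?_⟩
  obtain ⟨z, h1, h2, h3⟩ := q.exists_halfSpace
  have h4 : P.twistedForm s w z = inner ℝ v (P.valL z) + inner ℝ g (P.gradL z) := hw z
  rw [twistedForm_apply, h1, h2, h3] at h4
  rw [← h4]
  simp only [HHalf.ofHalf]
  rw [hyh.halfForm_eq q.hasHalf]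
  rfl

end ParabolicProblem
end

noncomputable section

namespace ParabolicProblem

variable {d : ℕ} {P : ParabolicProblem d}

/-! ### Truncation of Fourier series in time -/

section
variable {F : Type*} [NormedAddCommGroup F] [InnerProductSpace ℝ F] [CompleteSpace F]
  (s : Finset ℤ)

/-- Partial sum of the Fourier series in time. -/
def trunc (u : Lp F 2 P.μQ) : Lp F 2 P.μQ := ∑ n ∈ s, P.tens n (P.coef n u)

/-- Partial sum of the Fourier series of the time derivative. -/
def truncDt (u : Lp F 2 P.μQ) : Lp F 2 P.μQ :=
  ∑ n ∈ s, (n * P.freq) • P.tens n (P.coef (-n) u)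

theorem coef_sum_tens (c : ℤ → Lp F 2 P.μΩ) (m : ℤ) :
    P.coef m (∑ n ∈ s, P.tens n (c n)) = if m ∈ s then c m else 0 := by
  rw [map_sum]
  simp only [coef_tens, Finset.sum_ite_eq]

theorem coef_trunc (u : Lp F 2 P.μQ) (m : ℤ) :
    P.coef m (trunc s u) = if m ∈ s then P.coef m u else 0 := coef_sum_tens s _ m

theorem coef_truncDt (u : Lp F 2 P.μQ) (m : ℤ) :
    P.coef m (truncDt s u) = if m ∈ s then (m * P.freq) • P.coef (-m) u else 0 := by
  rw [truncDt]
  simp only [← map_smul]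
  exact coef_sum_tens s _ m

theorem inner_trunc_comm (u v : Lp F 2 P.μQ) :
    inner ℝ (trunc s u) v = inner ℝ u (trunc s v) := by
  rw [trunc, trunc, sum_inner, inner_sum]
  refine Finset.sum_congr rfl fun n _ => ?_
  rw [← inner_coef_right, inner_coef_left]

variable {s}

/-- Integration by parts in time for trigonometric polynomials; the index set must be symmetric
because differentiation exchanges n and -n. -/
theorem inner_truncDt_left (hs : ∀ n, -n ∈ s ↔ n ∈ s) (u v : Lp F 2 P.μQ) :
    inner ℝ (truncDt s u) v = -inner ℝ u (truncDt s v) := by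
  rw [truncDt, truncDt, sum_inner, inner_sum, ← Finset.sum_neg_distrib]
  refine Finset.sum_equiv (Equiv.neg ℤ) (fun n => (hs n).symm) fun n _ => ?_
  rw [real_inner_smul_left, real_inner_smul_right, ← inner_coef_right, ← inner_coef_left,
    Equiv.neg_apply, neg_neg]
  push_cast
  ring

theorem IsCoeff.trunc_mulQ {c : EuclideanSpace ℝ (Fin d) → ℝ} {lo hi : ℝ}
    (h : P.IsCoeff c lo hi) (u : Lp F 2 P.μQ) : trunc s (h.mulQ u) = h.mulQ (trunc s u) := by
  refine P.ext_coef fun n => ?_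
  rw [h.coef_mulQ, coef_trunc, coef_trunc, h.coef_mulQ]
  split_ifs
  · rfl
  · rw [map_zero]

theorem IsCoeff.truncDt_mulQ {c : EuclideanSpace ℝ (Fin d) → ℝ} {lo hi : ℝ}
    (h : P.IsCoeff c lo hi) (u : Lp F 2 P.μQ) : truncDt s (h.mulQ u) = h.mulQ (truncDt s u) := by
  refine P.ext_coef fun n => ?_
  rw [h.coef_mulQ, coef_truncDt, coef_truncDt, h.coef_mulQ]
  split_ifs
  · rw [map_smul]
  · rw [map_zero]

theorem trunc_hilb (hs : ∀ n, -n ∈ s ↔ n ∈ s) (u : Lp F 2 P.μQ) :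
    P.hilb (trunc s u) = trunc s (P.hilb u) := by
  refine P.ext_coef fun n => ?_
  rw [coef_hilb, coef_trunc, coef_trunc, coef_hilb]
  simp only [hs]
  split_ifs
  · rfl
  · rw [smul_zero]

theorem inner_mulQ_truncDt_self {c : EuclideanSpace ℝ (Fin d) → ℝ} {lo hi : ℝ}
    (h : P.IsCoeff c lo hi) (hs : ∀ n, -n ∈ s ↔ n ∈ s) (u : Lp F 2 P.μQ) :
    inner ℝ (h.mulQ u) (truncDt s u) = 0 := by
  have h1 := inner_truncDt_left hs (h.mulQ u) u
  rw [h.truncDt_mulQ, h.inner_mulQ_comm, real_inner_comm] at h1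
  linarith

/-- The symmetric intervals `[-N, N]`. -/
theorem neg_mem_Icc_iff (N : ℕ) (n : ℤ) :
    -n ∈ Finset.Icc (-(N : ℤ)) N ↔ n ∈ Finset.Icc (-(N : ℤ)) N := by
  simp only [Finset.mem_Icc]
  omega

theorem tendsto_Icc_atTop :
    Tendsto (fun N : ℕ => Finset.Icc (-(N : ℤ)) N) atTop atTop := by
  refine tendsto_atTop_finset_of_monotone (fun a b hab => ?_) fun n => ⟨n.natAbs, ?_⟩
  · refine Finset.Icc_subset_Icc ?_ ?_ <;> omega
  · rw [Finset.mem_Icc]; omega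

theorem tendsto_trunc (u : Lp F 2 P.μQ) :
    Tendsto (fun N : ℕ => trunc (Finset.Icc (-(N : ℤ)) N) u) atTop (𝓝 u) :=
  (P.hasSum_tens_coef u).comp tendsto_Icc_atTop

end

/-! ### Truncated series as elements of the Sobolev-type spaces -/

theorem MemH10Zero.trunc {u : P.L2Q} {G : P.L2Qd} (h : P.MemH10Zero u G) (s : Finset ℤ) :
    P.MemH10Zero (trunc s u) (trunc s G) := MemH10Zero.sum s fun n _ => h.tens_coef n n

theorem MemH10Zero.truncDt {u : P.L2Q} {G : P.L2Qd} (h : P.MemH10Zero u G) (s : Finset ℤ) :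
    P.MemH10Zero (truncDt s u) (truncDt s G) :=
  MemH10Zero.sum s fun n _ => (h.tens_coef (-n) n).smul _

theorem hasPeriodicTimeDeriv_trunc {s : Finset ℤ} (hs : ∀ n, -n ∈ s ↔ n ∈ s) (u : P.L2Q) :
    P.HasPeriodicTimeDeriv (trunc s u) (truncDt s u) := by
  refine .of_coef fun n => ?_
  rw [coef_trunc, coef_truncDt]
  simp only [hs]
  split_ifs
  · rfl
  · rw [smul_zero]

theorem hasPeriodicTimeDeriv_truncDt {s : Finset ℤ} (hs : ∀ n, -n ∈ s ↔ n ∈ s) (u : P.L2Q) :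
    P.HasPeriodicTimeDeriv (truncDt s u) (truncDt s (truncDt s u)) := by
  refine .of_coef fun n => ?_
  rw [coef_truncDt s (truncDt s u), coef_truncDt]
  simp only [hs]
  split_ifs
  · rfl
  · rw [smul_zero]

theorem HasHalf.trunc {u h : P.L2Q} (h1 : P.HasHalf u h) (s : Finset ℤ) :
    P.HasHalf (trunc s u) (trunc s h) := fun n => by
  rw [coef_trunc, coef_trunc, h1]
  split_ifs
  · rfl
  · rw [smul_zero]

/-- The truncation of an element of `H^{1,0}_0(Q)` lies in `H^{1,1}_{0,per}(Q)`. -/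
def HOne.ofTrunc {s : Finset ℤ} (hs : ∀ n, -n ∈ s ↔ n ∈ s) {u : P.L2Q} {G : P.L2Qd}
    (h : P.MemH10Zero u G) : P.HOne :=
  ⟨trunc s u, trunc s G, truncDt s u, h.trunc s, hasPeriodicTimeDeriv_trunc hs u⟩

/-- The inclusion of `H^{1,1}_{0,per}(Q)` in `H^{1,1/2}_{0,per}(Q)`. -/
def HOne.toHalf (η : P.HOne) : P.HHalf :=
  ⟨η.val, η.grad, η.mem_zero, summable_halfTerm_iff.2 η.periodic.exists_half⟩

theorem stateForm_toHalf (η : P.HOne) (q : P.HHalf) : P.stateForm η.toHalf q =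
    inner ℝ (P.mulν η.grad) q.grad + inner ℝ (P.mulσ η.dt) q.val := by
  rw [stateForm_eq, ← η.periodic.halfForm_eq η.toHalf.hasHalf q.hasHalf]
  rfl

/-- Symmetric truncation is self-adjoint and commutes with both σ and the Hilbert transform, so it
can be moved across the form. -/
theorem halfForm_trunc {s : Finset ℤ} (hs : ∀ n, -n ∈ s ↔ n ∈ s) {p hp z hz : P.L2Q}
    (h1 : P.HasHalf p hp) (h2 : P.HasHalf z hz) :
    P.halfForm p (trunc s z) = P.halfForm (trunc s p) z := by
  rw [h1.halfForm_eq (h2.trunc s), (h1.trunc s).halfForm_eq h2, trunc_hilb hs,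
    ← inner_trunc_comm, mulσ_eq, mulσ_eq, P.isCoeff_σ.trunc_mulQ]

/-! ### Weak divergences from test functions in `H^{1,1/2}_{0,per}(Q)` -/

theorem HDiv.inner_add_eq_zero (τ : P.HDiv) (q : P.HHalf) :
    inner ℝ τ.div q.val + inner ℝ τ.val q.grad = 0 := q.mem_zero.inner_add_eq_zero τ.hasDiv

/-- The truncations of a test function have a half derivative, being trigonometric polynomials in
time, and they converge to it together with their gradients. Variational equations thus yield weak
divergences by passing to the limit. -/
theorem hasWeakDiv_of_half {τ : P.L2Qd} {a : P.L2Q}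
    (h : ∀ q : P.HHalf, inner ℝ a q.val + inner ℝ τ q.grad = 0) : P.HasWeakDiv τ a := by
  rw [hasWeakDiv_iff_inner]
  intro φ hφ
  have hmem := memH10Zero_of_test hφ
  generalize (hφ.memLp (P := P)).toLp φ = u at *
  generalize (hφ.memLp_gradX (P := P)).toLp (gradX φ) = G at *
  have h1 : ∀ N : ℕ, inner ℝ a (trunc (Finset.Icc (-(N : ℤ)) N) u) +
      inner ℝ τ (trunc (Finset.Icc (-(N : ℤ)) N) G) = 0 := fun N =>
    h (HOne.ofTrunc (neg_mem_Icc_iff N) hmem).toHalf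
  have h2 := ((tendsto_const_nhds (x := a)).inner (𝕜 := ℝ) (tendsto_trunc u)).add
    ((tendsto_const_nhds (x := τ)).inner (𝕜 := ℝ) (tendsto_trunc G))
  simp only [h1] at h2
  exact (tendsto_nhds_unique h2 tendsto_const_nhds)

/-! ### Regularity of the state -/

/-- The state equation is tested with the truncated time derivative D of y. The elliptic term
vanishes, since truncated differentiation is skew and commutes with ν, and the time term is ⟨σD, D⟩.
The resulting bound does not depend on the truncation. -/
theorem IsState.norm_truncDt_le {v : P.L2Q} {y : P.HHalf} (h : P.IsState v y) {s : Finset ℤ}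
    (hs : ∀ n, -n ∈ s ↔ n ∈ s) : P.σlo * ‖truncDt s y.val‖ ≤ ‖v‖ := by
  obtain ⟨k, hk⟩ := (hasPeriodicTimeDeriv_truncDt hs y.val).exists_half
  have h1 := h (.ofHalf (y.mem_zero.truncDt s) hk)
  rw [stateForm_eq] at h1
  simp only [HHalf.ofHalf] at h1
  rw [mulν_eq, inner_mulQ_truncDt_self P.isCoeff_ν hs, zero_add,
    hk.halfForm_comm y.hasHalf, (hasPeriodicTimeDeriv_truncDt hs y.val).halfForm_eq hk y.hasHalf,
    mulσ_eq, ← P.isCoeff_σ.truncDt_mulQ, inner_truncDt_left hs, neg_neg] at h1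
  have h2 := P.isCoeff_σ.le_inner_mulQ_self (truncDt s y.val)
  have h3 := real_inner_le_norm v (truncDt s y.val)
  rcases (norm_nonneg (truncDt s y.val)).eq_or_lt with h0 | h0
  · rw [← h0, mul_zero]; exact norm_nonneg _
  · refine le_of_mul_le_mul_right ?_ h0
    rw [mul_assoc, ← sq]
    linarith

/-- The uniform bound on truncated derivatives makes the formal coefficients of ∂ₜy square summable,
and Riesz–Fischer supplies the derivative. -/
theorem IsState.exists_timeDeriv {v : P.L2Q} {y : P.HHalf} (h : P.IsState v y) :
    ∃ w, P.HasPeriodicTimeDeriv y.val w := by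
  have hsum : Summable fun n : ℤ => ‖(n * P.freq) • P.coef (-n) y.val‖ ^ 2 := by
    refine summable_of_sum_le (c := (‖v‖ / P.σlo) ^ 2) (fun n => sq_nonneg _) fun s => ?_
    obtain ⟨N, hN⟩ := (tendsto_Icc_atTop.eventually_ge_atTop s).exists
    have h1 := h.norm_truncDt_le (neg_mem_Icc_iff N)
    have h2 : ‖truncDt (Finset.Icc (-(N : ℤ)) N) y.val‖ ≤ ‖v‖ / P.σlo := by
      rw [le_div_iff₀ P.σlo_pos, mul_comm]; exact h1
    refine le_trans ?_ (pow_le_pow_left₀ (norm_nonneg _) h2 2)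
    refine le_trans (Finset.sum_le_sum fun n hn => ?_)
      (sum_le_hasSum s (fun n _ => sq_nonneg _) (P.hasSum_norm_sq_coef _))
    rw [coef_truncDt, if_pos (hN hn)]
  obtain ⟨w, hw⟩ := P.exists_coef_eq hsum
  exact ⟨w, .of_coef hw⟩

end ParabolicProblem
end

noncomputable section

namespace ParabolicProblem

variable {d : ℕ} {P : ParabolicProblem d}

/-! ### The state equation: stability, unique solvability, residual estimates -/

theorem HHalf.halfNormSq_nonneg (y : P.HHalf) : 0 ≤ P.halfNormSq y.val := by
  rw [y.hasHalf.halfNormSq_eq]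
  positivity

theorem mul_norm_le_of_sq {m a b R : ℝ} (hb : 0 ≤ b) (hR : 0 ≤ R)
    (h : m ^ 2 * (a ^ 2 + b) ≤ R ^ 2) : m * a ≤ R := by
  refine le_of_sq_le_sq ?_ hR
  rw [mul_pow]
  nlinarith [mul_nonneg (sq_nonneg m) hb]

theorem HHalf.norm_le {CF : ℝ} (hCF : P.IsFriedrichsConstant CF) (q : P.HHalf) :
    ‖q.val‖ ≤ CF * ‖q.grad‖ := q.mem_zero.norm_le hCF

theorem HHalf.inner_le {CF : ℝ} (hCF : P.IsFriedrichsConstant CF) (v : P.L2Q) (q : P.HHalf) :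
    inner ℝ v q.val ≤ CF * ‖v‖ * ‖q.grad‖ :=
  calc inner ℝ v q.val ≤ ‖v‖ * ‖q.val‖ := real_inner_le_norm _ _
    _ ≤ ‖v‖ * (CF * ‖q.grad‖) := by gcongr; exact q.norm_le hCF
    _ = CF * ‖v‖ * ‖q.grad‖ := by ring

theorem IsState.add {v w : P.L2Q} {y z : P.HHalf} (h1 : P.IsState v y) (h2 : P.IsState w z) :
    P.IsState (v + w) (y + z) := fun q => by
  rw [stateForm_add_left, h1 q, h2 q, inner_add_left]

theorem IsState.sub {v w : P.L2Q} {y z : P.HHalf} (h1 : P.IsState v y) (h2 : P.IsState w z) :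
    P.IsState (v - w) (y - z) := fun q => by
  rw [stateForm_sub_left, h1 q, h2 q, inner_sub_left]

theorem IsState.smul (c : ℝ) {v : P.L2Q} {y : P.HHalf} (h : P.IsState v y) :
    P.IsState (c • v) (c • y) := fun q => by
  rw [stateForm_smul_left, h q, real_inner_smul_left]

theorem IsState.stability {CF : ℝ} (hCF : P.IsFriedrichsConstant CF) {v : P.L2Q} {y : P.HHalf}
    (h : P.IsState v y) :
    P.μ₁ ^ 2 * (‖y.grad‖ ^ 2 + P.halfNormSq y.val) ≤ (CF * ‖v‖) ^ 2 :=
  HHalf.inf_sup fun q => by rw [h q]; exact q.inner_le hCF v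

theorem IsState.norm_grad_le {CF : ℝ} (hCF : P.IsFriedrichsConstant CF) {v : P.L2Q} {y : P.HHalf}
    (h : P.IsState v y) : P.μ₁ * ‖y.grad‖ ≤ CF * ‖v‖ :=
  mul_norm_le_of_sq y.halfNormSq_nonneg (mul_nonneg hCF.1.le (norm_nonneg _))
    (h.stability hCF)

theorem IsState.unique {CF : ℝ} (hCF : P.IsFriedrichsConstant CF) {v : P.L2Q} {y z : P.HHalf}
    (h1 : P.IsState v y) (h2 : P.IsState v z) : y = z := by
  have h := (h1.sub h2).norm_grad_le hCF
  rw [sub_self, norm_zero, mul_zero] at h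
  have h3 : ‖(y - z).grad‖ = 0 :=
    le_antisymm (nonpos_of_mul_nonpos_right h μ₁_pos) (norm_nonneg _)
  have h4 := (y - z).norm_le hCF
  rw [h3, mul_zero, norm_le_zero_iff, HHalf.sub_val, sub_eq_zero] at h4
  exact HHalf.ext_val h4

theorem exists_isState {CF : ℝ} (hCF : P.IsFriedrichsConstant CF) (v : P.L2Q) :
    ∃ y : P.HHalf, P.IsState v y := by
  obtain ⟨y, hy⟩ := exists_solution hCF (one_mul 1) v 0
  refine ⟨y, fun q => ?_⟩
  have := hy q
  rwa [one_mul, inner_zero_left, add_zero] at this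

theorem R₁_def (η : P.HOne) (τ : P.HDiv) (v : P.L2Q) :
    P.R₁ η τ v = P.mulσ η.dt - τ.div - v := rfl

theorem R₂_def (η : P.HOne) (τ : P.HDiv) : P.R₂ η τ = τ.val - P.mulν η.grad := rfl

theorem stateRes_nonneg {CF : ℝ} (hCF : 0 < CF) (η : P.HOne) (τ : P.HDiv) (v : P.L2Q) :
    0 ≤ P.stateRes CF η τ v :=
  add_nonneg (mul_nonneg hCF.le (norm_nonneg _)) (norm_nonneg _)

theorem adjointRes_nonneg (gd : P.L2Qd) {CF : ℝ} (hCF : 0 < CF) (ζ : P.HOne) (ρ : P.HDiv)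
    (η : P.HOne) : 0 ≤ P.adjointRes gd CF ζ ρ η :=
  add_nonneg (mul_nonneg hCF.le (norm_nonneg _)) (norm_nonneg _)

/-- Adding ⟨∇·τ, q⟩ + ⟨τ, ∇q⟩ = 0 splits the defect of η in the state equation into the equilibrium
residual R₁ and the flux residual R₂. -/
theorem IsState.residual {v : P.L2Q} {y : P.HHalf} (h : P.IsState v y) (η : P.HOne) (τ : P.HDiv)
    (q : P.HHalf) : P.stateForm (y - η.toHalf) q =
      inner ℝ (-P.R₁ η τ v) q.val + inner ℝ (P.R₂ η τ) q.grad := by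
  have h1 := τ.inner_add_eq_zero q
  rw [stateForm_sub_left, h q, stateForm_toHalf, R₁_def, R₂_def, inner_neg_left, inner_sub_left,
    inner_sub_left, inner_sub_left]
  linarith

/-- By Friedrichs' inequality the residual functional is at most `stateRes` times ‖∇q‖, which is the
input of the inf-sup condition. -/
theorem IsState.norm_grad_sub_le {CF : ℝ} (hCF : P.IsFriedrichsConstant CF) {v : P.L2Q}
    {y : P.HHalf} (h : P.IsState v y) (η : P.HOne) (τ : P.HDiv) :
    P.μ₁ * ‖y.grad - η.grad‖ ≤ P.stateRes CF η τ v := by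
  refine mul_norm_le_of_sq (y - η.toHalf).halfNormSq_nonneg
    (stateRes_nonneg hCF.1 η τ v) (HHalf.inf_sup (w := y - η.toHalf) fun q => ?_)
  rw [h.residual η τ q]
  have h1 := q.inner_le hCF (-P.R₁ η τ v)
  have h2 := real_inner_le_norm (P.R₂ η τ) q.grad
  rw [norm_neg] at h1
  rw [stateRes, add_mul]
  exact add_le_add h1 h2

/-! ### First order optimality condition -/

variable (P) in
/-- The Euler equation of the control problem. -/
def FirstOrder (gd : P.L2Qd) (lam : ℝ) (y : P.HHalf) (u : P.L2Q) : Prop :=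
  P.IsState u y ∧ ∀ (w : P.L2Q) (z : P.HHalf), P.IsState w z →
    inner ℝ (y.grad - gd) z.grad + lam * inner ℝ u w = 0

/-- Along u + tw the excess of the cost over its minimum is a nonnegative quadratic in t without
constant term; the discriminant forces its linear coefficient to vanish. -/
theorem IsOptimal.firstOrder {gd : P.L2Qd} {lam : ℝ} {y : P.HHalf} {u : P.L2Q}
    (h : P.IsOptimal gd lam y u) : P.FirstOrder gd lam y u := by
  refine ⟨h.1, fun w z hz => ?_⟩
  have key : ∀ t : ℝ, 0 ≤ (1 / 2 * ‖z.grad‖ ^ 2 + lam / 2 * ‖w‖ ^ 2) * (t * t) +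
      (inner ℝ (y.grad - gd) z.grad + lam * inner ℝ u w) * t + 0 := fun t => by
    have h1 := h.2 _ _ (h.1.add (hz.smul t))
    have e1 : ‖(y + t • z).grad - gd‖ ^ 2 = ‖y.grad - gd‖ ^ 2 +
        2 * (t * inner ℝ (y.grad - gd) z.grad) + t ^ 2 * ‖z.grad‖ ^ 2 := by
      rw [HHalf.add_grad, HHalf.smul_grad, add_sub_right_comm, norm_add_sq_real,
        real_inner_smul_right, norm_smul, mul_pow, Real.norm_eq_abs, sq_abs]
    have e2 : ‖u + t • w‖ ^ 2 = ‖u‖ ^ 2 + 2 * (t * inner ℝ u w) + t ^ 2 * ‖w‖ ^ 2 := by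
      rw [norm_add_sq_real, real_inner_smul_right, norm_smul, mul_pow, Real.norm_eq_abs, sq_abs]
    rw [cost, cost, e1, e2] at h1
    linarith
  have h2 := discrim_le_zero key
  rw [discrim, mul_zero, sub_zero] at h2
  exact pow_eq_zero_iff two_ne_zero |>.1 (le_antisymm h2 (sq_nonneg _))

/-- The cost is quadratic: its second-order part at (y, u) is the error measure, and its linear part
in the direction (z - y, v - u) is zero by the Euler equation. -/
theorem FirstOrder.errSq_eq {gd : P.L2Qd} {lam : ℝ} {y z : P.HHalf} {u v : P.L2Q}
    (h : P.FirstOrder gd lam y u) (hz : P.IsState v z) :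
    P.errSq lam y u z v = P.cost gd lam z v - P.cost gd lam y u := by
  have h1 := h.2 _ _ (hz.sub h.1)
  have e1 : ‖z.grad - gd‖ ^ 2 = ‖y.grad - gd‖ ^ 2 +
      2 * inner ℝ (y.grad - gd) (z - y).grad + ‖y.grad - z.grad‖ ^ 2 := by
    rw [HHalf.sub_grad, norm_sub_rev y.grad z.grad, ← norm_add_sq_real]
    congr 2
    abel
  have e2 : ‖v‖ ^ 2 = ‖u‖ ^ 2 + 2 * inner ℝ u (v - u) + ‖u - v‖ ^ 2 := by
    rw [norm_sub_rev u v, ← norm_add_sq_real]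
    congr 2
    abel
  rw [errSq, cost, cost, e1, e2]
  linarith

theorem errSq_nonneg {lam : ℝ} (hlam : 0 < lam) (y z : P.HHalf) (u v : P.L2Q) :
    0 ≤ P.errSq lam y u z v := by
  rw [errSq]; positivity

theorem FirstOrder.isOptimal {gd : P.L2Qd} {lam : ℝ} (hlam : 0 < lam) {y : P.HHalf} {u : P.L2Q}
    (h : P.FirstOrder gd lam y u) : P.IsOptimal gd lam y u :=
  ⟨h.1, fun w z hz => by linarith [h.errSq_eq hz, errSq_nonneg hlam y z u w]⟩

/-- The error identities with the two critical points exchanged have right sides of opposite sign,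
so both errors are zero. -/
theorem FirstOrder.unique {gd : P.L2Qd} {lam : ℝ} (hlam : 0 < lam) {y z : P.HHalf} {u v : P.L2Q}
    (h1 : P.FirstOrder gd lam y u) (h2 : P.FirstOrder gd lam z v) : u = v := by
  have h3 := h1.errSq_eq h2.1
  have h4 := h2.errSq_eq h1.1
  have h5 := errSq_nonneg hlam z y v u
  have h6 : lam / 2 * ‖u - v‖ ^ 2 ≤ 0 := by
    have : P.errSq lam y u z v ≤ 0 := by linarith
    rw [errSq] at this
    linarith [sq_nonneg ‖y.grad - z.grad‖]
  have h7 : ‖u - v‖ ^ 2 ≤ 0 := nonpos_of_mul_nonpos_right h6 (by positivity)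
  have h8 : ‖u - v‖ = 0 := pow_eq_zero_iff two_ne_zero |>.1 (le_antisymm h7 (sq_nonneg _))
  exact sub_eq_zero.1 (norm_eq_zero.1 h8)

theorem OptimalitySystem.stateForm_adjoint {gd : P.L2Qd} {lam : ℝ} {y p : P.HHalf}
    (h : P.OptimalitySystem gd lam y p) (z : P.HHalf) :
    P.stateForm z p = inner ℝ (y.grad - gd) z.grad := by
  have := h.1 z
  rw [stateForm_swap, inner_sub_left]
  linarith

theorem OptimalitySystem.isState {gd : P.L2Qd} {lam : ℝ} {y p : P.HHalf}
    (h : P.OptimalitySystem gd lam y p) : P.IsState (-(lam⁻¹ • p.val)) y := fun q => by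
  rw [inner_neg_left, real_inner_smul_left]
  linarith [h.2 q]

theorem OptimalitySystem.firstOrder {gd : P.L2Qd} {lam : ℝ} (hlam : 0 < lam) {y p : P.HHalf}
    (h : P.OptimalitySystem gd lam y p) : P.FirstOrder gd lam y (-(lam⁻¹ • p.val)) := by
  refine ⟨h.isState, fun w z hz => ?_⟩
  rw [← h.stateForm_adjoint, hz p, inner_neg_left, real_inner_smul_left,
    real_inner_comm w p.val]
  field_simp
  ring

/-- With p the solution of the adjoint equation, the Euler equation reads ⟨p + λu, w⟩ = 0. Every w
is the control of some state, hence p + λu = 0. -/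
theorem FirstOrder.exists_optimalitySystem {CF : ℝ} (hCF : P.IsFriedrichsConstant CF)
    {gd : P.L2Qd} {lam : ℝ} (hlam : 0 < lam) {y : P.HHalf} {u : P.L2Q}
    (h : P.FirstOrder gd lam y u) :
    ∃ p : P.HHalf, P.OptimalitySystem gd lam y p ∧ u = -(lam⁻¹ • p.val) := by
  obtain ⟨p, hp⟩ := exists_solution hCF (s := -1) (by norm_num) 0 (y.grad - gd)
  have h1 : ∀ z : P.HHalf, inner ℝ (P.mulν p.grad) z.grad - P.halfForm p.val z.val =
      inner ℝ (y.grad - gd) z.grad := fun z => by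
    have := hp z
    rw [inner_zero_left, zero_add] at this
    linarith
  have h2 : ∀ w : P.L2Q, inner ℝ (p.val + lam • u) w = 0 := fun w => by
    obtain ⟨z, hz⟩ := exists_isState hCF w
    rw [← h.2 w z hz, ← h1 z, ← stateForm_swap, hz p, inner_add_left, real_inner_smul_left,
      real_inner_comm w p.val]
  have h3 : p.val + lam • u = 0 := inner_self_eq_zero.1 (h2 _)
  have h4 : u = -(lam⁻¹ • p.val) := by
    rw [eq_neg_of_add_eq_zero_left h3, smul_neg, neg_neg, inv_smul_smul₀ hlam.ne']
  refine ⟨p, ⟨fun z => ?_, fun q => ?_⟩, h4⟩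
  · have := h1 z
    rw [inner_sub_left] at this
    linarith
  · rw [h.1 q, h4, inner_neg_left, real_inner_smul_left]
    ring

/-! ### Existence of an optimal control -/

/-- The control-to-gradient map `v ↦ ∇y(v)`. -/
def gradSolution {CF : ℝ} (hCF : P.IsFriedrichsConstant CF) : P.L2Q →L[ℝ] P.L2Qd :=
  LinearMap.mkContinuous
    { toFun := fun v => (exists_isState hCF v).choose.grad
      map_add' := fun v w => by
        rw [IsState.unique hCF (exists_isState hCF (v + w)).choose_spec
          ((exists_isState hCF v).choose_spec.add (exists_isState hCF w).choose_spec)]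
        rfl
      map_smul' := fun c v => by
        rw [IsState.unique hCF (exists_isState hCF (c • v)).choose_spec
          ((exists_isState hCF v).choose_spec.smul c)]
        rfl }
    (P.μ₁⁻¹ * CF) fun v => by
      have := (exists_isState hCF v).choose_spec.norm_grad_le hCF
      rw [mul_assoc, ← div_eq_inv_mul, le_div_iff₀' μ₁_pos]
      exact this

theorem IsState.gradSolution_eq {CF : ℝ} (hCF : P.IsFriedrichsConstant CF) {v : P.L2Q} {y : P.HHalf}
    (h : P.IsState v y) : gradSolution hCF v = y.grad := by
  rw [h.unique hCF (exists_isState hCF v).choose_spec]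
  rfl

/-- With S the map v ↦ ∇y(v), the Euler equation is (S*S + λ)u = S*g_d, and the left side is
coercive with constant λ. -/
theorem exists_firstOrder {CF : ℝ} (hCF : P.IsFriedrichsConstant CF) (gd : P.L2Qd) {lam : ℝ}
    (hlam : 0 < lam) : ∃ (u : P.L2Q) (y : P.HHalf), P.FirstOrder gd lam y u := by
  have hB : IsCoercive (innerBilin (gradSolution hCF) (gradSolution hCF) +
      lam • innerBilin (ContinuousLinearMap.id ℝ P.L2Q) (ContinuousLinearMap.id ℝ P.L2Q)) := by
    refine ⟨lam, hlam, fun u => ?_⟩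
    change lam * ‖u‖ * ‖u‖ ≤ inner ℝ (gradSolution hCF u) (gradSolution hCF u) + lam * inner ℝ u u
    rw [real_inner_self_eq_norm_sq, real_inner_self_eq_norm_sq]
    linarith [sq_nonneg ‖gradSolution hCF u‖]
  obtain ⟨u, hu⟩ := hB.exists_solution_pair (gradSolution hCF) (ContinuousLinearMap.id ℝ P.L2Q) gd 0
  obtain ⟨y, hy⟩ := exists_isState hCF u
  refine ⟨u, y, hy, fun w z hz => ?_⟩
  have h1 : inner ℝ (gradSolution hCF u) (gradSolution hCF w) + lam * inner ℝ u w =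
      inner ℝ gd (gradSolution hCF w) + inner ℝ (0 : P.L2Q) w := hu w
  rw [hy.gradSolution_eq, hz.gradSolution_eq, inner_zero_left, add_zero] at h1
  rw [inner_sub_left, ← h1]
  ring

end ParabolicProblem
end

noncomputable section

namespace ParabolicProblem

variable {d : ℕ} {P : ParabolicProblem d}

/-! ### Bounds of the cost functional and of the errors -/

theorem add_sq_le_young {α : ℝ} (hα : 0 < α) (x y : ℝ) :
    (x + y) ^ 2 ≤ (1 + α) * (x ^ 2 + y ^ 2 / α) := by
  have h : (1 + α) * (x ^ 2 + y ^ 2 / α) - (x + y) ^ 2 = (α * x - y) ^ 2 / α := by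
    field_simp
    ring
  have : 0 ≤ (α * x - y) ^ 2 / α := by positivity
  linarith

/-- The triangle inequality through ∇η and Young's inequality with α separate the computable part
from ‖∇y - ∇η‖. The latter is bounded by the residuals, which Young's inequality with β splits. -/
theorem IsState.cost_le_Jplus {CF : ℝ} (hCF : P.IsFriedrichsConstant CF) (gd : P.L2Qd) (lam : ℝ)
    {v : P.L2Q} {y : P.HHalf} (h : P.IsState v y) {α β : ℝ} (hα : 0 < α) (hβ : 0 < β)
    (η : P.HOne) (τ : P.HDiv) : P.cost gd lam y v ≤ P.Jplus gd lam CF α β η τ v := by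
  have h1 := h.norm_grad_sub_le hCF η τ
  have hμ : 0 < P.μ₁ := μ₁_pos
  have h2 : ‖y.grad - gd‖ ≤ ‖η.grad - gd‖ + ‖y.grad - η.grad‖ := by
    rw [add_comm]
    exact norm_sub_le_norm_sub_add_norm_sub _ _ _
  have h3 := (pow_le_pow_left₀ (norm_nonneg _) h2 2).trans (add_sq_le_young hα _ _)
  have h4 : ‖y.grad - η.grad‖ ^ 2 ≤
      (1 + β) * (‖P.R₂ η τ‖ ^ 2 + CF ^ 2 / β * ‖P.R₁ η τ v‖ ^ 2) / P.μ₁ ^ 2 := by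
    rw [le_div_iff₀' (by positivity), ← mul_pow]
    refine (pow_le_pow_left₀ (mul_nonneg hμ.le (norm_nonneg _)) h1 2).trans ?_
    -- The order decides which residual carries the weight 1/β: it must be R₁.
    rw [stateRes, add_comm]
    refine (add_sq_le_young hβ _ _).trans_eq ?_
    ring
  have h5 : ‖y.grad - η.grad‖ ^ 2 / α ≤
      (1 + β) * (‖P.R₂ η τ‖ ^ 2 + CF ^ 2 / β * ‖P.R₁ η τ v‖ ^ 2) / P.μ₁ ^ 2 / α := by gcongr
  have h6 : ‖y.grad - gd‖ ^ 2 ≤ (1 + α) * (‖η.grad - gd‖ ^ 2 +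
      (1 + β) * (‖P.R₂ η τ‖ ^ 2 + CF ^ 2 / β * ‖P.R₁ η τ v‖ ^ 2) / P.μ₁ ^ 2 / α) :=
    h3.trans (by gcongr)
  calc P.cost gd lam y v = ‖y.grad - gd‖ ^ 2 / 2 + lam / 2 * ‖v‖ ^ 2 := by rw [cost]; ring
    _ ≤ (1 + α) * (‖η.grad - gd‖ ^ 2 +
      (1 + β) * (‖P.R₂ η τ‖ ^ 2 + CF ^ 2 / β * ‖P.R₁ η τ v‖ ^ 2) / P.μ₁ ^ 2 / α) / 2 +
        lam / 2 * ‖v‖ ^ 2 := by gcongr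
    _ = P.Jplus gd lam CF α β η τ v := by
      rw [Jplus, γ]
      field_simp

theorem stateRes_le_add {CF : ℝ} (hCF : 0 < CF) (η : P.HOne) (τ : P.HDiv) (u v : P.L2Q) :
    P.stateRes CF η τ u ≤ P.stateRes CF η τ v + CF * ‖u - v‖ := by
  have h : P.R₁ η τ u = P.R₁ η τ v - (u - v) := by
    rw [R₁_def, R₁_def]
    abel
  have h1 := norm_sub_le (P.R₁ η τ v) (u - v)
  rw [← h] at h1
  rw [stateRes, stateRes]
  linarith [mul_le_mul_of_nonneg_left h1 hCF.le]

/-- By the definition of R₄, ∇η - g_d = R₄ - ρ + ν∇ζ. Integrating ρ by parts produces R₃ - σ∂ₜζ, and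
the terms in ζ form the transposed state form. -/
theorem inner_grad_sub_eq (gd : P.L2Qd) (η ζ : P.HOne) (ρ : P.HDiv) (e : P.HHalf) :
    inner ℝ (η.grad - gd) e.grad = inner ℝ (P.R₃ ζ ρ) e.val +
      inner ℝ (P.R₄ gd ζ ρ η) e.grad + P.stateForm e ζ.toHalf := by
  have h1 := ρ.inner_add_eq_zero e
  have h2 : P.stateForm e ζ.toHalf = inner ℝ (P.mulν ζ.grad) e.grad -
      inner ℝ (P.mulσ ζ.dt) e.val := by
    rw [stateForm_swap, ← ζ.periodic.halfForm_eq ζ.toHalf.hasHalf e.hasHalf]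
    rfl
  rw [h2, R₃, R₄, inner_add_left, inner_sub_left, inner_sub_left, inner_add_left, inner_sub_left]
  linarith

/-- The cost is expanded about η and ½‖∇y - ∇η‖² is discarded. The linear term costs at most
`adjointRes` times ‖∇y - ∇η‖, and this distance is bounded by the state residual for the control
-λ⁻¹ζ plus C_F‖u + λ⁻¹ζ‖. The unknown last norm is absorbed by the square that completing λ/2‖u‖² +
⟨u, ζ⟩ provides. -/
theorem IsState.Jminus_le_cost {CF : ℝ} (hCF : P.IsFriedrichsConstant CF) (gd : P.L2Qd) {lam : ℝ}
    (hlam : 0 < lam) {u : P.L2Q} {y : P.HHalf} (h : P.IsState u y) (η ζ : P.HOne)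
    (τ ρ : P.HDiv) : P.Jminus gd lam CF η ζ τ ρ ≤ P.cost gd lam y u := by
  have hμ : 0 < P.μ₁ := μ₁_pos
  set A := P.adjointRes gd CF ζ ρ η with hA
  have hA0 : 0 ≤ A := adjointRes_nonneg gd hCF.1 ζ ρ η
  set S := P.stateRes CF η τ (-(lam⁻¹ • ζ.val)) with hS
  set c := ‖u - -(lam⁻¹ • ζ.val)‖ with hc
  have h1 : P.μ₁ * ‖y.grad - η.grad‖ ≤ S + CF * c :=
    (h.norm_grad_sub_le hCF η τ).trans (stateRes_le_add hCF.1 η τ _ _)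
  have h2 : ‖y.grad - gd‖ ^ 2 = ‖η.grad - gd‖ ^ 2 +
      2 * inner ℝ (η.grad - gd) (y - η.toHalf).grad + ‖y.grad - η.grad‖ ^ 2 := by
    change _ = ‖η.grad - gd‖ ^ 2 + 2 * inner ℝ (η.grad - gd) (y.grad - η.grad) +
      ‖y.grad - η.grad‖ ^ 2
    rw [← norm_add_sq_real]
    congr 2
    abel
  have h3 := inner_grad_sub_eq gd η ζ ρ (y - η.toHalf)
  have h4 : P.stateForm (y - η.toHalf) ζ.toHalf = inner ℝ u ζ.val -
      (inner ℝ (P.mulν η.grad) ζ.grad + inner ℝ (P.mulσ η.dt) ζ.val) := by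
    rw [stateForm_sub_left, h, stateForm_toHalf]
    rfl
  have h5 : -(A * ‖y.grad - η.grad‖) ≤ inner ℝ (P.R₃ ζ ρ) (y - η.toHalf).val +
      inner ℝ (P.R₄ gd ζ ρ η) (y - η.toHalf).grad := by
    have e1 := (y - η.toHalf).inner_le hCF (-P.R₃ ζ ρ)
    have e2 := real_inner_le_norm (-P.R₄ gd ζ ρ η) (y - η.toHalf).grad
    rw [norm_neg, inner_neg_left] at e1 e2
    have e3 : A * ‖y.grad - η.grad‖ = CF * ‖P.R₃ ζ ρ‖ * ‖(y - η.toHalf).grad‖ +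
      ‖P.R₄ gd ζ ρ η‖ * ‖(y - η.toHalf).grad‖ := add_mul _ _ _
    linarith
  have h6 : c ^ 2 = ‖u‖ ^ 2 + 2 * (lam⁻¹ * inner ℝ u ζ.val) + (lam⁻¹) ^ 2 * ‖ζ.val‖ ^ 2 := by
    rw [hc, sub_neg_eq_add, norm_add_sq_real, real_inner_smul_right, norm_smul, mul_pow,
      Real.norm_eq_abs, sq_abs]
  have h7 : lam / 2 * ‖u‖ ^ 2 = lam / 2 * c ^ 2 - inner ℝ u ζ.val -
      1 / (2 * lam) * ‖ζ.val‖ ^ 2 := by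
    rw [h6]
    field_simp
    ring
  have h8 : A * ‖y.grad - η.grad‖ ≤ 1 / P.μ₁ * S * A + CF / P.μ₁ * A * c := by
    have : ‖y.grad - η.grad‖ ≤ (S + CF * c) / P.μ₁ := (le_div_iff₀' hμ).2 h1
    refine (mul_le_mul_of_nonneg_left this hA0).trans_eq ?_
    field_simp
  have h9 : 0 ≤ lam / 2 * c ^ 2 - CF / P.μ₁ * A * c + CF ^ 2 / (P.μ₁ ^ 2 * lam) * A ^ 2 := by
    -- Completing the square needs only half of the last coefficient; the surplus is the second
    -- square on the right.
    have : lam / 2 * c ^ 2 - CF / P.μ₁ * A * c + CF ^ 2 / (P.μ₁ ^ 2 * lam) * A ^ 2 =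
        ((lam * c - CF / P.μ₁ * A) ^ 2 + (CF / P.μ₁ * A) ^ 2) / (2 * lam) := by
      field_simp
      ring
    rw [this]
    positivity
  have h10 : 1 / (2 * lam) * ‖ζ.val‖ ^ 2 - lam⁻¹ * ‖ζ.val‖ ^ 2 =
      -(1 / (2 * lam) * ‖ζ.val‖ ^ 2) := by
    field_simp
    ring
  rw [Jminus, cost, crossTerm, ← hA, ← hS, h2, h3, h4, h7]
  linarith [sq_nonneg ‖y.grad - η.grad‖]

theorem FirstOrder.errSq_le_Maj {CF : ℝ} (hCF : P.IsFriedrichsConstant CF) {gd : P.L2Qd} {lam : ℝ}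
    (hlam : 0 < lam) {y z : P.HHalf} {u v : P.L2Q} (h : P.FirstOrder gd lam y u)
    (hz : P.IsState v z) {α β : ℝ} (hα : 0 < α) (hβ : 0 < β) (η ζ : P.HOne) (τ ρ : P.HDiv) :
    P.errSq lam y u z v ≤ P.Maj gd lam CF α β η ζ τ ρ v := by
  rw [h.errSq_eq hz, Maj]
  linarith [hz.cost_le_Jplus hCF gd lam hα hβ η τ, h.1.Jminus_le_cost hCF gd hlam η ζ τ ρ]

/-- The difference of the states has control u - v, and stability bounds its H^{1,1/2} seminorm by
C_F‖u - v‖/μ₁; the weight in the second error measure is chosen to match. -/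
theorem errOneSq_le_errSq {CF : ℝ} (hCF : P.IsFriedrichsConstant CF) {lam : ℝ}
    (hlam : 0 < lam) {y z : P.HHalf} {u v : P.L2Q} (h1 : P.IsState u y) (h2 : P.IsState v z) :
    P.errOneSq lam CF y z ≤ P.errSq lam y u z v := by
  have h3 : P.μ₁ ^ 2 * (‖y.grad - z.grad‖ ^ 2 + P.halfNormSq (y.val - z.val)) ≤
    (CF * ‖u - v‖) ^ 2 := (h1.sub h2).stability hCF
  have h4 : lam / (2 * CF ^ 2) *
      (P.μ₁ ^ 2 * (‖y.grad - z.grad‖ ^ 2 + P.halfNormSq (y.val - z.val))) ≤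
      lam / (2 * CF ^ 2) * (CF * ‖u - v‖) ^ 2 := by gcongr
  have h5 : lam / (2 * CF ^ 2) * (CF * ‖u - v‖) ^ 2 = lam / 2 * ‖u - v‖ ^ 2 := by
    have := hCF.1.ne'
    field_simp
  rw [errOneSq, errSq, mul_div_right_comm, mul_assoc]
  linarith

theorem Maj_le_MajOne (gd : P.L2Qd) {lam : ℝ} (hlam : 0 < lam) (CF α β : ℝ) (η ζ : P.HOne)
    (τ ρ : P.HDiv) (v : P.L2Q) :
    P.Maj gd lam CF α β η ζ τ ρ v ≤ P.MajOne gd lam CF α β η ζ τ ρ v := by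
  rw [Maj, MajOne]
  exact le_add_of_nonneg_right (by positivity)

theorem Maj_eq (gd : P.L2Qd) (lam CF α β : ℝ) (η ζ : P.HOne) (τ ρ : P.HDiv) (v : P.L2Q) :
    P.Maj gd lam CF α β η ζ τ ρ v =
        α / 2 * ‖η.grad - gd‖ ^ 2
        + P.γ α β * (‖P.R₂ η τ‖ ^ 2 + CF ^ 2 / β * ‖P.R₁ η τ v‖ ^ 2)
        + lam / 2 * ‖v‖ ^ 2 - 1 / (2 * lam) * ‖ζ.val‖ ^ 2 + P.crossTerm lam η ζ
        + CF ^ 2 / (P.μ₁ ^ 2 * lam) * (CF * ‖P.R₃ ζ ρ‖ + ‖P.R₄ gd ζ ρ η‖) ^ 2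
        + 1 / P.μ₁ * (CF * ‖P.R₁ η τ (-(lam⁻¹ • ζ.val))‖ + ‖P.R₂ η τ‖)
          * (CF * ‖P.R₃ ζ ρ‖ + ‖P.R₄ gd ζ ρ η‖) := by
  rw [Maj, Jplus, Jminus, stateRes, adjointRes]
  ring

theorem MajOne_eq (gd : P.L2Qd) (lam CF α β : ℝ) (η ζ : P.HOne) (τ ρ : P.HDiv) (v : P.L2Q) :
    P.MajOne gd lam CF α β η ζ τ ρ v = P.Maj gd lam CF α β η ζ τ ρ v
        + 3 * lam / (4 * CF ^ 2) * (CF * ‖P.R₁ η τ v‖ + ‖P.R₂ η τ‖) ^ 2 := rfl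

/-! ### Sharpness of the majorants -/

/-- A state as an element of `H^{1,1}_{0,per}(Q)`. -/
def IsState.toOne {v : P.L2Q} {y : P.HHalf} (h : P.IsState v y) : P.HOne :=
  ⟨y.val, y.grad, h.exists_timeDeriv.choose, y.mem_zero, h.exists_timeDeriv.choose_spec⟩

/-- The flux `ν ∇y` of a state as an element of `H(div,Q)`. -/
def IsState.flux {v : P.L2Q} {y : P.HHalf} (h : P.IsState v y) : P.HDiv :=
  ⟨P.mulν y.grad, P.mulσ h.toOne.dt - v, hasWeakDiv_of_half fun q => by
    have h1 : P.stateForm h.toOne.toHalf q = inner ℝ v q.val := h q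
    rw [stateForm_toHalf] at h1
    rw [inner_sub_left, ← h1]
    change _ - (inner ℝ (P.mulν y.grad) q.grad + _) + _ = _
    ring⟩

theorem IsState.R₁_eq_zero {v : P.L2Q} {y : P.HHalf} (h : P.IsState v y) :
    P.R₁ h.toOne h.flux v = 0 := by
  change P.mulσ h.toOne.dt - (P.mulσ h.toOne.dt - v) - v = 0
  abel

theorem IsState.R₂_eq_zero {v : P.L2Q} {y : P.HHalf} (h : P.IsState v y) :
    P.R₂ h.toOne h.flux = 0 := sub_self (P.mulν y.grad)

/-- At the exact state and flux both state residuals vanish, the cross term simplifies by the state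
equation tested with ζ, and changing the control in R₁ to -λ⁻¹ζ leaves v + λ⁻¹ζ. -/
theorem IsState.Maj_eq {v : P.L2Q} {y : P.HHalf} (h : P.IsState v y) (gd : P.L2Qd)
    (lam CF α β : ℝ) (ζ : P.HOne) (ρ : P.HDiv) :
    P.Maj gd lam CF α β h.toOne ζ h.flux ρ v = α / 2 * ‖y.grad - gd‖ ^ 2 +
      lam / 2 * ‖v‖ ^ 2 - 1 / (2 * lam) * ‖ζ.val‖ ^ 2 +
      (inner ℝ v ζ.val + lam⁻¹ * ‖ζ.val‖ ^ 2)
        + CF ^ 2 / (P.μ₁ ^ 2 * lam) * (CF * ‖P.R₃ ζ ρ‖ + ‖P.R₄ gd ζ ρ h.toOne‖) ^ 2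
        + 1 / P.μ₁ * (CF * ‖v + lam⁻¹ • ζ.val‖)
          * (CF * ‖P.R₃ ζ ρ‖ + ‖P.R₄ gd ζ ρ h.toOne‖) := by
  have h1 : P.crossTerm lam h.toOne ζ = inner ℝ v ζ.val + lam⁻¹ * ‖ζ.val‖ ^ 2 := by
    have : P.stateForm h.toOne.toHalf ζ.toHalf = inner ℝ v ζ.val := h ζ.toHalf
    rw [stateForm_toHalf] at this
    rw [crossTerm, ← this]
    rfl
  have h2 : P.R₁ h.toOne h.flux (-(lam⁻¹ • ζ.val)) = v + lam⁻¹ • ζ.val := by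
    change P.mulσ h.toOne.dt - (P.mulσ h.toOne.dt - v) - -(lam⁻¹ • ζ.val) = _
    abel
  rw [ParabolicProblem.Maj_eq, h1, h2, h.R₁_eq_zero, h.R₂_eq_zero, norm_zero, norm_zero]
  change α / 2 * ‖y.grad - gd‖ ^ 2 + _ + _ - _ + _ + _ + _ = _
  ring

theorem IsState.MajOne_eq {v : P.L2Q} {y : P.HHalf} (h : P.IsState v y) (gd : P.L2Qd)
    (lam CF α β : ℝ) (ζ : P.HOne) (ρ : P.HDiv) :
    P.MajOne gd lam CF α β h.toOne ζ h.flux ρ v = P.Maj gd lam CF α β h.toOne ζ h.flux ρ v := by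
  rw [ParabolicProblem.MajOne_eq, h.R₁_eq_zero, h.R₂_eq_zero, norm_zero, norm_zero]
  ring

theorem cost_adjoint_eq {lam : ℝ} (hlam : 0 < lam) (p : P.L2Q) :
    lam / 2 * ‖-(lam⁻¹ • p)‖ ^ 2 - 1 / (2 * lam) * ‖p‖ ^ 2 +
      (inner ℝ (-(lam⁻¹ • p)) p + lam⁻¹ * ‖p‖ ^ 2) = 0 := by
  rw [norm_neg, norm_smul, mul_pow, Real.norm_eq_abs, sq_abs, inner_neg_left,
    real_inner_smul_left, real_inner_self_eq_norm_sq]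
  field_simp
  ring

/-- If p has a time derivative in L², the adjoint equation says that the divergence of ν∇p - (∇y -
g_d) is -σ∂ₜp. Hence R₃ = R₄ = 0, and the remaining terms in p cancel by `cost_adjoint_eq`. -/
theorem OptimalitySystem.exists_exact_flux {gd : P.L2Qd} {lam : ℝ} (hlam : 0 < lam)
    {y p : P.HHalf} (h : P.OptimalitySystem gd lam y p) {ζ : P.HOne} (hζ : ζ.val = p.val) :
    ∃ ρ : P.HDiv, ρ.val = P.mulν p.grad - (y.grad - gd) ∧ ∀ CF α β : ℝ,
      P.Maj gd lam CF α β h.isState.toOne ζ h.isState.flux ρ (-(lam⁻¹ • p.val)) =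
        α / 2 * ‖y.grad - gd‖ ^ 2 := by
  have hg : ζ.grad = p.grad := by
    have := ζ.mem_zero
    rw [hζ] at this
    exact this.grad_unique p.mem_zero
  have hw : P.HasWeakDiv (P.mulν p.grad - (y.grad - gd)) (-P.mulσ ζ.dt) :=
    hasWeakDiv_of_half fun q => by
      have h1 := h.stateForm_adjoint q
      have h2 := ζ.periodic.halfForm_eq ζ.toHalf.hasHalf q.hasHalf
      have h3 : P.halfForm p.val q.val = inner ℝ (P.mulσ ζ.dt) q.val := by rw [← hζ]; exact h2
      rw [stateForm_swap, h3] at h1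
      rw [inner_neg_left, inner_sub_left, ← h1]
      ring
  refine ⟨⟨_, _, hw⟩, rfl, fun CF α β => ?_⟩
  rw [h.isState.Maj_eq]
  have h3 : P.R₃ ζ ⟨_, _, hw⟩ = 0 := neg_add_cancel (P.mulσ ζ.dt)
  have h4 : P.R₄ gd ζ ⟨_, _, hw⟩ h.isState.toOne = 0 := by
    change P.mulν p.grad - (y.grad - gd) - P.mulν ζ.grad + y.grad - gd = 0
    rw [hg]
    abel
  rw [h3, h4, hζ, norm_zero, norm_zero]
  linear_combination cost_adjoint_eq hlam p.val

/-- Testing the adjoint equation with truncated q and moving the truncation over shows that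
truncated flux and truncated adjoint state still satisfy the equation exactly. -/
theorem OptimalitySystem.hasWeakDiv_trunc {gd : P.L2Qd} {lam : ℝ} {y p : P.HHalf}
    (h : P.OptimalitySystem gd lam y p) {s : Finset ℤ} (hs : ∀ n, -n ∈ s ↔ n ∈ s) :
    P.HasWeakDiv (trunc s (P.mulν p.grad - (y.grad - gd)))
      (-P.mulσ (HOne.ofTrunc hs p.mem_zero).dt) := by
  refine hasWeakDiv_of_half fun q => ?_
  have h1 := h.stateForm_adjoint (.ofHalf (q.mem_zero.trunc s) (q.hasHalf.trunc s))
  rw [stateForm_swap] at h1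
  simp only [HHalf.ofHalf] at h1
  have h2 := (HOne.ofTrunc hs p.mem_zero).periodic.halfForm_eq
    (HOne.ofTrunc hs p.mem_zero).toHalf.hasHalf q.hasHalf
  rw [halfForm_trunc hs p.hasHalf q.hasHalf] at h1
  change P.halfForm (trunc s p.val) q.val = _ at h2
  rw [h2] at h1
  rw [inner_neg_left, inner_trunc_comm, inner_sub_left, ← h1]
  ring

/-- The time derivatives of the truncations need not converge, but they enter only through R₃, which
is zero at every stage, and through the cross term, which the state equation rewrites without them.
All other terms are continuous in ζ, ∇ζ and ρ. -/
theorem OptimalitySystem.exists_tendsto {gd : P.L2Qd} {lam : ℝ} (hlam : 0 < lam)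
    {y p : P.HHalf} (h : P.OptimalitySystem gd lam y p) :
    ∃ (ζ : ℕ → P.HOne) (ρ : ℕ → P.HDiv),
      Tendsto (fun n => (ζ n).val) atTop (𝓝 p.val) ∧
      Tendsto (fun n => (ζ n).grad) atTop (𝓝 p.grad) ∧
      Tendsto (fun n => (ρ n).val) atTop (𝓝 (P.mulν p.grad - (y.grad - gd))) ∧
      ∀ CF α β : ℝ, Tendsto (fun n => P.Maj gd lam CF α β h.isState.toOne (ζ n) h.isState.flux
        (ρ n) (-(lam⁻¹ • p.val))) atTop (𝓝 (α / 2 * ‖y.grad - gd‖ ^ 2)) := by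
  let ζ : ℕ → P.HOne := fun N => .ofTrunc (neg_mem_Icc_iff N) p.mem_zero
  let ρ : ℕ → P.HDiv := fun N => ⟨_, _, h.hasWeakDiv_trunc (neg_mem_Icc_iff N)⟩
  have h1 : Tendsto (fun n => (ζ n).val) atTop (𝓝 p.val) := tendsto_trunc p.val
  have h2 : Tendsto (fun n => (ζ n).grad) atTop (𝓝 p.grad) := tendsto_trunc p.grad
  have h3 : Tendsto (fun n => (ρ n).val) atTop (𝓝 (P.mulν p.grad - (y.grad - gd))) :=
    tendsto_trunc (P.mulν p.grad - (y.grad - gd))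
  refine ⟨ζ, ρ, h1, h2, h3, fun CF α β => ?_⟩
  have h4 : ∀ n, P.R₃ (ζ n) (ρ n) = 0 := fun n => neg_add_cancel (P.mulσ (ζ n).dt)
  have h5 : Tendsto (fun n => P.R₄ gd (ζ n) (ρ n) h.isState.toOne) atTop (𝓝 0) := by
    have e1 : Tendsto (fun n => P.mulν (ζ n).grad) atTop (𝓝 (P.mulν p.grad)) :=
      (P.isCoeff_ν.mulQ.continuous.tendsto p.grad).comp h2
    have e2 := ((h3.sub e1).add_const y.grad).sub_const gd
    have e3 : P.mulν p.grad - (y.grad - gd) - P.mulν p.grad + y.grad - gd = 0 := by abel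
    rwa [e3] at e2
  have h6 : Tendsto (fun n => CF * ‖P.R₃ (ζ n) (ρ n)‖ + ‖P.R₄ gd (ζ n) (ρ n) h.isState.toOne‖)
      atTop (𝓝 0) := by
    simp only [h4, norm_zero, mul_zero, zero_add]
    simpa only [norm_zero] using h5.norm
  have h7 : Tendsto (fun n => ‖-(lam⁻¹ • p.val) + lam⁻¹ • (ζ n).val‖) atTop
      (𝓝 ‖-(lam⁻¹ • p.val) + lam⁻¹ • p.val‖) := ((h1.const_smul lam⁻¹).const_add _).norm
  have h8 : Tendsto (fun n => ‖(ζ n).val‖ ^ 2) atTop (𝓝 (‖p.val‖ ^ 2)) := h1.norm.pow 2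
  have h9 : Tendsto (fun n => inner ℝ (-(lam⁻¹ • p.val)) (ζ n).val) atTop
      (𝓝 (inner ℝ (-(lam⁻¹ • p.val)) p.val)) := tendsto_const_nhds.inner h1
  simp only [h.isState.Maj_eq]
  have h10 := (((h8.const_mul (1 / (2 * lam))).const_sub
    (α / 2 * ‖y.grad - gd‖ ^ 2 + lam / 2 * ‖-(lam⁻¹ • p.val)‖ ^ 2)).add
    (h9.add (h8.const_mul lam⁻¹))).add ((h6.pow 2).const_mul (CF ^ 2 / (P.μ₁ ^ 2 * lam))) |>.add
    (((h7.const_mul CF).const_mul (1 / P.μ₁)).mul h6)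
  convert h10 using 2
  linear_combination -cost_adjoint_eq hlam p.val

/-- A lower bound of a set that contains a sequence converging to `a / 2 * c` for all `a > 0` is at
most zero; together with nonnegativity the infimum is zero. -/
theorem isGLB_zero_of_tendsto {s : Set ℝ} {c : ℝ} (h0 : ∀ m ∈ s, 0 ≤ m)
    (h : ∀ a : ℝ, 0 < a → ∃ x : ℕ → ℝ, (∀ n, x n ∈ s) ∧ Tendsto x atTop (𝓝 (a / 2 * c))) :
    IsGLB s 0 := by
  refine ⟨h0, fun b hb => ?_⟩
  have h1 : ∀ a : ℝ, 0 < a → b ≤ a / 2 * c := fun a ha => by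
    obtain ⟨x, hx, hl⟩ := h a ha
    exact ge_of_tendsto' hl fun n => hb (hx n)
  have h2 : Tendsto (fun a : ℝ => a / 2 * c) (𝓝[>] 0) (𝓝 0) := by
    have : Continuous fun a : ℝ => a / 2 * c := by fun_prop
    have h3 := this.tendsto 0
    rw [zero_div, zero_mul] at h3
    exact h3.mono_left nhdsWithin_le_nhds
  exact ge_of_tendsto h2 (eventually_nhdsWithin_of_forall fun a ha => h1 a ha)

end ParabolicProblem
end

/-! ### Assembly of the theorem -/

theorem mainTheorem10 {d : ℕ} (P : ParabolicProblem d) (lam CF : ℝ) (hlam : 0 < lam)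
    (hCF : P.IsFriedrichsConstant CF) (gd : P.L2Qd) :
    -- the state `y(v)` and the optimal control `u` are well defined
    (∀ v : P.L2Q, ∃! y : P.HHalf, P.IsState v y) ∧
    (∃! u : P.L2Q, ∃ y : P.HHalf, P.IsOptimal gd lam y u) ∧
    -- optimality is equivalent to the optimality system with `u = -λ⁻¹ p`
    (∀ (y : P.HHalf) (u : P.L2Q), P.IsOptimal gd lam y u ↔
      ∃ p : P.HHalf, P.OptimalitySystem gd lam y p ∧ u = -(lam⁻¹ • p.val)) ∧
    -- the error identity and the two error majorants
    (∀ (u v : P.L2Q) (yu yv : P.HHalf), P.IsOptimal gd lam yu u → P.IsState v yv →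
      P.errSq lam yu u yv v = P.cost gd lam yv v - P.cost gd lam yu u ∧
      ∀ (α β : ℝ) (η ζ : P.HOne) (τ ρ : P.HDiv), 0 < α → 0 < β →
        P.errSq lam yu u yv v ≤ P.Maj gd lam CF α β η ζ τ ρ v ∧
        P.errOneSq lam CF yu yv ≤ P.MajOne gd lam CF α β η ζ τ ρ v) ∧
    -- the expanded form of the majorants
    (∀ (α β : ℝ) (η ζ : P.HOne) (τ ρ : P.HDiv) (v : P.L2Q), 0 < α → 0 < β →
      P.Maj gd lam CF α β η ζ τ ρ v =
        α / 2 * ‖η.grad - gd‖ ^ 2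
        + P.γ α β * (‖P.R₂ η τ‖ ^ 2 + CF ^ 2 / β * ‖P.R₁ η τ v‖ ^ 2)
        + lam / 2 * ‖v‖ ^ 2 - 1 / (2 * lam) * ‖ζ.val‖ ^ 2 + P.crossTerm lam η ζ
        + CF ^ 2 / (P.μ₁ ^ 2 * lam) * (CF * ‖P.R₃ ζ ρ‖ + ‖P.R₄ gd ζ ρ η‖) ^ 2
        + 1 / P.μ₁ * (CF * ‖P.R₁ η τ (-(lam⁻¹ • ζ.val))‖ + ‖P.R₂ η τ‖)
          * (CF * ‖P.R₃ ζ ρ‖ + ‖P.R₄ gd ζ ρ η‖) ∧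
      P.MajOne gd lam CF α β η ζ τ ρ v = P.Maj gd lam CF α β η ζ τ ρ v
        + 3 * lam / (4 * CF ^ 2) * (CF * ‖P.R₁ η τ v‖ + ‖P.R₂ η τ‖) ^ 2) ∧
    -- the infima of the majorants vanish
    IsGLB {m : ℝ | ∃ (α β : ℝ) (η ζ : P.HOne) (τ ρ : P.HDiv) (v : P.L2Q),
      0 < α ∧ 0 < β ∧ m = P.Maj gd lam CF α β η ζ τ ρ v} 0 ∧
    IsGLB {m : ℝ | ∃ (α β : ℝ) (η ζ : P.HOne) (τ ρ : P.HDiv) (v : P.L2Q),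
      0 < α ∧ 0 < β ∧ m = P.MajOne gd lam CF α β η ζ τ ρ v} 0 ∧
    -- the infima are reached at the solution of the optimality system, as `α → 0`
    (∀ (y p : P.HHalf) (u : P.L2Q), P.OptimalitySystem gd lam y p → u = -(lam⁻¹ • p.val) →
      ∃ (η : P.HOne) (τ : P.HDiv),
        η.val = y.val ∧ η.grad = y.grad ∧ τ.val = P.mulν y.grad ∧
        -- exactly, if `p` lies in `H^{1,1}_{0,per}(Q)`
        (∀ ζ : P.HOne, ζ.val = p.val →
          ∃ ρ : P.HDiv, ρ.val = P.mulν p.grad - (y.grad - gd) ∧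
            ∀ α β : ℝ, 0 < α → 0 < β →
              P.Maj gd lam CF α β η ζ τ ρ u = α / 2 * ‖y.grad - gd‖ ^ 2 ∧
              P.MajOne gd lam CF α β η ζ τ ρ u = α / 2 * ‖y.grad - gd‖ ^ 2) ∧
        -- in the limit, in general
        (∃ (ζ : ℕ → P.HOne) (ρ : ℕ → P.HDiv),
          Tendsto (fun n => (ζ n).val) atTop (𝓝 p.val) ∧
          Tendsto (fun n => (ζ n).grad) atTop (𝓝 p.grad) ∧
          Tendsto (fun n => (ρ n).val) atTop (𝓝 (P.mulν p.grad - (y.grad - gd))) ∧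
          ∀ α β : ℝ, 0 < α → 0 < β →
            Tendsto (fun n => P.Maj gd lam CF α β η (ζ n) τ (ρ n) u) atTop
              (𝓝 (α / 2 * ‖y.grad - gd‖ ^ 2)) ∧
            Tendsto (fun n => P.MajOne gd lam CF α β η (ζ n) τ (ρ n) u) atTop
              (𝓝 (α / 2 * ‖y.grad - gd‖ ^ 2)))) := by
  have hopt : ∀ (y : P.HHalf) (u : P.L2Q), P.IsOptimal gd lam y u ↔ P.FirstOrder gd lam y u :=
    fun y u => ⟨ParabolicProblem.IsOptimal.firstOrder, fun h => h.isOptimal hlam⟩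
  obtain ⟨u₀, y₀, h₀⟩ := ParabolicProblem.exists_firstOrder hCF gd hlam
  obtain ⟨p₀, hp₀, rfl⟩ := h₀.exists_optimalitySystem hCF hlam
  -- The majorant dominates an error measure, taken at the state of v; this gives the lower bound 0
  -- for both infima.
  have hnonneg : ∀ (α β : ℝ) (η ζ : P.HOne) (τ ρ : P.HDiv) (v : P.L2Q), 0 < α → 0 < β →
      0 ≤ P.Maj gd lam CF α β η ζ τ ρ v := fun α β η ζ τ ρ v hα hβ => by
    obtain ⟨z, hz⟩ := ParabolicProblem.exists_isState hCF v
    exact (ParabolicProblem.errSq_nonneg hlam _ _ _ _).trans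
      (h₀.errSq_le_Maj hCF hlam hz hα hβ η ζ τ ρ)
  refine ⟨fun v => ?_, ?_, fun y u => ?_, fun u v yu yv hu hv => ?_,
    fun α β η ζ τ ρ v _ _ => ⟨ParabolicProblem.Maj_eq gd lam CF α β η ζ τ ρ v, rfl⟩,
    ParabolicProblem.isGLB_zero_of_tendsto (c := ‖y₀.grad - gd‖ ^ 2) ?_ fun α hα => ?_,
    ParabolicProblem.isGLB_zero_of_tendsto (c := ‖y₀.grad - gd‖ ^ 2) ?_ fun α hα => ?_,
    fun y p u h hu => ?_⟩
  · obtain ⟨y, hy⟩ := ParabolicProblem.exists_isState hCF v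
    exact ⟨y, hy, fun z hz => ParabolicProblem.IsState.unique hCF hz hy⟩
  · refine ⟨_, ⟨y₀, (hopt _ _).2 h₀⟩, ?_⟩
    rintro v ⟨z, hz⟩
    exact ((hopt _ _).1 hz).unique hlam h₀
  · rw [hopt]
    constructor
    · exact fun h => h.exists_optimalitySystem hCF hlam
    · rintro ⟨p, hp, rfl⟩
      exact hp.firstOrder hlam
  · have hf := (hopt _ _).1 hu
    refine ⟨hf.errSq_eq hv, fun α β η ζ τ ρ hα hβ => ?_⟩
    have h1 := hf.errSq_le_Maj hCF hlam hv hα hβ η ζ τ ρ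
    exact ⟨h1, ((ParabolicProblem.errOneSq_le_errSq hCF hlam hu.1 hv).trans h1).trans
      (ParabolicProblem.Maj_le_MajOne gd hlam CF α β η ζ τ ρ v)⟩
  · rintro m ⟨α, β, η, ζ, τ, ρ, v, hα, hβ, rfl⟩
    exact hnonneg α β η ζ τ ρ v hα hβ
  · obtain ⟨ζ, ρ, -, -, -, h⟩ := hp₀.exists_tendsto hlam
    -- The choice β = 1 is arbitrary, since the limit along the truncations depends on α alone.
    exact ⟨_, fun n => ⟨α, 1, _, _, _, _, _, hα, one_pos, rfl⟩, h CF α 1⟩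
  · rintro m ⟨α, β, η, ζ, τ, ρ, v, hα, hβ, rfl⟩
    exact (hnonneg α β η ζ τ ρ v hα hβ).trans
      (ParabolicProblem.Maj_le_MajOne gd hlam CF α β η ζ τ ρ v)
  · obtain ⟨ζ, ρ, -, -, -, h⟩ := hp₀.exists_tendsto hlam
    exact ⟨_, fun n => ⟨α, 1, _, _, _, _, _, hα, one_pos, (hp₀.isState.MajOne_eq _ _ _ _ _ _ _).symm⟩,
      h CF α 1⟩
  · subst hu
    refine ⟨h.isState.toOne, h.isState.flux, rfl, rfl, rfl, fun ζ hζ => ?_, ?_⟩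
    · obtain ⟨ρ, hρ, hm⟩ := h.exists_exact_flux hlam hζ
      exact ⟨ρ, hρ, fun α β _ _ =>
        ⟨hm CF α β, (h.isState.MajOne_eq gd lam CF α β ζ ρ).trans (hm CF α β)⟩⟩
    · obtain ⟨ζ, ρ, h1, h2, h3, h4⟩ := h.exists_tendsto hlam
      refine ⟨ζ, ρ, h1, h2, h3, fun α β _ _ => ⟨h4 CF α β, ?_⟩⟩
      simp only [h.isState.MajOne_eq]
      exact h4 CF α β
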